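/- Consider the one-dimensional thin-film free boundary problem $$u_t+(u\,u_{xxx})_x=0\ \text{ for } t>0,\ \lambda_-(t)<x<\lambda_+(t),\qquad u(t,\lambda_\pm(t))=0,\quad |u_x(t,\lambda_\pm(t))|=1,\quad \lim_{x\to\lambda_\pm(t)}u_{xxx}(t,x)=\dot\lambda_\pm(t)\ \text{ for } t>0 .$$ A global smooth solution is a triple $(u,\lambda_-,\lambda_+)$ with $\lambda_-(t)<\lambda_+(t)$ and $u(t,\cdot)>0$ on $(\lambda_-(t),\lambda_+(t))$ for all $t\ge 0$, which satisfies these relations, such that $\lambda_\pm$ are $C^\infty$ on $(0,\infty)$ and continuous on $[0,\infty)$, $u$ is $C^\infty$ on $\{t>0,\ \lambda_-(t)\le x\le\lambda_+(t)\}$, $u_0=u(0,\cdot)$ is $C^2$ on $[\lambda_-(0),\lambda_+(0)]$, and $u,u_x,u_{xx}$ are continuous on $\{t\ge 0,\ \lambda_-(t)\le x\le\lambda_+(t)\}$. Let $u^\infty(y)=\tfrac12(1-y^2)_+$. For a global smooth solution with mass $\int_{\lambda_-(0)}^{\lambda_+(0)}u_0\,dx=\tfrac23$ and center of mass $\int_{\lambda_-(0)}^{\lambda_+(0)}x\,u_0\,dx=0$,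 let $Z(t,y)\in[\lambda_-(t),\lambda_+(t)]$ be the mass Lagrangian variable, defined for $t\ge0$, $y\in[-1,1]$ by $$\int_{\lambda_-(t)}^{Z(t,y)}u(t,x)\,dx=\frac12\int_{-1}^{y}(1-s^2)\,ds ,$$ and put $$\tilde u(t,y)=u(t,Z(t,y)),\qquad \tilde u_0=\tilde u(0,\cdot),\qquad E(t)=\frac12\int_{-1}^{1}\Big|\partial_y\Big(\frac{\tilde u(t,y)}{u^\infty(y)}\Big)\Big|^2dy .$$ There exist constants $c_0>0$, $\gamma>0$ and $C>0$ such that every global smooth solution with mass $\tfrac23$, center of mass $0$ and $E(0)<c_0$ satisfies $$\|\tilde u_0-u^\infty\|_{L^\infty(-1,1)}\le C\,c_0,$$ and, for all $t\ge 0$, $$E(t)\le E(0)\,e^{-\gamma t}\qquad\text{and}\qquad \|\tilde u(t)-u^\infty\|_{L^\infty(-1,1)}\le C\,e^{-\frac{\gamma}{2}t}.$$ -/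

import Mathlib

open MeasureTheory Set Filter Topology
open scoped ContDiff

namespace ThinFilm

noncomputable section

/-- The space-time region `{(t, x) : t ∈ I, lL t ≤ x ≤ lR t}` occupied by the film during the
set of times `I`, with both contact points `lL t`, `lR t` included. -/
def region (I : Set ℝ) (lL lR : ℝ → ℝ) : Set (ℝ × ℝ) :=
  {p | p.1 ∈ I ∧ p.2 ∈ Icc (lL p.1) (lR p.1)}

/-- `u` (film height `u t x`), with left and right contact points `lL`, `lR`, is a global smooth
solution of the free boundary problem
`u_t + (u u_xxx)_x = 0` in `lL t < x < lR t`, with `u = 0`, `|u_x| = 1` and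
`u_xxx = ` velocity of the contact point, at both contact points, for all `t > 0`.

Smooth means: `lL`, `lR` are `C^∞` for `t > 0`, and `u` is `C^∞` for `t > 0`, up to the
contact points. The initial datum `u 0` is attained in the sense that `lL`, `lR` and `u`, `u_x`,
`u_xx` are continuous up to `t = 0` (on the closed region, contact points included).
Values of `u` off the film, or at negative times, are irrelevant. -/
structure IsGlobalSmoothSolution (u : ℝ → ℝ → ℝ) (lL lR : ℝ → ℝ) : Prop where
  lt : ∀ t, 0 ≤ t → lL t < lR t
  left_continuous : ContinuousOn lL (Ici 0)
  right_continuous : ContinuousOn lR (Ici 0)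
  left_smooth : ContDiffOn ℝ ∞ lL (Ioi 0)
  right_smooth : ContDiffOn ℝ ∞ lR (Ioi 0)
  smooth : ContDiffOn ℝ ∞ (fun p : ℝ × ℝ => u p.1 p.2) (region (Ioi 0) lL lR)
  initial_smooth : ContDiffOn ℝ 2 (u 0) (Icc (lL 0) (lR 0))
  initial_attained : ∀ k : ℕ, k ≤ 2 →
    ContinuousOn
      (fun p : ℝ × ℝ => iteratedDerivWithin k (u p.1) (Icc (lL p.1) (lR p.1)) p.2)
      (region (Ici 0) lL lR)
  pos : ∀ t, 0 ≤ t → ∀ x ∈ Ioo (lL t) (lR t), 0 < u t x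
  equation : ∀ t, 0 < t → ∀ x ∈ Ioo (lL t) (lR t),
    deriv (fun s => u s x) t + deriv (fun z => u t z * iteratedDeriv 3 (u t) z) x = 0
  left_zero : ∀ t, 0 < t → u t (lL t) = 0
  right_zero : ∀ t, 0 < t → u t (lR t) = 0
  left_slope : ∀ t, 0 < t → |derivWithin (u t) (Icc (lL t) (lR t)) (lL t)| = 1
  right_slope : ∀ t, 0 < t → |derivWithin (u t) (Icc (lL t) (lR t)) (lR t)| = 1
  left_velocity : ∀ t, 0 < t →
    Tendsto (iteratedDeriv 3 (u t)) (𝓝[>] lL t) (𝓝 (deriv lL t))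
  right_velocity : ∀ t, 0 < t →
    Tendsto (iteratedDeriv 3 (u t)) (𝓝[<] lR t) (𝓝 (deriv lR t))

/-- The mass `∫ u dx` of the film at time `t`. -/
def mass (u : ℝ → ℝ → ℝ) (lL lR : ℝ → ℝ) (t : ℝ) : ℝ :=
  ∫ x in (lL t)..(lR t), u t x

/-- The center of mass `∫ x u dx` of the film at time `t`. -/
def centerOfMass (u : ℝ → ℝ → ℝ) (lL lR : ℝ → ℝ) (t : ℝ) : ℝ :=
  ∫ x in (lL t)..(lR t), x * u t x

/-- The stationary solution `(1/2) (1 - x^2)_+`. -/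
def uInf (x : ℝ) : ℝ := (1 / 2) * max (1 - x ^ 2) 0

/-- The mass Lagrangian variable `Z t y`: the point `x` of `[lL t, lR t]` with
`∫_{lL t}^{x} u(t, ξ) dξ = (1/2) ∫_{-1}^{y} (1 - s^2) ds`. For a positive film of mass `2/3` and
`y ∈ [-1, 1]` there is exactly one such point, so the infimum only selects it. -/
def lagrangianZ (u : ℝ → ℝ → ℝ) (lL lR : ℝ → ℝ) (t y : ℝ) : ℝ :=
  sInf {x | x ∈ Icc (lL t) (lR t) ∧
    ∫ ξ in (lL t)..x, u t ξ = (1 / 2) * ∫ s in (-1 : ℝ)..y, (1 - s ^ 2)}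

/-- The film height in Lagrangian coordinates, `u(t, Z(t, y))`. -/
def uTilde (u : ℝ → ℝ → ℝ) (lL lR : ℝ → ℝ) (t y : ℝ) : ℝ :=
  u t (lagrangianZ u lL lR t y)

/-- The energy `E(t) = (1/2) ∫_{-1}^{1} |∂_y (ũ(t, y) / u^∞(y))|^2 dy`. -/
def energy (u : ℝ → ℝ → ℝ) (lL lR : ℝ → ℝ) (t : ℝ) : ℝ :=
  (1 / 2) * ∫ y in (-1 : ℝ)..1, |deriv (fun z => uTilde u lL lR t z / uInf z) y| ^ 2

/-- The distance `‖ũ(t) - u^∞‖` in `L^∞(-1, 1)`. -/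
def supDist (u : ℝ → ℝ → ℝ) (lL lR : ℝ → ℝ) (t : ℝ) : ENNReal :=
  eLpNorm (fun y => uTilde u lL lR t y - uInf y) ⊤ (volume.restrict (Ioo (-1 : ℝ) 1))

end

end ThinFilm

/-! Write `v = ũ / u^∞` as a function of the mass label `y`, and `φ = (1 - y²)/2`. The definition of
the label gives `u Z_y = φ`, hence `Z_y = 1/v` and `∂_x = v ∂_y`; conservation of mass gives `Z_t =
u_xxx = (v ∂_y)³(φ v)`. Equating the mixed derivatives of `Z` turns the free boundary problem into
an equation on a fixed interval, `v_t = -v² ∂_y((v ∂_y)³(φ v))` (`dT_ratio`). The unit contact slope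
becomes the Dirichlet condition `v = 1` at `y = ±1` (`labelRatio_left`, `labelRatio_right`).

The energy is the Dirichlet integral of `v`. As `v_t = 0` at both ends, `E' = ∫ v² v_yy ∂_y((v
∂_y)³(φ v)) dy`. The quadratic part of this integral at `v = 1` is `-∫ (φ v_yyy² + 8 v_yy²)` plus a
nonpositive boundary term. The nonlinear part, after subtraction of suitable exact derivatives, is
absorbed when `E` is small: each remaining term carries a factor `v - 1`, or enough powers of `v_y`
to be bounded by `E` times the dissipation. Since `v_y` has a zero, `∫ v_y²` is bounded by a
multiple of `∫ v_yy²`, and so `E' ≤ -2E` (`dissipation_le`, `exists_hasDerivAt_energy`). A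
continuity argument shows that smallness persists (`energy_decay`), and `v - 1`, which vanishes at
both ends, is bounded by `√E` up to a constant (`supDist_le`).

The rest is regularity at the contact points, where `v` is a quotient of two vanishing heights and
the relation between mass and label degenerates. There the mass of the film and that of the
stationary film both vanish quadratically. Smooth square roots of them are comparable through a
regular change of variable, and this exhibits the label and `v` as smooth functions of averages of
`u_x` (`massLabel_eq`, `heightRatio_eq`); the right contact point follows by reflection. The same
formulas give continuity of `v_y` down to `t = 0` (`C1_heightRatio`), so that the decay starts from
`E(0)`. -/

namespace ThinFilm

/-! ### Integral inequalities and the dissipation estimate. -/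

/-- Fundamental theorem of calculus for a function differentiable in the interior, whose derivative
extends continuously to the closed interval. -/
theorem integral_eq_sub_of_interior {a b : ℝ} (hab : a ≤ b) {f f' : ℝ → ℝ}
    (hf : ContinuousOn f (Icc a b)) (hf' : ContinuousOn f' (Icc a b))
    (hd : ∀ x ∈ Ioo a b, HasDerivAt f (f' x) x) : ∫ x in a..b, f' x = f b - f a :=
  intervalIntegral.integral_eq_sub_of_hasDerivAt_of_le hab hf hd
    (hf'.intervalIntegrable_of_Icc hab)

set_option maxHeartbeats 1000000 in
/-- Pointwise bound for the remainder of the dissipation integrand. -/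
theorem dissipation_remainder_le {v p g h y φ : ℝ} (hφ : φ = (1 - y ^ 2) / 2)
    (hy : y ^ 2 ≤ 1) (hv : (v - 1) ^ 2 ≤ 2 * φ * (1 / 1000) ^ 2) :
    -(φ * v ^ 5 * h ^ 2) - 8 * g ^ 2 - 24 / 5 * (v ^ 5 - 1) * g ^ 2
      + 32 / 5 * (v ^ 5 - 1) * y * g * h - 25 * v ^ 4 * p ^ 2 * g - 15 * y * v ^ 3 * p ^ 3 * g
      + φ * (v ^ 2 * p ^ 4 * g - 5 * v ^ 3 * p ^ 2 * g ^ 2 - 6 * v ^ 4 * p * g * h) ≤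
    -(9 / 10) * (φ * h ^ 2) - 39 / 5 * g ^ 2 + 13000 * p ^ 4 + 9000 * p ^ 6
      + 4000 * (φ * g ^ 2) * p ^ 2 := by
  have hφ0 : 0 ≤ φ := by rw [hφ]; linarith
  have hφ1 : φ ≤ 1 / 2 := by rw [hφ]; nlinarith [sq_nonneg y]
  have hw : |v - 1| ≤ 1 / 1000 := by
    apply abs_le_of_sq_le_sq _ (by norm_num)
    nlinarith
  have hw1 := (abs_le.1 hw).1
  have hw2 := (abs_le.1 hw).2
  have v0 : 999 / 1000 ≤ v := by linarith
  have v1 : v ≤ 1001 / 1000 := by linarith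
  have vp : 0 ≤ v := by linarith
  have v2 : v ^ 2 ≤ 1003 / 1000 := by nlinarith
  have v3 : v ^ 3 ≤ 1005 / 1000 := by nlinarith
  have v4 : v ^ 4 ≤ 1007 / 1000 := by nlinarith
  have v5 : 99 / 100 ≤ v ^ 5 := by
    calc (99 / 100 : ℝ) ≤ (999 / 1000) ^ 5 := by norm_num
      _ ≤ v ^ 5 := by gcongr
  -- `c` is the cofactor of `v - 1` in `v ^ 5 - 1`; its bound is the sum of the bounds on the powers
  -- of `v`.
  obtain ⟨c, hc, c0, c1⟩ : ∃ c, v ^ 5 - 1 = (v - 1) * c ∧ 0 ≤ c ∧ c ≤ 51 / 10 :=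
    ⟨1 + v + v ^ 2 + v ^ 3 + v ^ 4, by ring, by positivity, by linarith⟩
  have hyabs : |y| ≤ 1 := abs_le_one_iff_mul_self_le_one.2 (by nlinarith)
  -- Young's inequality, weighted so that the factor `a`, which is `g` or `h` below, is charged only
  -- a small multiple of the dissipation.
  have key : ∀ a b : ℝ, |a * b| ≤ (1 / 2) * (1 / 1000 * a ^ 2 + 1000 * b ^ 2) := fun a b => by
    rw [abs_le]; constructor <;> nlinarith [sq_nonneg (a + 1000 * b), sq_nonneg (a - 1000 * b)]
  -- the seven terms
  have t0 : -(φ * v ^ 5 * h ^ 2) ≤ -(99 / 100) * (φ * h ^ 2) := by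
    have : 0 ≤ φ * h ^ 2 := by positivity
    nlinarith
  have t1 : -(24 / 5 * (v ^ 5 - 1) * g ^ 2) ≤ 25 / 1000 * g ^ 2 := by
    have : -((v - 1) * c) ≤ 51 / 10 * (1 / 1000) := by nlinarith
    rw [hc]; nlinarith [sq_nonneg g]
  have t2 : 32 / 5 * (v ^ 5 - 1) * y * g * h ≤ 17 / 1000 * g ^ 2 + 33 / 1000 * (φ * h ^ 2) := by
    have k1 := key g ((v - 1) * h)
    have k2 : 32 / 5 * (v ^ 5 - 1) * y * g * h ≤ 32 / 5 * c * |g * ((v - 1) * h)| := by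
      calc 32 / 5 * (v ^ 5 - 1) * y * g * h = 32 / 5 * c * (y * (g * ((v - 1) * h))) := by
            rw [hc]; ring
        _ ≤ 32 / 5 * c * |g * ((v - 1) * h)| := by
            gcongr
            calc _ ≤ |y * (g * ((v - 1) * h))| := le_abs_self _
              _ = |y| * |g * ((v - 1) * h)| := abs_mul _ _
              _ ≤ 1 * |g * ((v - 1) * h)| := by gcongr
              _ = _ := one_mul _
    -- Only `φ h²`, not `h²`, is available as dissipation. The weight comes from `v - 1`, whose
    -- square is bounded by a multiple of `φ`.
    have k3 : ((v - 1) * h) ^ 2 ≤ 2 / 1000 ^ 2 * (φ * h ^ 2) := by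
      have := mul_le_mul_of_nonneg_right hv (sq_nonneg h)
      linarith
    have k4 : 32 / 5 * c * |g * ((v - 1) * h)| ≤ 33 * |g * ((v - 1) * h)| := by
      gcongr; linarith
    nlinarith [sq_nonneg g]
  have t3 : -(25 * v ^ 4 * p ^ 2 * g) ≤ 13 / 1000 * g ^ 2 + 13000 * p ^ 4 := by
    have k1 := key g (p ^ 2)
    calc -(25 * v ^ 4 * p ^ 2 * g) ≤ 25 * v ^ 4 * |g * p ^ 2| := by
          have := neg_abs_le (g * p ^ 2)
          have h4 : 0 ≤ 25 * v ^ 4 := by positivity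
          nlinarith
      _ ≤ 26 * |g * p ^ 2| := by gcongr; linarith
      _ ≤ _ := by
          rw [show (p ^ 2) ^ 2 = p ^ 4 by ring] at k1
          linarith
  have t4 : -(15 * y * v ^ 3 * p ^ 3 * g) ≤ 8 / 1000 * g ^ 2 + 8000 * p ^ 6 := by
    have k1 := key g (p ^ 3)
    calc -(15 * y * v ^ 3 * p ^ 3 * g) = 15 * v ^ 3 * (-(y * (g * p ^ 3))) := by ring
      _ ≤ 15 * v ^ 3 * |g * p ^ 3| := by
          gcongr
          calc _ ≤ |y * (g * p ^ 3)| := neg_le_abs _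
            _ = |y| * |g * p ^ 3| := abs_mul _ _
            _ ≤ 1 * |g * p ^ 3| := by gcongr
            _ = _ := one_mul _
      _ ≤ 16 * |g * p ^ 3| := by gcongr; linarith
      _ ≤ _ := by
          rw [show (p ^ 3) ^ 2 = p ^ 6 by ring] at k1
          linarith
  have hp6 : 0 ≤ p ^ 6 := by positivity
  have hpg : 0 ≤ (φ * g ^ 2) * p ^ 2 := by positivity
  have t5 : φ * (v ^ 2 * p ^ 4 * g) ≤ (φ * g ^ 2) * p ^ 2 + p ^ 6 := by
    have : p ^ 4 * g ≤ 1 / 2 * (g ^ 2 * p ^ 2 + p ^ 6) := by nlinarith [sq_nonneg (p * g - p ^ 3)]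
    have h5 : φ * v ^ 2 * (p ^ 4 * g) ≤ φ * v ^ 2 * (1 / 2 * (g ^ 2 * p ^ 2 + p ^ 6)) := by gcongr
    have h6 : φ * v ^ 2 * (1 / 2 * (g ^ 2 * p ^ 2 + p ^ 6))
        ≤ 1 * (1003 / 1000) * (1 / 2 * (φ * g ^ 2 * p ^ 2 + p ^ 6)) := by
      have h7 : φ * (v ^ 2 * p ^ 6) ≤ 1 / 2 * (1003 / 1000 * p ^ 6) := by gcongr
      have h8 : v ^ 2 * (φ * g ^ 2 * p ^ 2) ≤ 1003 / 1000 * (φ * g ^ 2 * p ^ 2) := by gcongr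
      linarith
    linarith
  have t6 : -(φ * (5 * v ^ 3 * p ^ 2 * g ^ 2)) ≤ 0 := by
    have : 0 ≤ φ * (5 * v ^ 3 * p ^ 2 * g ^ 2) := by positivity
    linarith
  have t7 : -(φ * (6 * v ^ 4 * p * g * h)) ≤ 4 / 1000 * (φ * h ^ 2)
      + 3600 * ((φ * g ^ 2) * p ^ 2) := by
    have k1 := key h (p * g)
    calc -(φ * (6 * v ^ 4 * p * g * h)) = 6 * v ^ 4 * φ * (-(h * (p * g))) := by ring
      _ ≤ 6 * v ^ 4 * φ * |h * (p * g)| := by gcongr; exact neg_le_abs _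
      _ ≤ 7 * φ * |h * (p * g)| := by gcongr; linarith
      _ ≤ 7 * φ * ((1 / 2) * (1 / 1000 * h ^ 2 + 1000 * (p * g) ^ 2)) := by gcongr
      _ ≤ _ := by
          have := mul_nonneg hφ0 (sq_nonneg h)
          linarith
  have g0 := sq_nonneg g
  have h0 := mul_nonneg hφ0 (sq_nonneg h)
  have p0 : 0 ≤ p ^ 4 := by positivity
  linarith

/-- The Cauchy-Schwarz inequality for continuous functions on an interval. -/
theorem sq_integral_mul_le {a b : ℝ} (hab : a ≤ b) {f g : ℝ → ℝ}
    (hf : ContinuousOn f (Icc a b)) (hg : ContinuousOn g (Icc a b)) :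
    (∫ x in a..b, f x * g x) ^ 2 ≤ (∫ x in a..b, f x ^ 2) * ∫ x in a..b, g x ^ 2 := by
  have i1 : IntervalIntegrable (fun x => f x ^ 2) volume a b :=
    (hf.pow 2).intervalIntegrable_of_Icc hab
  have i2 : IntervalIntegrable (fun x => f x * g x) volume a b :=
    (hf.mul hg).intervalIntegrable_of_Icc hab
  have i3 : IntervalIntegrable (fun x => g x ^ 2) volume a b :=
    (hg.pow 2).intervalIntegrable_of_Icc hab
  -- The integral of `(f + l g)²` is nonnegative for every `l`, so this quadratic in `l` has
  -- nonpositive discriminant, including when `∫ g² = 0`.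
  have key : ∀ l : ℝ, 0 ≤ (∫ x in a..b, g x ^ 2) * (l * l) + (2 * ∫ x in a..b, f x * g x) * l
      + ∫ x in a..b, f x ^ 2 := fun l => by
    have h0 : 0 ≤ ∫ x in a..b, (f x + l * g x) ^ 2 :=
      intervalIntegral.integral_nonneg hab fun x _ => sq_nonneg _
    have h1 : (fun x => (f x + l * g x) ^ 2)
        = fun x => (f x ^ 2 + 2 * l * (f x * g x)) + l * l * g x ^ 2 := by
      funext x; ring
    rw [h1, intervalIntegral.integral_add (i1.add (i2.const_mul _)) (i3.const_mul _),
      intervalIntegral.integral_add i1 (i2.const_mul _), intervalIntegral.integral_const_mul,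
      intervalIntegral.integral_const_mul] at h0
    linarith
  have := discrim_le_zero key
  rw [discrim] at this
  nlinarith

/-- Monotonicity in the interval of the integral of a nonnegative continuous function. -/
theorem integral_mono_interval_of_continuousOn {a b c d : ℝ} (hac : a ≤ c) (hcd : c ≤ d)
    (hdb : d ≤ b) {f : ℝ → ℝ} (hf : ContinuousOn f (Icc a b)) (h0 : ∀ x ∈ Icc a b, 0 ≤ f x) :
    ∫ x in c..d, f x ≤ ∫ x in a..b, f x := by
  apply intervalIntegral.integral_mono_interval hac hcd hdb
  · exact (ae_restrict_iff' measurableSet_Ioc).2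
      (Eventually.of_forall fun x hx => h0 x (Ioc_subset_Icc_self hx))
  · exact hf.intervalIntegrable_of_Icc (by linarith)

/-- The increment of a function is controlled by the integral of its derivative. -/
theorem abs_sub_le_integral_abs {a b : ℝ} {f f' : ℝ → ℝ}
    (hf : ContinuousOn f (Icc a b)) (hf' : ContinuousOn f' (Icc a b))
    (hd : ∀ x ∈ Ioo a b, HasDerivAt f (f' x) x) {x y : ℝ} (hx : x ∈ Icc a b) (hy : y ∈ Icc a b) :
    |f y - f x| ≤ ∫ s in a..b, |f' s| := by
  wlog hxy : x ≤ y generalizing x y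
  · rw [abs_sub_comm]; exact this hy hx (le_of_not_ge hxy)
  have hs : Icc x y ⊆ Icc a b := Icc_subset_Icc hx.1 hy.2
  rw [← integral_eq_sub_of_interior hxy (hf.mono hs) (hf'.mono hs)
    fun s hs' => hd s ⟨hx.1.trans_lt hs'.1, hs'.2.trans_le hy.2⟩]
  exact (intervalIntegral.abs_integral_le_integral_abs hxy).trans
    (integral_mono_interval_of_continuousOn hx.1 hxy hy.2 hf'.abs fun s _ => abs_nonneg _)

/-- A function on `[-1, 1]` vanishing at both ends is bounded by `(1 - y ^ 2)` times the
Dirichlet integral. -/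
theorem sq_le_of_dirichlet {w p : ℝ → ℝ} (hw : ContinuousOn w (Icc (-1) 1))
    (hp : ContinuousOn p (Icc (-1) 1)) (hd : ∀ y ∈ Ioo (-1 : ℝ) 1, HasDerivAt w (p y) y)
    (h0 : w (-1) = 0) (h1 : w 1 = 0) {y : ℝ} (hy : y ∈ Icc (-1 : ℝ) 1) :
    w y ^ 2 ≤ (1 - y ^ 2) * ∫ s in (-1 : ℝ)..1, p s ^ 2 := by
  have e0 : 0 ≤ ∫ s in (-1 : ℝ)..1, p s ^ 2 :=
    intervalIntegral.integral_nonneg (by norm_num) fun x _ => sq_nonneg _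
  have key : ∀ a b, -1 ≤ a → a ≤ b → b ≤ 1 →
      (w b - w a) ^ 2 ≤ (b - a) * ∫ s in (-1 : ℝ)..1, p s ^ 2 := fun a b ha hab hb => by
    have hs : Icc a b ⊆ Icc (-1) 1 := Icc_subset_Icc ha hb
    rw [← integral_eq_sub_of_interior hab (hw.mono hs) (hp.mono hs)
      fun s hs' => hd s ⟨ha.trans_lt hs'.1, hs'.2.trans_le hb⟩]
    have := sq_integral_mul_le hab (f := fun _ => 1) continuousOn_const (hp.mono hs)
    simp only [one_mul, one_pow, intervalIntegral.integral_const, smul_eq_mul, mul_one] at this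
    refine this.trans (mul_le_mul_of_nonneg_left ?_ (by linarith))
    exact integral_mono_interval_of_continuousOn ha hab hb (hp.pow 2) fun s _ => sq_nonneg _
  have k1 := key (-1) y le_rfl hy.1 hy.2
  have k2 := key y 1 hy.1 hy.2 le_rfl
  rw [h0] at k1
  rw [h1] at k2
  -- The increment is taken from the nearer endpoint, whose distance `1 - |y|` is at most `1 - y ^
  -- 2`.
  rcases le_total y 0 with h | h
  · have : (y - -1) ≤ 1 - y ^ 2 := by nlinarith [hy.1]
    nlinarith
  · have : (1 - y) ≤ 1 - y ^ 2 := by nlinarith [hy.2]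
    nlinarith

/-- The primitive whose boundary values are the boundary terms of the dissipation identity. -/
noncomputable def dissipationPrimitive (v p g h : ℝ → ℝ) (y : ℝ) : ℝ :=
  (1 - y ^ 2) / 2 * v y ^ 5 * g y * h y - 2 * y * g y ^ 2
    - 26 / 5 * y * (v y ^ 5 - 1) * g y ^ 2 + 2 * (1 - y ^ 2) * v y ^ 4 * p y * g y ^ 2

/-- The spatial derivative of the velocity, in terms of the values at `y` of `v` and of its first
four derivatives. -/
noncomputable def velocityDeriv (y v p g h k : ℝ) : ℝ :=
  -(25 * v ^ 2 * p ^ 2 + 10 * v ^ 3 * g) - y * (15 * v * p ^ 3 + 30 * v ^ 2 * p * g + 5 * v ^ 3 * h)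
    + (1 - y ^ 2) / 2 * (p ^ 4 + 11 * v * p ^ 2 * g + 4 * v ^ 2 * g ^ 2 + 7 * v ^ 2 * p * h
      + v ^ 3 * k)

theorem continuousOn_velocityDeriv {v p g h k : ℝ → ℝ} {s : Set ℝ} (hv : ContinuousOn v s)
    (hp : ContinuousOn p s) (hg : ContinuousOn g s) (hh : ContinuousOn h s)
    (hk : ContinuousOn k s) :
    ContinuousOn (fun y => velocityDeriv y (v y) (p y) (g y) (h y) (k y)) s := by
  unfold velocityDeriv
  fun_prop

set_option maxHeartbeats 1000000 in
/-- The dissipation estimate: near the stationary state, the dissipation controls the energy. -/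
theorem dissipation_le {v p g h k : ℝ → ℝ}
    (hv : ContinuousOn v (Icc (-1) 1)) (hp : ContinuousOn p (Icc (-1) 1))
    (hg : ContinuousOn g (Icc (-1) 1)) (hh : ContinuousOn h (Icc (-1) 1))
    (hk : ContinuousOn k (Icc (-1) 1))
    (dv : ∀ y ∈ Ioo (-1 : ℝ) 1, HasDerivAt v (p y) y)
    (dp : ∀ y ∈ Ioo (-1 : ℝ) 1, HasDerivAt p (g y) y)
    (dg : ∀ y ∈ Ioo (-1 : ℝ) 1, HasDerivAt g (h y) y)
    (dh : ∀ y ∈ Ioo (-1 : ℝ) 1, HasDerivAt h (k y) y)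
    (v0 : v (-1) = 1) (v1 : v 1 = 1) (he : ∫ y in (-1 : ℝ)..1, p y ^ 2 ≤ (1 / 1000) ^ 2) :
    ∫ y in (-1 : ℝ)..1, v y ^ 2 * g y * velocityDeriv y (v y) (p y) (g y) (h y) (k y) ≤
      -∫ y in (-1 : ℝ)..1, p y ^ 2 := by
  have I01 : (-1 : ℝ) ≤ 1 := by norm_num
  have cφ : ContinuousOn (fun y : ℝ => (1 - y ^ 2) / 2) (Icc (-1) 1) := by fun_prop
  have ii : ∀ {f : ℝ → ℝ}, ContinuousOn f (Icc (-1) 1) → IntervalIntegrable f volume (-1) 1 :=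
    fun hf => hf.intervalIntegrable_of_Icc I01
  set e := ∫ y in (-1 : ℝ)..1, p y ^ 2 with he_def
  set G := ∫ y in (-1 : ℝ)..1, g y ^ 2 with hG
  set H := ∫ y in (-1 : ℝ)..1, (1 - y ^ 2) / 2 * h y ^ 2 with hH
  have e0 : 0 ≤ e := intervalIntegral.integral_nonneg I01 fun x _ => sq_nonneg _
  have G0 : 0 ≤ G := intervalIntegral.integral_nonneg I01 fun x _ => sq_nonneg _
  have φ0 : ∀ y ∈ Icc (-1 : ℝ) 1, 0 ≤ (1 - y ^ 2) / 2 := fun y hy => by nlinarith [hy.1, hy.2]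
  have H0 : 0 ≤ H := intervalIntegral.integral_nonneg I01 fun x hx =>
    mul_nonneg (φ0 x hx) (sq_nonneg _)
  have cG : ContinuousOn (fun y => g y ^ 2) (Icc (-1) 1) := by fun_prop
  have cH : ContinuousOn (fun y => (1 - y ^ 2) / 2 * h y ^ 2) (Icc (-1) 1) := by fun_prop
  have cP : ContinuousOn (fun y => p y ^ 2) (Icc (-1) 1) := by fun_prop
  -- pointwise bounds
  obtain ⟨z, hz, pz⟩ : ∃ z ∈ Ioo (-1 : ℝ) 1, p z = 0 :=
    exists_hasDerivAt_eq_zero (by norm_num) hv (by rw [v0, v1]) dv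
  have hz' := Ioo_subset_Icc_self hz
  -- The zero `z` of `p`, from Rolle's theorem for `v`, replaces a boundary condition: `p` is the
  -- integral of `g` from `z`.
  have hp2 : ∀ y ∈ Icc (-1 : ℝ) 1, p y ^ 2 ≤ 2 * G := fun y hy => by
    have h1 := abs_sub_le_integral_abs hp hg dp hz' hy
    have h2 := sq_integral_mul_le I01 (f := fun _ => 1) continuousOn_const hg.abs
    simp only [one_mul, one_pow, intervalIntegral.integral_const, smul_eq_mul, mul_one,
      sq_abs] at h2
    rw [pz, sub_zero] at h1
    calc p y ^ 2 = |p y| ^ 2 := (sq_abs _).symm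
      _ ≤ (∫ s in (-1 : ℝ)..1, |g s|) ^ 2 := by gcongr
      _ ≤ _ := by rw [hG]; linarith
  -- The same argument for `p²`, with derivative `2 p g`, gains the small factor `e`.
  have hp4 : ∀ y ∈ Icc (-1 : ℝ) 1, p y ^ 4 ≤ 4 * (e * G) := fun y hy => by
    have h1 := abs_sub_le_integral_abs (f := fun y => p y ^ 2) (f' := fun y => 2 * (p y * g y))
      cP (by fun_prop) (fun x hx => by
        refine ((dp x hx).fun_pow 2).congr_deriv ?_
        push_cast; ring) hz' hy
    have h2 := sq_integral_mul_le I01 hp.abs hg.abs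
    simp only [sq_abs] at h2
    simp only [pz, abs_mul, abs_two, intervalIntegral.integral_const_mul] at h1
    rw [zero_pow two_ne_zero, sub_zero, abs_of_nonneg (sq_nonneg _)] at h1
    calc p y ^ 4 = (p y ^ 2) ^ 2 := by ring
      _ ≤ (2 * ∫ s in (-1 : ℝ)..1, |p s| * |g s|) ^ 2 := by gcongr
      _ ≤ _ := by rw [mul_pow]; linarith
  -- `g` itself has no pointwise bound from `G` and `H`, but `φ g²` vanishes at `-1` and its
  -- derivative is integrable in terms of `G` and `H`.
  have hφg : ∀ y ∈ Icc (-1 : ℝ) 1, (1 - y ^ 2) / 2 * g y ^ 2 ≤ 2 * G + H := fun y hy => by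
    have h1 := abs_sub_le_integral_abs (f := fun y => (1 - y ^ 2) / 2 * g y ^ 2)
      (f' := fun y => -y * g y ^ 2 + (1 - y ^ 2) * (g y * h y))
      (by fun_prop) (by fun_prop) (fun x hx => by
        have d1 := ((hasDerivAt_pow 2 x).const_sub 1).div_const 2
        refine (d1.mul ((dg x hx).fun_pow 2)).congr_deriv ?_
        push_cast; ring) (left_mem_Icc.2 I01) hy
    have h2 : ∫ s in (-1 : ℝ)..1, |-s * g s ^ 2 + (1 - s ^ 2) * (g s * h s)|
        ≤ ∫ s in (-1 : ℝ)..1, (2 * g s ^ 2 + (1 - s ^ 2) / 2 * h s ^ 2) := by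
      apply intervalIntegral.integral_mono_on I01 (ii (by fun_prop)) (ii (by fun_prop))
      intro s hs
      have hs0 : 0 ≤ 1 - s ^ 2 := by linarith [φ0 s hs]
      have a1 : |s| ≤ 1 := abs_le.2 hs
      have a2 := sq_nonneg (g s + h s)
      have a3 := sq_nonneg (g s - h s)
      have a4 := abs_le.1 a1
      have b1 := mul_nonneg hs0 a2
      have b2 := mul_nonneg hs0 a3
      have b3 := mul_nonneg (sq_nonneg s) (sq_nonneg (g s))
      have b4 : s * g s ^ 2 ≤ g s ^ 2 := by nlinarith [sq_nonneg (g s)]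
      have b5 : -(s * g s ^ 2) ≤ g s ^ 2 := by nlinarith [sq_nonneg (g s)]
      have c1 : (1 - s ^ 2) * g s ^ 2 ≤ g s ^ 2 := by linarith
      rw [abs_le]; constructor <;> linarith
    rw [intervalIntegral.integral_add (ii (by fun_prop)) (ii cH),
      intervalIntegral.integral_const_mul] at h2
    have h3 := (le_abs_self _).trans (h1.trans h2)
    norm_num at h3
    linarith
  have hwφ : ∀ y ∈ Icc (-1 : ℝ) 1,
      (v y - 1) ^ 2 ≤ 2 * ((1 - y ^ 2) / 2) * (1 / 1000) ^ 2 := fun y hy => by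
    have := sq_le_of_dirichlet (w := fun y => v y - 1) (by fun_prop) hp
      (fun y hy => (dv y hy).sub_const 1) (by simp [v0]) (by simp [v1]) hy
    have h0 := φ0 y hy
    calc (v y - 1) ^ 2 ≤ (1 - y ^ 2) * e := this
      _ ≤ (1 - y ^ 2) * (1 / 1000) ^ 2 := by gcongr; linarith
      _ = _ := by ring
  have heG : e ≤ 4 * G := by
    have : e ≤ ∫ y in (-1 : ℝ)..1, 2 * G :=
      intervalIntegral.integral_mono_on I01 (ii cP) (ii continuousOn_const) hp2
    rw [intervalIntegral.integral_const, smul_eq_mul] at this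
    linarith
  -- the dissipation identity
  have cB : ContinuousOn (dissipationPrimitive v p g h) (Icc (-1) 1) := by
    unfold dissipationPrimitive; fun_prop
  set R : ℝ → ℝ := fun y => -((1 - y ^ 2) / 2 * v y ^ 5 * h y ^ 2) - 8 * g y ^ 2
      - 24 / 5 * (v y ^ 5 - 1) * g y ^ 2
      + 32 / 5 * (v y ^ 5 - 1) * y * g y * h y - 25 * v y ^ 4 * p y ^ 2 * g y
      - 15 * y * v y ^ 3 * p y ^ 3 * g y
      + (1 - y ^ 2) / 2 * (v y ^ 2 * p y ^ 4 * g y - 5 * v y ^ 3 * p y ^ 2 * g y ^ 2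
        - 6 * v y ^ 4 * p y * g y * h y) with hR
  have cR : ContinuousOn R (Icc (-1) 1) := by rw [hR]; fun_prop
  have cA := continuousOn_velocityDeriv hv hp hg hh hk
  have cI : ContinuousOn (fun y => v y ^ 2 * g y * velocityDeriv y (v y) (p y) (g y) (h y) (k y))
      (Icc (-1) 1) := by fun_prop
  -- The primitive is chosen term by term. The first removes the fourth derivative `k`; `-2 y g²`
  -- symmetrizes the quadratic part `-4 y g h` and leaves `-8 g²`. The term `2 (1 - y²) v⁴ p g²`
  -- cancels the cubic term in `g³`, and the coefficient `26/5` then cancels `y v⁴ p g²`: `-30 + 26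
  -- + 4 = 0`. Neither cubic term could be absorbed by the pointwise bounds above.
  have ident := integral_eq_sub_of_interior I01 cB
    (f' := fun y => v y ^ 2 * g y * velocityDeriv y (v y) (p y) (g y) (h y) (k y) - R y)
    (cI.sub cR) (fun y hy => by
      have d1 : HasDerivAt (fun y : ℝ => 1 - y ^ 2) (-(2 * y)) y :=
        ((hasDerivAt_pow 2 y).const_sub 1).congr_deriv (by norm_num)
      have dv' := dv y hy
      have dp' := dp y hy
      have dg' := dg y hy
      have dh' := dh y hy
      have e1 := (((d1.div_const 2).mul (dv'.pow 5)).mul dg').mul dh'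
      have e2 := ((hasDerivAt_id y).const_mul 2).mul (dg'.pow 2)
      have e3 := (((hasDerivAt_id y).const_mul (26 / 5)).mul ((dv'.pow 5).sub_const 1)).mul
        (dg'.pow 2)
      have e4 := (((d1.const_mul 2).mul (dv'.pow 4)).mul dp').mul (dg'.pow 2)
      refine (((e1.sub e2).sub e3).add e4).congr_deriv ?_
      simp only [hR, velocityDeriv, Pi.mul_apply, Pi.pow_apply, id]
      push_cast
      ring)
  rw [intervalIntegral.integral_sub (ii cI) (ii cR)] at ident
  -- At the ends `1 - y²` and `v ^ 5 - 1` vanish, so only `-2 y g²` remains, with the favourable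
  -- sign on both sides.
  have bdry : dissipationPrimitive v p g h 1 - dissipationPrimitive v p g h (-1) ≤ 0 := by
    simp only [dissipationPrimitive, v0, v1]
    nlinarith [sq_nonneg (g 1), sq_nonneg (g (-1))]
  have hRle : ∫ y in (-1 : ℝ)..1, R y ≤ ∫ y in (-1 : ℝ)..1,
      (-(9 / 10) * ((1 - y ^ 2) / 2 * h y ^ 2) + (-39 / 5) * g y ^ 2
        + (26000 * G + 36000 * (e * G) + 4000 * (2 * G + H)) * p y ^ 2) := by
    apply intervalIntegral.integral_mono_on I01 (ii cR) (ii (by fun_prop))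
    intro y hy
    have m := dissipation_remainder_le (p := p y) (g := g y) (h := h y) rfl
      (by linarith [φ0 y hy]) (hwφ y hy)
    have p2 := sq_nonneg (p y)
    have q1 : p y ^ 4 ≤ 2 * G * p y ^ 2 := by nlinarith [hp2 y hy]
    have q2 : p y ^ 6 ≤ 4 * (e * G) * p y ^ 2 := by
      have := mul_le_mul_of_nonneg_right (hp4 y hy) p2
      linarith [show p y ^ 6 = p y ^ 4 * p y ^ 2 by ring]
    have q3 := mul_le_mul_of_nonneg_right (hφg y hy) p2
    simp only [hR]
    linarith
  clear_value R
  rw [intervalIntegral.integral_add (ii (by fun_prop)) (ii (by fun_prop)),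
    intervalIntegral.integral_add (ii (by fun_prop)) (ii (by fun_prop)),
    intervalIntegral.integral_const_mul, intervalIntegral.integral_const_mul,
    intervalIntegral.integral_const_mul, ← hG, ← hH, ← he_def] at hRle
  -- With `e ≤ 10⁻⁶` the error terms are at most about `0.07 G + 0.004 H`, against `7.8 G + 0.9 H`;
  -- what is left dominates `e` because `e ≤ 4 G`.
  have f1 : G * e ≤ G * (1 / 1000) ^ 2 := by gcongr
  have f2 : H * e ≤ H * (1 / 1000) ^ 2 := by gcongr
  have f3 : e * G * e ≤ G * (1 / 1000) ^ 2 := by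
    calc e * G * e = (G * e) * e := by ring
      _ ≤ (G * e) * 1 := by gcongr; linarith
      _ ≤ _ := by linarith
  linarith

/-! ### Continuity and smoothness of parametric integrals. -/

section ParametricIntegral

variable {E F : Type*} [NormedAddCommGroup E] [NormedSpace ℝ E]
  [NormedAddCommGroup F] [NormedSpace ℝ F]

theorem continuousOn_slice {X Y Z : Type*} [TopologicalSpace X] [TopologicalSpace Y]
    [TopologicalSpace Z] {f : X → Y → Z} {S : Set X} {T : Set Y}
    (hf : ContinuousOn (fun q : X × Y => f q.1 q.2) (S ×ˢ T)) {x : X} (hx : x ∈ S) :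
    ContinuousOn (f x) T :=
  hf.comp (f := fun y => (x, y)) (by fun_prop) fun _ hy => ⟨hx, hy⟩

theorem continuousOn_slice_left {X Y Z : Type*} [TopologicalSpace X] [TopologicalSpace Y]
    [TopologicalSpace Z] {f : X → Y → Z} {S : Set X} {T : Set Y}
    (hf : ContinuousOn (fun q : X × Y => f q.1 q.2) (S ×ˢ T)) {y : Y} (hy : y ∈ T) :
    ContinuousOn (fun x => f x y) S :=
  hf.comp (f := fun x => (x, y)) (by fun_prop) fun _ hx => ⟨hx, hy⟩

/-- Uniformity in the compact variable. -/
theorem eventually_forall_norm_sub_lt {F : Type*} [NormedAddCommGroup F] {X : Type*} [TopologicalSpace X] {f : X → ℝ → F} {S : Set X}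
    {a b : ℝ} (hf : ContinuousOn (fun q : X × ℝ => f q.1 q.2) (S ×ˢ Icc a b)) {x₀ : X}
    (hx : x₀ ∈ S) {ε : ℝ} (hε : 0 < ε) :
    ∀ᶠ x in 𝓝[S] x₀, ∀ r ∈ Icc a b, ‖f x r - f x₀ r‖ < ε := by
  obtain ⟨v, hv, h⟩ := isCompact_Icc.mem_uniformity_of_prod (f := f) hf hx
    (Metric.dist_mem_uniformity hε)
  filter_upwards [hv] with x hx r hr
  simpa [dist_eq_norm] using h x hx r hr

theorem continuousOn_parametric_integral {X : Type*} [TopologicalSpace X] {f : X → ℝ → F}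
    {S : Set X} {a b : ℝ} (hab : a ≤ b)
    (hf : ContinuousOn (fun q : X × ℝ => f q.1 q.2) (S ×ˢ Icc a b)) :
    ContinuousOn (fun x => ∫ r in a..b, f x r) S := by
  intro x₀ hx₀
  rw [ContinuousWithinAt, Metric.tendsto_nhds]
  intro ε hε
  have hd : 0 < ε / (b - a + 1) := div_pos hε (by linarith)
  filter_upwards [eventually_forall_norm_sub_lt hf hx₀ hd, self_mem_nhdsWithin] with x hx hxS
  have hi : ∀ z ∈ S, IntervalIntegrable (f z) volume a b := fun z hz =>
    (continuousOn_slice hf hz).intervalIntegrable_of_Icc hab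
  rw [dist_eq_norm, ← intervalIntegral.integral_sub (hi x hxS) (hi x₀ hx₀)]
  have := intervalIntegral.norm_integral_le_of_norm_le_const (a := a) (b := b)
    (f := fun r => f x r - f x₀ r) (C := ε / (b - a + 1)) fun r hr => by
      rw [uIoc_of_le hab] at hr
      exact (hx r (Ioc_subset_Icc_self hr)).le
  refine this.trans_lt ?_
  rw [abs_of_nonneg (by linarith), div_mul_eq_mul_div, div_lt_iff₀ (by linarith)]
  nlinarith

/-- Differentiation under the integral sign on a convex set of parameters. -/
theorem hasFDerivWithinAt_parametric_integral [CompleteSpace F] {S : Set E} (hS : Convex ℝ S)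
    {a b : ℝ} (hab : a ≤ b) {f : E → ℝ → F} {f' : E → ℝ → E →L[ℝ] F}
    (hf : ContinuousOn (fun q : E × ℝ => f q.1 q.2) (S ×ˢ Icc a b))
    (hf' : ContinuousOn (fun q : E × ℝ => f' q.1 q.2) (S ×ˢ Icc a b))
    (hd : ∀ x ∈ S, ∀ r ∈ Icc a b, HasFDerivWithinAt (fun z => f z r) (f' x r) S x)
    {x₀ : E} (hx₀ : x₀ ∈ S) :
    HasFDerivWithinAt (fun x => ∫ r in a..b, f x r) (∫ r in a..b, f' x₀ r) S x₀ := by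
  refine HasFDerivWithinAt.of_isLittleO (Asymptotics.isLittleO_iff.2 fun {ε} hε => ?_)
  have hd0 : 0 < ε / (b - a + 1) := div_pos hε (by linarith)
  have hi : ∀ z ∈ S, IntervalIntegrable (f z) volume a b := fun z hz =>
    (continuousOn_slice hf hz).intervalIntegrable_of_Icc hab
  have hi' : IntervalIntegrable (f' x₀) volume a b :=
    (continuousOn_slice hf' hx₀).intervalIntegrable_of_Icc hab
  obtain ⟨δ, hδ, hball⟩ := Metric.mem_nhdsWithin_iff.1
    (eventually_forall_norm_sub_lt hf' hx₀ hd0)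
  filter_upwards [inter_mem_nhdsWithin S (Metric.ball_mem_nhds x₀ hδ)] with x hx
  have happ : (∫ r in a..b, f' x₀ r) (x - x₀) = ∫ r in a..b, f' x₀ r (x - x₀) :=
    (ContinuousLinearMap.intervalIntegral_apply hi' _)
  have hi'' : IntervalIntegrable (fun r => f' x₀ r (x - x₀)) volume a b :=
    ((continuousOn_slice hf' hx₀).clm_apply continuousOn_const).intervalIntegrable_of_Icc hab
  rw [happ, ← intervalIntegral.integral_sub (hi x hx.1) (hi x₀ hx₀),
    ← intervalIntegral.integral_sub ((hi x hx.1).sub (hi x₀ hx₀)) hi'']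
  have := intervalIntegral.norm_integral_le_of_norm_le_const (a := a) (b := b)
    (f := fun r => f x r - f x₀ r - f' x₀ r (x - x₀)) (C := ε / (b - a + 1) * ‖x - x₀‖)
    fun r hr => by
      rw [uIoc_of_le hab] at hr
      have hr := Ioc_subset_Icc_self hr
      -- Mean value inequality on the convex set `S ∩ ball`, where `f'` is close to `f' x₀`
      -- uniformly in `r`; this replaces dominated convergence.
      refine Convex.norm_image_sub_le_of_norm_hasFDerivWithin_le' (f := fun z => f z r)
        (f' := fun z => f' z r) (s := S ∩ Metric.ball x₀ δ)
        (fun z hz => (hd z hz.1 r hr).mono inter_subset_left)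
        (fun z hz => (hball ⟨hz.2, hz.1⟩ r hr).le) (hS.inter (convex_ball _ _))
        ⟨hx₀, Metric.mem_ball_self hδ⟩ hx
  refine this.trans ?_
  rw [abs_of_nonneg (by linarith), mul_right_comm]
  gcongr
  rw [div_mul_eq_mul_div, div_le_iff₀ (by linarith)]
  nlinarith

/-- A parametric integral of a smooth function is smooth, on a convex set of parameters. -/
theorem contDiffOn_parametric_integral [FiniteDimensional ℝ E] [CompleteSpace F] {S : Set E}
    (hS : Convex ℝ S) (hu : UniqueDiffOn ℝ S) {a b : ℝ} (hab : a < b) (n : ℕ) {f : E → ℝ → F}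
    (hf : ContDiffOn ℝ n (fun q : E × ℝ => f q.1 q.2) (S ×ˢ Icc a b)) :
    ContDiffOn ℝ n (fun x => ∫ r in a..b, f x r) S := by
  induction n generalizing f with
  | zero =>
    exact contDiffOn_zero.2 (continuousOn_parametric_integral hab.le hf.continuousOn)
  | succ n ih =>
    have hu' : UniqueDiffOn ℝ (S ×ˢ Icc a b) := hu.prod (uniqueDiffOn_Icc hab)
    set f' : E → ℝ → E →L[ℝ] F := fun x r =>
      (fderivWithin ℝ (fun q : E × ℝ => f q.1 q.2) (S ×ˢ Icc a b) (x, r)).comp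
        (ContinuousLinearMap.inl ℝ E ℝ) with hf'_def
    have h1 : ContDiffOn ℝ n
        (fderivWithin ℝ (fun q : E × ℝ => f q.1 q.2) (S ×ˢ Icc a b)) (S ×ˢ Icc a b) :=
      hf.fderivWithin hu' (by norm_cast)
    have hf' : ContinuousOn (fun q : E × ℝ => f' q.1 q.2) (S ×ˢ Icc a b) :=
      h1.continuousOn.clm_comp continuousOn_const
    have hd : ∀ x ∈ S, ∀ r ∈ Icc a b, HasFDerivWithinAt (fun z => f z r) (f' x r) S x := by
      intro x hx r hr
      have h2 := (hf.differentiableOn (by simp) (x, r) ⟨hx, hr⟩).hasFDerivWithinAt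
      have h3 : HasFDerivWithinAt (fun z : E => (z, r)) (ContinuousLinearMap.inl ℝ E ℝ) S x :=
        (hasFDerivAt_prodMk_left x r).hasFDerivWithinAt
      exact HasFDerivWithinAt.comp (t := S ×ˢ Icc a b) x h2 h3 fun z hz => mk_mem_prod hz hr
    have hI := fun x hx => hasFDerivWithinAt_parametric_integral hS hab.le hf.continuousOn hf' hd
      (x₀ := x) hx
    rw [Nat.cast_succ]
    -- Evaluating the derivative at a fixed vector `y` keeps the values in `F`, so the induction
    -- hypothesis applies to the resulting parametric integral.
    refine contDiffOn_succ_of_fderiv_apply (fun x hx => (hI x hx).differentiableWithinAt)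
      (fun h => by exact absurd h (by simp)) fun y => ?_
    refine (ih (f := fun x r => f' x r y) ?_).congr fun x hx => ?_
    · simp only [hf'_def, ContinuousLinearMap.comp_apply]
      exact h1.clm_apply contDiffOn_const
    · rw [(hI x hx).fderivWithin (hu x hx)]
      exact ContinuousLinearMap.intervalIntegral_apply
        ((continuousOn_slice hf' hx).intervalIntegrable_of_Icc hab.le) _

end ParametricIntegral

/-! ### Calculus of functions smooth up to the lateral boundary. -/

/-- Smoothness of `f t x` for positive times, up to the boundary of the interval `[a, b]`. -/
def SmoothUpTo (a b : ℝ) (f : ℝ → ℝ → ℝ) : Prop :=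
  ContDiffOn ℝ ∞ (fun q : ℝ × ℝ => f q.1 q.2) (Ioi 0 ×ˢ Icc a b)

/-- The time derivative, up to the boundary. -/
noncomputable def dT (a b : ℝ) (f : ℝ → ℝ → ℝ) (t x : ℝ) : ℝ :=
  fderivWithin ℝ (fun q : ℝ × ℝ => f q.1 q.2) (Ioi 0 ×ˢ Icc a b) (t, x) (1, 0)

/-- The space derivative, up to the boundary. -/
noncomputable def dX (a b : ℝ) (f : ℝ → ℝ → ℝ) (t x : ℝ) : ℝ :=
  fderivWithin ℝ (fun q : ℝ × ℝ => f q.1 q.2) (Ioi 0 ×ˢ Icc a b) (t, x) (0, 1)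

section SmoothUpTo

variable {a b : ℝ} {f g : ℝ → ℝ → ℝ}

theorem uniqueDiffOn_strip (hab : a < b) : UniqueDiffOn ℝ (Ioi (0 : ℝ) ×ˢ Icc a b) :=
  (uniqueDiffOn_Ioi 0).prod (uniqueDiffOn_Icc hab)

theorem convex_strip : Convex ℝ (Ioi (0 : ℝ) ×ˢ Icc a b) :=
  (convex_Ioi 0).prod (convex_Icc a b)

namespace SmoothUpTo

theorem smooth_dT (hab : a < b) (hf : SmoothUpTo a b f) : SmoothUpTo a b (dT a b f) :=
  (hf.fderivWithin (uniqueDiffOn_strip hab) (by simp)).clm_apply contDiffOn_const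

theorem smooth_dX (hab : a < b) (hf : SmoothUpTo a b f) : SmoothUpTo a b (dX a b f) :=
  (hf.fderivWithin (uniqueDiffOn_strip hab) (by simp)).clm_apply contDiffOn_const

theorem hasFDerivWithinAt (hf : SmoothUpTo a b f) {t x : ℝ} (ht : 0 < t) (hx : x ∈ Icc a b) :
    HasFDerivWithinAt (fun q : ℝ × ℝ => f q.1 q.2)
      (dT a b f t x • ContinuousLinearMap.fst ℝ ℝ ℝ
        + dX a b f t x • ContinuousLinearMap.snd ℝ ℝ ℝ) (Ioi 0 ×ˢ Icc a b) (t, x) := by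
  have h := (hf.differentiableOn (by simp) (t, x) ⟨ht, hx⟩).hasFDerivWithinAt
  refine h.congr_fderiv ?_
  ext <;> simp [dT, dX]

theorem hasDerivWithinAt (hf : SmoothUpTo a b f) {t x : ℝ} (ht : 0 < t) (hx : x ∈ Icc a b) :
    HasDerivWithinAt (f t) (dX a b f t x) (Icc a b) x := by
  have h := (hf.hasFDerivWithinAt ht hx).comp_hasDerivWithinAt x
    (f := fun z => (t, z)) (((hasDerivAt_const x t).prodMk (hasDerivAt_id x)).hasDerivWithinAt
      (s := Icc a b)) (fun z hz => ⟨ht, hz⟩)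
  simpa [Function.comp_def] using h

theorem hasDerivAt_space (hf : SmoothUpTo a b f) {t x : ℝ} (ht : 0 < t) (hx : x ∈ Ioo a b) :
    HasDerivAt (f t) (dX a b f t x) x :=
  (hf.hasDerivWithinAt ht (Ioo_subset_Icc_self hx)).hasDerivAt (Icc_mem_nhds hx.1 hx.2)

theorem hasDerivAt_time (hf : SmoothUpTo a b f) {t x : ℝ} (ht : 0 < t) (hx : x ∈ Icc a b) :
    HasDerivAt (fun s => f s x) (dT a b f t x) t := by
  have h := (hf.hasFDerivWithinAt ht hx).comp_hasDerivWithinAt t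
    (f := fun s => (s, x)) (((hasDerivAt_id t).prodMk (hasDerivAt_const t x)).hasDerivWithinAt
      (s := Ioi 0)) (fun s hs => ⟨hs, hx⟩)
  simpa [Function.comp_def] using h.hasDerivAt (Ioi_mem_nhds ht)

theorem continuousOn_slice (hf : SmoothUpTo a b f) {t : ℝ} (ht : 0 < t) :
    ContinuousOn (f t) (Icc a b) :=
  ThinFilm.continuousOn_slice hf.continuousOn (x := t) ht

/-- Mixed partial derivatives commute. -/
theorem dT_dX_comm (hab : a < b) (hf : SmoothUpTo a b f) {t x : ℝ} (ht : 0 < t) (hx : x ∈ Icc a b) :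
    dT a b (dX a b f) t x = dX a b (dT a b f) t x := by
  have hu := uniqueDiffOn_strip hab
  have hmem : (t, x) ∈ Ioi (0 : ℝ) ×ˢ Icc a b := ⟨ht, hx⟩
  -- Symmetry of second derivatives within a set holds at boundary points that are limits of
  -- interior points, so the ends of the interval are included.
  have hcl : (t, x) ∈ closure (interior (Ioi (0 : ℝ) ×ˢ Icc a b)) := by
    rw [interior_prod_eq, closure_prod_eq, interior_Ioi, interior_Icc, closure_Ioo hab.ne]
    exact ⟨subset_closure ht, hx⟩
  have hsymm := (hf (t, x) hmem).isSymmSndFDerivWithinAt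
    (by rw [minSmoothness_of_isRCLikeNormedField]; exact WithTop.coe_le_coe.2 le_top) hu hcl hmem
  have hd : DifferentiableWithinAt ℝ
      (fderivWithin ℝ (fun q : ℝ × ℝ => f q.1 q.2) (Ioi (0 : ℝ) ×ˢ Icc a b))
      (Ioi (0 : ℝ) ×ˢ Icc a b) (t, x) :=
    (hf.fderivWithin (m := ∞) hu (by simp)).differentiableOn (by simp) _ hmem
  have e : ∀ w z : ℝ × ℝ, fderivWithin ℝ (fun q : ℝ × ℝ => fderivWithin ℝ
      (fun q : ℝ × ℝ => f q.1 q.2) (Ioi (0 : ℝ) ×ˢ Icc a b) (q.1, q.2) w)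
      (Ioi (0 : ℝ) ×ˢ Icc a b) (t, x) z = fderivWithin ℝ (fderivWithin ℝ
      (fun q : ℝ × ℝ => f q.1 q.2) (Ioi (0 : ℝ) ×ˢ Icc a b)) (Ioi (0 : ℝ) ×ˢ Icc a b) (t, x) z w :=
    fun w z => by
      have := (hd.hasFDerivWithinAt.clm_apply (hasFDerivWithinAt_const w _ _)).fderivWithin
        (hu _ hmem)
      simp only [Prod.mk.eta]
      rw [this]
      simp
  rw [dT, dX]
  unfold dX dT
  rw [e, e]
  exact hsymm _ _

end SmoothUpTo

/-- Smoothness of the inverse of an increasing family of diffeomorphisms of intervals. -/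
theorem SmoothUpTo.inverse {c d : ℝ} (hab : a < b) (hcd : c < d) (hf : SmoothUpTo a b f)
    (hpos : ∀ t, 0 < t → ∀ x ∈ Icc a b, dX a b f t x ≠ 0)
    (hg : ContinuousOn (fun q : ℝ × ℝ => g q.1 q.2) (Ioi 0 ×ˢ Icc c d))
    (hmaps : ∀ t, 0 < t → ∀ y ∈ Icc c d, g t y ∈ Icc a b)
    (hinv : ∀ t, 0 < t → ∀ y ∈ Icc c d, f t (g t y) = y) : SmoothUpTo c d g := by
  have hu := uniqueDiffOn_strip hcd
  set G : ℝ × ℝ → ℝ × ℝ := fun q => (q.1, g q.1 q.2) with hG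
  have hGc : ContinuousOn G (Ioi 0 ×ˢ Icc c d) := continuousOn_fst.prodMk hg
  have hGm : MapsTo G (Ioi 0 ×ˢ Icc c d) (Ioi 0 ×ˢ Icc a b) := fun q hq =>
    ⟨hq.1, hmaps _ hq.1 _ hq.2⟩
  -- The inverse of the triangular differential of `(t, x) ↦ (t, f t x)`.
  set G' : ℝ × ℝ → ℝ × ℝ →L[ℝ] ℝ × ℝ := fun q =>
    (ContinuousLinearMap.fst ℝ ℝ ℝ).prod
      ((dX a b f q.1 (g q.1 q.2))⁻¹ • (ContinuousLinearMap.snd ℝ ℝ ℝ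
        - dT a b f q.1 (g q.1 q.2) • ContinuousLinearMap.fst ℝ ℝ ℝ)) with hG'
  have hder : ∀ q ∈ Ioi (0 : ℝ) ×ˢ Icc c d,
      HasFDerivWithinAt G (G' q) (Ioi 0 ×ˢ Icc c d) q := by
    rintro ⟨t, y⟩ ⟨ht, hy⟩
    have hx := hmaps t ht y hy
    have h1 : HasFDerivWithinAt (fun q : ℝ × ℝ => (q.1, f q.1 q.2))
        ((ContinuousLinearMap.fst ℝ ℝ ℝ).prod
          (dT a b f t (g t y) • ContinuousLinearMap.fst ℝ ℝ ℝ
            + dX a b f t (g t y) • ContinuousLinearMap.snd ℝ ℝ ℝ))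
        (Ioi 0 ×ˢ Icc a b) (G (t, y)) :=
      hasFDerivWithinAt_fst.prodMk (hf.hasFDerivWithinAt ht hx)
    have hne := hpos t ht _ hx
    have := HasFDerivWithinAt.of_comp_of_leftInverse (g := G) (h := id)
      (f'symm := G' (t, y)) (s := Ioi (0 : ℝ) ×ˢ Icc c d) (a := (t, y))
      ((hGc (t, y) ⟨ht, hy⟩).tendsto_nhdsWithin hGm) h1 (hasFDerivWithinAt_id _ _)
      (by
        filter_upwards [self_mem_nhdsWithin] with q hq
        simp [hG, hinv q.1 hq.1 q.2 hq.2])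
      (by
        intro q
        ext
        · simp [hG']
        · simp [hG', inv_mul_cancel_left₀ hne])
      ⟨ht, hy⟩
    simpa using this
  -- Bootstrap: the derivative `G'` is a smooth expression composed with `G` itself, so each order
  -- of regularity of `G` gives the next one.
  have main : ∀ n : ℕ, ContDiffOn ℝ n G (Ioi 0 ×ˢ Icc c d) := by
    intro n
    induction n with
    | zero => exact contDiffOn_zero.2 hGc
    | succ n ih =>
      rw [Nat.cast_succ]
      refine (contDiffOn_succ_iff_hasFDerivWithinAt_of_uniqueDiffOn hu).2
        ⟨fun h => by exact absurd h (by simp), G', ?_, hder⟩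
      have c1 : ContDiffOn ℝ n (fun q : ℝ × ℝ => dX a b f q.1 (g q.1 q.2)) (Ioi 0 ×ˢ Icc c d) :=
        ((hf.smooth_dX hab).of_le (by exact_mod_cast le_top)).comp ih hGm
      have c2 : ContDiffOn ℝ n (fun q : ℝ × ℝ => dT a b f q.1 (g q.1 q.2)) (Ioi 0 ×ˢ Icc c d) :=
        ((hf.smooth_dT hab).of_le (by exact_mod_cast le_top)).comp ih hGm
      refine contDiffOn_clm_apply.2 fun z => ?_
      simp only [hG', ContinuousLinearMap.prod_apply]
      refine contDiffOn_const.prodMk ?_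
      simp only [smul_apply, sub_apply, smul_eq_mul]
      exact (c1.inv fun q hq => hpos _ hq.1 _ (hmaps _ hq.1 _ hq.2)).mul
        (contDiffOn_const.sub (c2.mul contDiffOn_const))
  exact (contDiffOn_infty.2 main).snd

end SmoothUpTo

/-! ### The stationary mass profile and its regular square root. -/

/-- The mass of the stationary film at distance at most `q` from its left contact point. -/
noncomputable def massProfile (q : ℝ) : ℝ := q ^ 2 / 2 - q ^ 3 / 6

theorem massProfile_eq_integral (y : ℝ) :
    (1 / 2) * ∫ s in (-1 : ℝ)..y, (1 - s ^ 2) = massProfile (1 + y) := by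
  rw [intervalIntegral.integral_sub (by simp) (by simp)]
  simp [massProfile]
  ring

theorem hasDerivAt_massProfile (q : ℝ) : HasDerivAt massProfile (q - q ^ 2 / 2) q := by
  refine (((hasDerivAt_pow 2 q).div_const 2).sub ((hasDerivAt_pow 3 q).div_const 6)).congr_deriv ?_
  push_cast; ring

theorem strictMonoOn_massProfile : StrictMonoOn massProfile (Icc 0 2) := by
  refine strictMonoOn_of_deriv_pos (convex_Icc 0 2)
    (fun q _ => (hasDerivAt_massProfile q).continuousAt.continuousWithinAt) fun q hq => ?_
  rw [interior_Icc] at hq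
  rw [(hasDerivAt_massProfile q).deriv]
  nlinarith [hq.1, hq.2]

theorem massProfile_zero : massProfile 0 = 0 := by norm_num [massProfile]

theorem massProfile_two : massProfile 2 = 2 / 3 := by norm_num [massProfile]

/-- Symmetry of the stationary film under `y ↦ -y`; it transfers results from the left to the right
contact point. -/
theorem massProfile_two_sub (q : ℝ) : massProfile (2 - q) = 2 / 3 - massProfile q := by
  simp only [massProfile]; ring

/-- The inverse of `massProfile` on `[0, 2]`. -/
noncomputable def massProfileInv (z : ℝ) : ℝ := Function.invFunOn massProfile (Icc 0 2) z

theorem exists_massProfile_eq {z : ℝ} (hz : z ∈ Icc (0 : ℝ) (2 / 3)) :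
    ∃ q ∈ Icc (0 : ℝ) 2, massProfile q = z := by
  have hc : ContinuousOn massProfile (Icc 0 2) := fun q _ =>
    (hasDerivAt_massProfile q).continuousAt.continuousWithinAt
  have := intermediate_value_Icc (by norm_num : (0 : ℝ) ≤ 2) hc
  rw [massProfile_zero, massProfile_two] at this
  exact this hz

theorem massProfileInv_mem {z : ℝ} (hz : z ∈ Icc (0 : ℝ) (2 / 3)) :
    massProfileInv z ∈ Icc (0 : ℝ) 2 := Function.invFunOn_mem (exists_massProfile_eq hz)

theorem massProfile_inv {z : ℝ} (hz : z ∈ Icc (0 : ℝ) (2 / 3)) :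
    massProfile (massProfileInv z) = z := Function.invFunOn_eq (exists_massProfile_eq hz)

theorem massProfileInv_massProfile {q : ℝ} (hq : q ∈ Icc (0 : ℝ) 2) :
    massProfileInv (massProfile q) = q := by
  have hz : massProfile q ∈ Icc (0 : ℝ) (2 / 3) := by
    rw [← massProfile_zero, ← massProfile_two]
    exact ⟨strictMonoOn_massProfile.monotoneOn (by simp) hq hq.1,
      strictMonoOn_massProfile.monotoneOn hq (by simp) hq.2⟩
  exact strictMonoOn_massProfile.injOn (massProfileInv_mem hz) hq (massProfile_inv hz)

/-- The smooth square root of `massProfile`. -/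
noncomputable def sqrtProfile (q : ℝ) : ℝ := q * √(1 / 2 - q / 6)

theorem sqrtProfile_sq {q : ℝ} (hq : q ≤ 3) : sqrtProfile q ^ 2 = massProfile q := by
  rw [sqrtProfile, mul_pow, Real.sq_sqrt (by linarith), massProfile]; ring

theorem contDiffAt_sqrt_profile {q : ℝ} (hq : q < 3) :
    ContDiffAt ℝ ∞ (fun q : ℝ => √(1 / 2 - q / 6)) q :=
  ContDiffAt.sqrt (by fun_prop) (by linarith)

theorem contDiffAt_sqrtProfile {q : ℝ} (hq : q < 3) : ContDiffAt ℝ ∞ sqrtProfile q :=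
  contDiffAt_id.mul (contDiffAt_sqrt_profile hq)

theorem hasDerivAt_sqrtProfile {q : ℝ} (hq : q < 3) :
    HasDerivAt sqrtProfile ((1 / 2 - q / 4) / √(1 / 2 - q / 6)) q := by
  have h0 : 0 < 1 / 2 - q / 6 := by linarith
  have h1 : HasDerivAt (fun q : ℝ => √(1 / 2 - q / 6)) (-(1 / 6) / (2 * √(1 / 2 - q / 6))) q :=
    (((hasDerivAt_id q).div_const 6).const_sub (1 / 2)).sqrt h0.ne'
  refine ((hasDerivAt_id q).mul h1).congr_deriv ?_
  have h2 : √(1 / 2 - q / 6) ≠ 0 := (Real.sqrt_pos.2 h0).ne'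
  have h3 := Real.sq_sqrt h0.le
  simp only [id]
  clear h1
  generalize √(1 / 2 - q / 6) = r at h2 h3 ⊢
  rw [eq_div_iff h2, add_mul, mul_assoc q, div_mul_eq_mul_div, mul_div_mul_right _ _ h2]
  linarith

/-- The interval reaches below `0`, so that the left contact point `q = 0` is an interior regular
point, and stops at `2`, where the derivative vanishes. -/
theorem strictMonoOn_sqrtProfile : StrictMonoOn sqrtProfile (Ioo (-1) 2) := by
  refine strictMonoOn_of_deriv_pos (convex_Ioo _ _) (fun q hq =>
    (hasDerivAt_sqrtProfile (by linarith [hq.2])).continuousAt.continuousWithinAt) fun q hq => ?_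
  rw [interior_Ioo] at hq
  rw [(hasDerivAt_sqrtProfile (by linarith [hq.2])).deriv]
  exact div_pos (by linarith [hq.2]) (Real.sqrt_pos.2 (by linarith [hq.2]))

/-- The inverse of `sqrtProfile`. -/
noncomputable def sqrtProfileInv (z : ℝ) : ℝ := Function.invFunOn sqrtProfile (Ioo (-1) 2) z

theorem sqrtProfileInv_sqrtProfile {q : ℝ} (hq : q ∈ Ioo (-1 : ℝ) 2) :
    sqrtProfileInv (sqrtProfile q) = q :=
  strictMonoOn_sqrtProfile.injOn (Function.invFunOn_mem ⟨q, hq, rfl⟩) hq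
    (Function.invFunOn_eq ⟨q, hq, rfl⟩)

theorem contDiffAt_sqrtProfileInv {q : ℝ} (hq : q ∈ Ioo (-1 : ℝ) 2) :
    ContDiffAt ℝ ∞ sqrtProfileInv (sqrtProfile q) := by
  have hq3 : q < 3 := by linarith [hq.2]
  have hne : (1 / 2 - q / 4) / √(1 / 2 - q / 6) ≠ 0 :=
    (div_pos (by linarith [hq.2]) (Real.sqrt_pos.2 (by linarith))).ne'
  have hs := contDiffAt_sqrtProfile hq3
  have hd : HasFDerivAt sqrtProfile
      ((ContinuousLinearEquiv.unitsEquivAut ℝ (Units.mk0 _ hne) : ℝ ≃L[ℝ] ℝ) : ℝ →L[ℝ] ℝ) q := by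
    refine (hasDerivAt_sqrtProfile hq3).hasFDerivAt.congr_fderiv ?_
    ext; simp
  have hi := hs.to_localInverse hd (by simp)
  refine hi.congr_of_eventuallyEq ?_
  have hst := hs.hasStrictFDerivAt' hd (by simp)
  have e1 := hst.eventually_right_inverse
  -- The local inverse agrees with `sqrtProfileInv` only where its values stay in the interval of
  -- injectivity.
  have e2 : ∀ᶠ z in 𝓝 (sqrtProfile q), hs.localInverse hd (by simp) z ∈ Ioo (-1 : ℝ) 2 := by
    have hc := hi.continuousAt
    have hval : hs.localInverse hd (by simp) (sqrtProfile q) = q :=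
      hst.localInverse_apply_image
    exact hc.eventually (by rw [hval]; exact Ioo_mem_nhds hq.1 hq.2)
  filter_upwards [e1, e2] with z h1 h2
  calc sqrtProfileInv z = sqrtProfileInv (sqrtProfile (hs.localInverse hd (by simp) z)) := by
        congr 1; exact h1.symm
    _ = _ := sqrtProfileInv_sqrtProfile h2

/-- The factor by which the ratio of the heights differs from the ratio of the leading
coefficients at the contact point. -/
noncomputable def ratioFactor (z : ℝ) : ℝ :=
  √(1 / 2 - sqrtProfileInv z / 6) / (1 - sqrtProfileInv z / 2)

theorem contDiffAt_ratioFactor {q : ℝ} (hq : q ∈ Ioo (-1 : ℝ) 2) :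
    ContDiffAt ℝ ∞ ratioFactor (sqrtProfile q) := by
  have h := contDiffAt_sqrtProfileInv hq
  have hv := sqrtProfileInv_sqrtProfile hq
  unfold ratioFactor
  refine ContDiffAt.div (ContDiffAt.sqrt (by fun_prop) ?_) (by fun_prop) ?_
  · rw [hv]; linarith [hq.2]
  · rw [hv]; linarith [hq.2]

theorem hasDerivWithinAt_parametric_integral {S : Set ℝ} (hS : Convex ℝ S)
    {a b : ℝ} (hab : a ≤ b) {f f' : ℝ → ℝ → ℝ}
    (hf : ContinuousOn (fun q : ℝ × ℝ => f q.1 q.2) (S ×ˢ Icc a b))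
    (hf' : ContinuousOn (fun q : ℝ × ℝ => f' q.1 q.2) (S ×ˢ Icc a b))
    (hd : ∀ x ∈ S, ∀ r ∈ Icc a b, HasDerivWithinAt (fun z => f z r) (f' x r) S x)
    {x₀ : ℝ} (hx₀ : x₀ ∈ S) :
    HasDerivWithinAt (fun x => ∫ r in a..b, f x r) (∫ r in a..b, f' x₀ r) S x₀ := by
  have hc : ContinuousOn (fun q : ℝ × ℝ => ContinuousLinearMap.toSpanSingleton ℝ (f' q.1 q.2))
      (S ×ˢ Icc a b) :=
    (ContinuousLinearMap.toSpanSingletonCLE : ℝ ≃L[ℝ] ℝ →L[ℝ] ℝ).continuous.comp_continuousOn hf'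
  have h := (hasFDerivWithinAt_parametric_integral hS hab hf
    (f' := fun x r => ContinuousLinearMap.toSpanSingleton ℝ (f' x r)) hc
    (fun x hx r hr => (hd x hx r hr).hasFDerivWithinAt) hx₀).hasDerivWithinAt
  refine h.congr_deriv ?_
  rw [ContinuousLinearMap.intervalIntegral_apply
    ((continuousOn_slice (f := fun x r => ContinuousLinearMap.toSpanSingleton ℝ (f' x r)) hc
      hx₀).intervalIntegrable_of_Icc hab)]
  simp

/-! ### Films on the reference interval, averages along segments, reflection. -/

/-- `f` is continuous up to time `0`, together with its space derivative `f'`. -/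
structure C1UpTo (f f' : ℝ → ℝ → ℝ) : Prop where
  cont : ContinuousOn (fun q : ℝ × ℝ => f q.1 q.2) (Ici 0 ×ˢ Icc 0 1)
  cont' : ContinuousOn (fun q : ℝ × ℝ => f' q.1 q.2) (Ici 0 ×ˢ Icc 0 1)
  hasDeriv : ∀ t, 0 ≤ t → ∀ x ∈ Icc (0 : ℝ) 1, HasDerivWithinAt (f t) (f' t x) (Icc 0 1) x

/-- The weighted average of `f t` over the segment from `0` to `x`. -/
noncomputable def rayAverage (w : ℝ → ℝ) (f : ℝ → ℝ → ℝ) (t x : ℝ) : ℝ :=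
  ∫ r in (0 : ℝ)..1, w r * f t (r * x)

theorem mul_mem_unit {r x : ℝ} (hr : r ∈ Icc (0 : ℝ) 1) (hx : x ∈ Icc (0 : ℝ) 1) :
    r * x ∈ Icc (0 : ℝ) 1 :=
  ⟨mul_nonneg hr.1 hx.1, mul_le_one₀ hr.2 hx.1 hx.2⟩

theorem continuousOn_rayAverage {w : ℝ → ℝ} (hw : Continuous w) {f : ℝ → ℝ → ℝ}
    (hf : ContinuousOn (fun q : ℝ × ℝ => f q.1 q.2) (Ici 0 ×ˢ Icc 0 1)) :
    ContinuousOn (fun q : ℝ × ℝ => rayAverage w f q.1 q.2) (Ici 0 ×ˢ Icc 0 1) := by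
  refine continuousOn_parametric_integral (X := ℝ × ℝ) (f := fun p r => w r * f p.1 (r * p.2))
    zero_le_one ?_
  refine (hw.comp continuous_snd).continuousOn.mul ?_
  exact hf.comp (f := fun q : (ℝ × ℝ) × ℝ => (q.1.1, q.2 * q.1.2)) (by fun_prop)
    fun q hq => ⟨hq.1.1, mul_mem_unit hq.2 hq.1.2⟩

/-- Differentiating `f t (r * x)` in `x` puts the extra factor `r` into the weight. -/
theorem C1UpTo.average {f f' : ℝ → ℝ → ℝ} (h : C1UpTo f f') {w : ℝ → ℝ} (hw : Continuous w) :
    C1UpTo (rayAverage w f) (rayAverage (fun r => w r * r) f') where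
  cont := continuousOn_rayAverage hw h.cont
  cont' := continuousOn_rayAverage (by fun_prop) h.cont'
  hasDeriv t ht x hx := by
    have hc : ∀ {g : ℝ → ℝ → ℝ} {ψ : ℝ → ℝ}, Continuous ψ →
        ContinuousOn (fun q : ℝ × ℝ => g q.1 q.2) (Ici 0 ×ˢ Icc 0 1) →
        ContinuousOn (fun q : ℝ × ℝ => ψ q.2 * g t (q.2 * q.1)) (Icc 0 1 ×ˢ Icc 0 1) :=
      fun {g ψ} hψ hg => (hψ.comp continuous_snd).continuousOn.mul
        (hg.comp (f := fun q : ℝ × ℝ => (t, q.2 * q.1)) (by fun_prop)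
          fun q hq => ⟨ht, mul_mem_unit hq.2 hq.1⟩)
    refine hasDerivWithinAt_parametric_integral (convex_Icc 0 1) zero_le_one
      (f := fun x r => w r * f t (r * x)) (f' := fun x r => w r * r * f' t (r * x))
      (hc hw h.cont) (hc (ψ := fun r => w r * r) (by fun_prop) h.cont') (fun x hx r hr => ?_) hx
    have h1 := h.hasDeriv t ht (r * x) (mul_mem_unit hr hx)
    have h2 : HasDerivWithinAt (fun z : ℝ => r * z) r (Icc 0 1) x := by
      simpa using ((hasDerivAt_id x).const_mul r).hasDerivWithinAt
    have h3 := (h1.comp x h2 fun z hz => mul_mem_unit hr hz).const_mul (w r)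
    refine h3.congr_deriv ?_
    ring

theorem SmoothUpTo.average {f : ℝ → ℝ → ℝ} (h : SmoothUpTo 0 1 f) {w : ℝ → ℝ}
    (hw : ContDiff ℝ ∞ w) : SmoothUpTo 0 1 (rayAverage w f) := by
  refine contDiffOn_infty.2 fun n => contDiffOn_parametric_integral (E := ℝ × ℝ) convex_strip
    (uniqueDiffOn_strip zero_lt_one) zero_lt_one n (f := fun p r => w r * f p.1 (r * p.2)) ?_
  refine ContDiffOn.of_le (n := ∞) ?_ (by exact_mod_cast le_top)
  refine (hw.comp contDiff_snd).contDiffOn.mul ?_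
  exact h.comp (f := fun q : (ℝ × ℝ) × ℝ => (q.1.1, q.2 * q.1.2)) (by fun_prop)
    fun q hq => ⟨hq.1.1, mul_mem_unit hq.2 hq.1.2⟩

/-- A film in the fixed reference domain `[0, 1]`: height `U` with derivatives `U'`, `U''`,
length `L`, mass `2 / 3`, vanishing with unit slope at the contact points. -/
structure FilmProfile (L : ℝ → ℝ) (U U' U'' : ℝ → ℝ → ℝ) : Prop where
  length_cont : ContinuousOn L (Ici 0)
  length_pos : ∀ t, 0 ≤ t → 0 < L t
  length_smooth : ContDiffOn ℝ ∞ L (Ioi 0)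
  height : C1UpTo U U'
  slope : C1UpTo U' U''
  smooth : SmoothUpTo 0 1 U
  pos : ∀ t, 0 ≤ t → ∀ x ∈ Ioo (0 : ℝ) 1, 0 < U t x
  left_zero : ∀ t, 0 ≤ t → U t 0 = 0
  right_zero : ∀ t, 0 ≤ t → U t 1 = 0
  left_slope : ∀ t, 0 ≤ t → U' t 0 = L t
  right_slope : ∀ t, 0 ≤ t → U' t 1 = -L t
  mass : ∀ t, 0 ≤ t → L t * ∫ x in (0 : ℝ)..1, U t x = 2 / 3

/-- The mass to the left of `x`. -/
noncomputable def partialMass (L : ℝ → ℝ) (U : ℝ → ℝ → ℝ) (t x : ℝ) : ℝ :=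
  L t * ∫ z in (0 : ℝ)..x, U t z

/-- The mass label in `[-1, 1]` of the point `x`. -/
noncomputable def massLabel (L : ℝ → ℝ) (U : ℝ → ℝ → ℝ) (t x : ℝ) : ℝ :=
  massProfileInv (partialMass L U t x) - 1

/-- The ratio of the height of the film to that of the stationary film at the same mass label. -/
noncomputable def heightRatio (L : ℝ → ℝ) (U : ℝ → ℝ → ℝ) (t x : ℝ) : ℝ :=
  if x ∈ Ioo (0 : ℝ) 1 then U t x / ((1 - massLabel L U t x ^ 2) / 2) else 1

theorem reflect_mem {x : ℝ} (hx : x ∈ Icc (0 : ℝ) 1) : 1 - x ∈ Icc (0 : ℝ) 1 :=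
  ⟨by linarith [hx.2], by linarith [hx.1]⟩

theorem C1UpTo.reflect {f f' : ℝ → ℝ → ℝ} (h : C1UpTo f f') :
    C1UpTo (fun t x => f t (1 - x)) (fun t x => -f' t (1 - x)) where
  cont := h.cont.comp (f := fun q : ℝ × ℝ => (q.1, 1 - q.2)) (by fun_prop)
    fun _ hq => ⟨hq.1, reflect_mem hq.2⟩
  cont' := (h.cont'.comp (f := fun q : ℝ × ℝ => (q.1, 1 - q.2)) (by fun_prop)
    fun _ hq => ⟨hq.1, reflect_mem hq.2⟩).neg
  hasDeriv t ht x hx := by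
    have h1 := h.hasDeriv t ht (1 - x) (reflect_mem hx)
    have h2 : HasDerivWithinAt (fun z : ℝ => 1 - z) (-1) (Icc 0 1) x :=
      ((hasDerivAt_id x).const_sub 1).hasDerivWithinAt
    exact (h1.comp x h2 fun z hz => reflect_mem hz).congr_deriv (by ring)

theorem C1UpTo.neg {f f' : ℝ → ℝ → ℝ} (h : C1UpTo f f') :
    C1UpTo (fun t x => -f t x) (fun t x => -f' t x) where
  cont := h.cont.neg
  cont' := h.cont'.neg
  hasDeriv t ht x hx := (h.hasDeriv t ht x hx).neg

theorem contDiffOn_strip_reflect :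
    ContDiffOn ℝ ∞ (fun q : ℝ × ℝ => (q.1, 1 - q.2)) (Ioi 0 ×ˢ Icc 0 1) := by fun_prop

theorem mapsTo_reflect (I : Set ℝ) :
    MapsTo (fun q : ℝ × ℝ => (q.1, 1 - q.2)) (I ×ˢ Icc 0 1) (I ×ˢ Icc 0 1) :=
  fun _ hq => ⟨hq.1, reflect_mem hq.2⟩

/-! ### The mass label and the height ratio near the left contact point. -/

namespace FilmProfile

variable {L : ℝ → ℝ} {U U' U'' : ℝ → ℝ → ℝ}

theorem reflect (h : FilmProfile L U U' U'') :
    FilmProfile L (fun t x => U t (1 - x)) (fun t x => -U' t (1 - x))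
      (fun t x => U'' t (1 - x)) where
  length_cont := h.length_cont
  length_pos := h.length_pos
  length_smooth := h.length_smooth
  height := h.height.reflect
  slope := by simpa using h.slope.reflect.neg
  smooth := h.smooth.comp contDiffOn_strip_reflect (mapsTo_reflect _)
  pos t ht x hx := h.pos t ht _ ⟨by linarith [hx.2], by linarith [hx.1]⟩
  left_zero t ht := by simpa using h.right_zero t ht
  right_zero t ht := by simpa using h.left_zero t ht
  left_slope t ht := by simp [h.right_slope t ht]
  right_slope t ht := by simp [h.left_slope t ht]
  mass t ht := by
    rw [intervalIntegral.integral_comp_sub_left (fun x => U t x) 1]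
    simpa using h.mass t ht

theorem intervalIntegrable (h : FilmProfile L U U' U'') {t : ℝ} (ht : 0 ≤ t) {x y : ℝ}
    (hx : x ∈ Icc (0 : ℝ) 1) (hy : y ∈ Icc (0 : ℝ) 1) :
    IntervalIntegrable (U t) volume x y :=
  ((continuousOn_slice h.height.cont (x := t) ht).mono
    (by rw [← uIcc_of_le zero_le_one] at hx hy ⊢; exact uIcc_subset_uIcc hx hy)).intervalIntegrable

theorem partialMass_sub (h : FilmProfile L U U' U'') {t : ℝ} (ht : 0 ≤ t) {x y : ℝ}
    (hx : x ∈ Icc (0 : ℝ) 1) (hy : y ∈ Icc (0 : ℝ) 1) :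
    partialMass L U t y - partialMass L U t x = L t * ∫ z in x..y, U t z := by
  rw [partialMass, partialMass, ← mul_sub, intervalIntegral.integral_interval_sub_left
    (h.intervalIntegrable ht (by simp) hy) (h.intervalIntegrable ht (by simp) hx)]

theorem strictMonoOn_partialMass (h : FilmProfile L U U' U'') {t : ℝ} (ht : 0 ≤ t) :
    StrictMonoOn (partialMass L U t) (Icc 0 1) := by
  intro x hx y hy hxy
  rw [← sub_pos, h.partialMass_sub ht hx hy]
  refine mul_pos (h.length_pos t ht) (intervalIntegral.intervalIntegral_pos_of_pos_on
    (h.intervalIntegrable ht hx hy) (fun z hz => h.pos t ht z ?_) hxy)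
  exact ⟨hx.1.trans_lt hz.1, hz.2.trans_le hy.2⟩

theorem partialMass_zero (t : ℝ) : partialMass L U t 0 = 0 := by simp [partialMass]

theorem partialMass_one (h : FilmProfile L U U' U'') {t : ℝ} (ht : 0 ≤ t) :
    partialMass L U t 1 = 2 / 3 := h.mass t ht

theorem partialMass_mem (h : FilmProfile L U U' U'') {t : ℝ} (ht : 0 ≤ t) {x : ℝ}
    (hx : x ∈ Icc (0 : ℝ) 1) : partialMass L U t x ∈ Icc (0 : ℝ) (2 / 3) := by
  rw [← partialMass_zero (L := L) (U := U) t, ← h.partialMass_one ht]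
  exact ⟨(h.strictMonoOn_partialMass ht).monotoneOn (by simp) hx hx.1,
    (h.strictMonoOn_partialMass ht).monotoneOn hx (by simp) hx.2⟩

theorem massProfile_massLabel (h : FilmProfile L U U' U'') {t : ℝ} (ht : 0 ≤ t) {x : ℝ}
    (hx : x ∈ Icc (0 : ℝ) 1) : massProfile (1 + massLabel L U t x) = partialMass L U t x := by
  rw [massLabel, add_sub_cancel]
  exact massProfile_inv (h.partialMass_mem ht hx)

theorem massLabel_mem (h : FilmProfile L U U' U'') {t : ℝ} (ht : 0 ≤ t) {x : ℝ}
    (hx : x ∈ Icc (0 : ℝ) 1) : 1 + massLabel L U t x ∈ Icc (0 : ℝ) 2 := by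
  rw [massLabel, add_sub_cancel]
  exact massProfileInv_mem (h.partialMass_mem ht hx)

theorem strictMonoOn_massLabel (h : FilmProfile L U U' U'') {t : ℝ} (ht : 0 ≤ t) :
    StrictMonoOn (massLabel L U t) (Icc 0 1) := by
  intro x hx y hy hxy
  have h1 := h.strictMonoOn_partialMass ht hx hy hxy
  rw [← h.massProfile_massLabel ht hx, ← h.massProfile_massLabel ht hy] at h1
  have := (strictMonoOn_massProfile.lt_iff_lt (h.massLabel_mem ht hx)
    (h.massLabel_mem ht hy)).1 h1
  linarith

theorem massLabel_zero (t : ℝ) : massLabel L U t 0 = -1 := by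
  have h : massProfileInv 0 = 0 := by
    rw [← massProfile_zero, massProfileInv_massProfile (by simp), massProfile_zero]
  rw [massLabel, partialMass_zero, h]; norm_num

theorem massLabel_one (h : FilmProfile L U U' U'') {t : ℝ} (ht : 0 ≤ t) :
    massLabel L U t 1 = 1 := by
  rw [massLabel, h.partialMass_one ht, ← massProfile_two, massProfileInv_massProfile (by simp)]
  norm_num

theorem massLabel_reflect (h : FilmProfile L U U' U'') {t : ℝ} (ht : 0 ≤ t) {x : ℝ}
    (hx : x ∈ Icc (0 : ℝ) 1) :
    massLabel L (fun t x => U t (1 - x)) t x = -massLabel L U t (1 - x) := by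
  have hp : partialMass L (fun t x => U t (1 - x)) t x = 2 / 3 - partialMass L U t (1 - x) := by
    rw [← h.partialMass_one ht, h.partialMass_sub ht (reflect_mem hx) (by simp), partialMass,
      intervalIntegral.integral_comp_sub_left (fun x => U t x) 1]
    simp
  have hm := h.massLabel_mem ht (reflect_mem hx)
  have key : massProfileInv (2 / 3 - partialMass L U t (1 - x)) = 2 - (1 + massLabel L U t (1 - x)) := by
    rw [← h.massProfile_massLabel ht (reflect_mem hx), ← massProfile_two_sub]
    exact massProfileInv_massProfile ⟨by linarith [hm.2], by linarith [hm.1]⟩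
  rw [massLabel, hp, key]; ring

theorem heightRatio_reflect (h : FilmProfile L U U' U'') {t : ℝ} (ht : 0 ≤ t) {x : ℝ}
    (hx : x ∈ Icc (0 : ℝ) 1) :
    heightRatio L (fun t x => U t (1 - x)) t x = heightRatio L U t (1 - x) := by
  have : x ∈ Ioo (0 : ℝ) 1 ↔ 1 - x ∈ Ioo (0 : ℝ) 1 := by
    simp only [mem_Ioo]; constructor <;> rintro ⟨_, _⟩ <;> constructor <;> linarith
  simp only [heightRatio, this, h.massLabel_reflect ht hx, neg_sq]

/-- The slope of the chord from the left contact point. -/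
theorem mul_rayAverage_one (h : FilmProfile L U U' U'') {t : ℝ} (ht : 0 ≤ t) {x : ℝ}
    (hx : x ∈ Icc (0 : ℝ) 1) : x * rayAverage (fun _ => 1) U' t x = U t x := by
  have := integral_eq_sub_of_interior (zero_le_one' ℝ) (f := fun r => U t (r * x))
    (f' := fun r => x * (1 * U' t (r * x)))
    ((continuousOn_slice h.height.cont (x := t) ht).comp (by fun_prop)
      fun r hr => mul_mem_unit hr hx)
    (continuousOn_const.mul (continuousOn_const.mul
      ((continuousOn_slice h.height.cont' (x := t) ht).comp (by fun_prop)
      fun r hr => mul_mem_unit hr hx)))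
    (fun r hr => by
      have hr' := Ioo_subset_Icc_self hr
      have h1 := (h.height.hasDeriv t ht (r * x) (mul_mem_unit hr' hx)).comp r
        (((hasDerivAt_id r).mul_const x).hasDerivWithinAt (s := Icc 0 1))
        fun z hz => mul_mem_unit hz hx
      exact (h1.hasDerivAt (Icc_mem_nhds hr.1 hr.2)).congr_deriv (by ring))
  rw [intervalIntegral.integral_const_mul] at this
  rw [rayAverage, this]
  simp [h.left_zero t ht]

/-- Integration by parts against `1 - r`: the boundary term vanishes at `r = 1` because of the
weight and at `r = 0` because the height does. The quadratic vanishing of the mass at the contact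
point is thereby factored out, with a remaining coefficient as regular as `U'`. -/
theorem partialMass_eq (h : FilmProfile L U U' U'') {t : ℝ} (ht : 0 ≤ t) {x : ℝ}
    (hx : x ∈ Icc (0 : ℝ) 1) :
    partialMass L U t x = x ^ 2 * (L t * rayAverage (fun r => 1 - r) U' t x) := by
  have cU : ContinuousOn (fun r => U t (r * x)) (Icc 0 1) :=
    (continuousOn_slice h.height.cont (x := t) ht).comp (by fun_prop) fun r hr => mul_mem_unit hr hx
  have cU' : ContinuousOn (fun r => U' t (r * x)) (Icc 0 1) :=
    (continuousOn_slice h.height.cont' (x := t) ht).comp (by fun_prop)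
      fun r hr => mul_mem_unit hr hx
  have c2 : ContinuousOn (fun r => x * ((1 - r) * U' t (r * x))) (Icc 0 1) :=
    continuousOn_const.mul ((by fun_prop : Continuous fun r : ℝ => 1 - r).continuousOn.mul cU')
  have := integral_eq_sub_of_interior (zero_le_one' ℝ) (f := fun r => (1 - r) * U t (r * x))
    (f' := fun r => x * ((1 - r) * U' t (r * x)) - U t (r * x))
    ((by fun_prop : Continuous fun r : ℝ => 1 - r).continuousOn.mul cU) (c2.sub cU)
    (fun r hr => by
      have hr' := Ioo_subset_Icc_self hr
      have h1 := (h.height.hasDeriv t ht (r * x) (mul_mem_unit hr' hx)).comp r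
        (((hasDerivAt_id r).mul_const x).hasDerivWithinAt (s := Icc 0 1))
        fun z hz => mul_mem_unit hz hx
      have h2 := h1.hasDerivAt (Icc_mem_nhds hr.1 hr.2)
      refine (((hasDerivAt_id r).const_sub 1).mul h2).congr_deriv ?_
      simp only [Function.comp, id]; ring)
  rw [intervalIntegral.integral_sub (c2.intervalIntegrable_of_Icc zero_le_one)
    (cU.intervalIntegrable_of_Icc zero_le_one), intervalIntegral.integral_const_mul] at this
  have e : x * ∫ r in (0 : ℝ)..1, U t (r * x) = ∫ z in (0 : ℝ)..x, U t z := by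
    simp
  rw [partialMass, rayAverage, ← e]
  simp only [sub_self, zero_mul, h.left_zero t ht, mul_zero, sub_zero] at this
  linear_combination (-(L t * x)) * this

/-- For `x > 0` this is positivity of the mass to the left of `x`; at `x = 0` the value is `L² / 2`,
because the slope is nonzero there. The square root of the coefficient is therefore smooth up to the
contact point. -/
theorem rayAverage_weight_pos (h : FilmProfile L U U' U'') {t : ℝ} (ht : 0 ≤ t) {x : ℝ}
    (hx : x ∈ Icc (0 : ℝ) 1) : 0 < L t * rayAverage (fun r => 1 - r) U' t x := by
  rcases hx.1.eq_or_lt with rfl | hx0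
  · have hL := h.length_pos t ht
    have : ∫ r in (0 : ℝ)..1, (1 - r) = 1 / 2 := by
      rw [intervalIntegral.integral_sub (by simp) (by simp)]; simp; norm_num
    simp only [rayAverage, mul_zero, h.left_slope t ht, intervalIntegral.integral_mul_const, this]
    positivity
  · have h1 := h.strictMonoOn_partialMass ht (by simp) hx hx0
    rw [partialMass_zero, h.partialMass_eq ht hx] at h1
    exact (pos_iff_pos_of_mul_pos h1).1 (by positivity)

/-- The representation of the mass label near the left contact point. -/
theorem sqrtProfile_massLabel (h : FilmProfile L U U' U'') {t : ℝ} (ht : 0 ≤ t) {x : ℝ}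
    (hx : x ∈ Icc (0 : ℝ) 1) :
    sqrtProfile (1 + massLabel L U t x) = x * √(L t * rayAverage (fun r => 1 - r) U' t x) := by
  have hm := h.massLabel_mem ht hx
  refine (sq_eq_sq₀ (a := sqrtProfile _) (mul_nonneg hm.1 (Real.sqrt_nonneg _))
    (mul_nonneg hx.1 (Real.sqrt_nonneg _))).1 ?_
  rw [sqrtProfile_sq (by linarith [hm.2]), h.massProfile_massLabel ht hx, h.partialMass_eq ht hx,
    mul_pow, Real.sq_sqrt (h.rayAverage_weight_pos ht hx).le]

theorem massLabel_lt (h : FilmProfile L U U' U'') {t : ℝ} (ht : 0 ≤ t) {x : ℝ}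
    (hx : x ∈ Ico (0 : ℝ) 1) : 1 + massLabel L U t x ∈ Ioo (-1 : ℝ) 2 := by
  have h0 := (h.massLabel_mem ht ⟨hx.1, hx.2.le⟩).1
  have h1 := h.strictMonoOn_massLabel ht ⟨hx.1, hx.2.le⟩ (by simp) hx.2
  rw [h.massLabel_one ht] at h1
  exact ⟨by linarith, by linarith⟩

theorem massLabel_eq (h : FilmProfile L U U' U'') {t : ℝ} (ht : 0 ≤ t) {x : ℝ}
    (hx : x ∈ Ico (0 : ℝ) 1) : massLabel L U t x =
      sqrtProfileInv (x * √(L t * rayAverage (fun r => 1 - r) U' t x)) - 1 := by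
  rw [← h.sqrtProfile_massLabel ht ⟨hx.1, hx.2.le⟩,
    sqrtProfileInv_sqrtProfile (h.massLabel_lt ht hx)]
  ring

/-- With `q = 1 + massLabel`, the heights are `U = x * rayAverage` and `q (1 - q / 2)`, while `x`
and `q` are related by `sqrtProfile_massLabel`; the common vanishing factor cancels. At `x = 0` the
formula gives `1` exactly because the rescaled slope is `L`, which justifies the value prescribed in
`heightRatio`. -/
theorem heightRatio_eq (h : FilmProfile L U U' U'') {t : ℝ} (ht : 0 ≤ t) {x : ℝ}
    (hx : x ∈ Ico (0 : ℝ) 1) : heightRatio L U t x =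
      rayAverage (fun _ => 1) U' t x / √(L t * rayAverage (fun r => 1 - r) U' t x)
        * ratioFactor (x * √(L t * rayAverage (fun r => 1 - r) U' t x)) := by
  have hx' : x ∈ Icc (0 : ℝ) 1 := ⟨hx.1, hx.2.le⟩
  have ha : 0 < √(L t * rayAverage (fun r => 1 - r) U' t x) :=
    Real.sqrt_pos.2 (h.rayAverage_weight_pos ht hx')
  have hm := h.massLabel_lt ht hx
  have hs := h.sqrtProfile_massLabel ht hx'
  have hq0 := (h.massLabel_mem ht hx').1
  rw [← hs, ratioFactor, sqrtProfileInv_sqrtProfile hm]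
  rcases hx.1.eq_or_lt with rfl | hx0
  · have hL := h.length_pos t ht
    have : ∫ r in (0 : ℝ)..1, (1 - r) = 1 / 2 := by
      rw [intervalIntegral.integral_sub (by simp) (by simp)]; simp; norm_num
    simp only [rayAverage, mul_zero, h.left_slope t ht, intervalIntegral.integral_mul_const, this,
      massLabel_zero, heightRatio]
    have e : L t * (1 / 2 * L t) = L t ^ 2 * (1 / 2) := by ring
    have e2 : √(1 / 2 : ℝ) ≠ 0 := (Real.sqrt_pos.2 (by norm_num)).ne'
    rw [e, Real.sqrt_mul (sq_nonneg _), Real.sqrt_sq hL.le]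
    simp
    field_simp
  · rw [heightRatio, if_pos ⟨hx0, hx.2⟩, ← h.mul_rayAverage_one ht hx']
    set q := 1 + massLabel L U t x with hq
    have hl : massLabel L U t x = q - 1 := by rw [hq]; ring
    have hqpos : 0 < q := by
      have := h.strictMonoOn_massLabel ht (by simp) hx' hx0
      rw [massLabel_zero] at this
      linarith
    have hr : 0 < √(1 / 2 - q / 6) := Real.sqrt_pos.2 (by linarith [hm.2])
    have h2q : 0 < 1 - q / 2 := by linarith [hm.2]
    rw [sqrtProfile] at hs
    rw [hl, show (1 - (q - 1) ^ 2) / 2 = q * (1 - q / 2) by ring, div_mul_div_comm,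
      div_eq_div_iff (by positivity) (by positivity)]
    linear_combination (-(rayAverage (fun _ => 1) U' t x) * (1 - q / 2)) * hs

end FilmProfile

theorem contDiff_weight : ContDiff ℝ ∞ (fun r : ℝ => 1 - r) := by fun_prop

namespace FilmProfile

variable {L : ℝ → ℝ} {U U' U'' : ℝ → ℝ → ℝ}

theorem smooth_slope (h : FilmProfile L U U' U'') : SmoothUpTo 0 1 U' := by
  refine (h.smooth.smooth_dX zero_lt_one).congr fun q hq => ?_
  have hq1 : 0 < q.1 := hq.1
  have h1 := (h.height.hasDeriv q.1 hq1.le q.2 hq.2).derivWithin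
    (uniqueDiffOn_Icc zero_lt_one _ hq.2)
  rw [← h1]
  exact (h.smooth.hasDerivWithinAt hq.1 hq.2).derivWithin (uniqueDiffOn_Icc zero_lt_one _ hq.2)

/-- The square root of the ratio of the partial mass and the square of the distance to the left
contact point. -/
theorem smooth_massRoot (h : FilmProfile L U U' U'') :
    SmoothUpTo 0 1 fun t x => √(L t * rayAverage (fun r => 1 - r) U' t x) := by
  refine ContDiffOn.sqrt (ContDiffOn.mul ?_ (h.smooth_slope.average contDiff_weight)) fun q hq => ?_
  · exact h.length_smooth.comp contDiffOn_fst fun q hq => hq.1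
  · exact (h.rayAverage_weight_pos (le_of_lt hq.1) hq.2).ne'

theorem C1_massRoot (h : FilmProfile L U U' U'') :
    C1UpTo (fun t x => √(L t * rayAverage (fun r => 1 - r) U' t x))
      (fun t x => L t * rayAverage (fun r => (1 - r) * r) U'' t x /
        (2 * √(L t * rayAverage (fun r => 1 - r) U' t x))) := by
  have hm := h.slope.average (w := fun r => 1 - r) (by fun_prop)
  have hL : ContinuousOn (fun q : ℝ × ℝ => L q.1) (Ici 0 ×ˢ Icc 0 1) :=
    h.length_cont.comp continuousOn_fst fun q hq => hq.1
  have hc : ContinuousOn (fun q : ℝ × ℝ => √(L q.1 * rayAverage (fun r => 1 - r) U' q.1 q.2))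
      (Ici 0 ×ˢ Icc 0 1) := (hL.mul hm.cont).sqrt
  refine ⟨hc, (hL.mul hm.cont').div (continuousOn_const.mul hc) fun q hq => ?_,
    fun t ht x hx => ?_⟩
  · exact mul_ne_zero two_ne_zero (Real.sqrt_pos.2 (h.rayAverage_weight_pos hq.1 hq.2)).ne'
  · exact ((hm.hasDeriv t ht x hx).const_mul (L t)).sqrt (h.rayAverage_weight_pos ht hx).ne'

theorem exists_sqrtProfile_eq (h : FilmProfile L U U' U'') {t : ℝ} (ht : 0 ≤ t) {x : ℝ}
    (hx : x ∈ Icc (0 : ℝ) 1) (hx1 : x < 1) : ∃ q ∈ Ioo (-1 : ℝ) 2,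
      x * √(L t * rayAverage (fun r => 1 - r) U' t x) = sqrtProfile q :=
  ⟨_, h.massLabel_lt ht ⟨hx.1, hx1⟩, (h.sqrtProfile_massLabel ht hx).symm⟩

theorem eventually_lt_one {I : Set ℝ} {p : ℝ × ℝ} (hp : p.2 < 1) :
    ∀ᶠ q in 𝓝[I ×ˢ Icc (0 : ℝ) 1] p, q ∈ I ×ˢ Icc (0 : ℝ) 1 ∧ q.2 < 1 :=
  Filter.Eventually.and self_mem_nhdsWithin (nhdsWithin_le_nhds
    (continuous_snd.continuousAt.eventually (gt_mem_nhds hp)))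

theorem contDiffWithinAt_massLabel_left (h : FilmProfile L U U' U'') {p : ℝ × ℝ}
    (hp : p ∈ Ioi (0 : ℝ) ×ˢ Icc (0 : ℝ) 1) (hp1 : p.2 < 1) :
    ContDiffWithinAt ℝ ∞ (fun q : ℝ × ℝ => massLabel L U q.1 q.2) (Ioi 0 ×ˢ Icc 0 1) p := by
  obtain ⟨q, hq, e⟩ := h.exists_sqrtProfile_eq (le_of_lt hp.1) hp.2 hp1
  have hz : ContDiffWithinAt ℝ ∞ (fun q : ℝ × ℝ =>
      q.2 * √(L q.1 * rayAverage (fun r => 1 - r) U' q.1 q.2)) (Ioi 0 ×ˢ Icc 0 1) p :=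
    contDiffWithinAt_snd.mul (h.smooth_massRoot p hp)
  have hs := contDiffAt_sqrtProfileInv hq
  rw [← e] at hs
  refine ((hs.comp_contDiffWithinAt p hz).sub (contDiffWithinAt_const (c := 1))).congr_of_eventuallyEq_of_mem
    (f₁ := fun q : ℝ × ℝ => massLabel L U q.1 q.2) ?_ hp
  filter_upwards [eventually_lt_one hp1] with r hr
  exact h.massLabel_eq (le_of_lt hr.1.1) ⟨hr.1.2.1, hr.2⟩

theorem contDiffWithinAt_heightRatio_left (h : FilmProfile L U U' U'') {p : ℝ × ℝ}
    (hp : p ∈ Ioi (0 : ℝ) ×ˢ Icc (0 : ℝ) 1) (hp1 : p.2 < 1) :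
    ContDiffWithinAt ℝ ∞ (fun q : ℝ × ℝ => heightRatio L U q.1 q.2) (Ioi 0 ×ˢ Icc 0 1) p := by
  obtain ⟨q, hq, e⟩ := h.exists_sqrtProfile_eq (le_of_lt hp.1) hp.2 hp1
  have hz : ContDiffWithinAt ℝ ∞ (fun q : ℝ × ℝ =>
      q.2 * √(L q.1 * rayAverage (fun r => 1 - r) U' q.1 q.2)) (Ioi 0 ×ˢ Icc 0 1) p :=
    contDiffWithinAt_snd.mul (h.smooth_massRoot p hp)
  have hs := contDiffAt_ratioFactor hq
  rw [← e] at hs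
  refine (((h.smooth_slope.average (contDiff_const (c := 1)) p hp).div (h.smooth_massRoot p hp) ?_).mul
    (hs.comp_contDiffWithinAt p hz)).congr_of_eventuallyEq_of_mem
    (f₁ := fun q : ℝ × ℝ => heightRatio L U q.1 q.2) ?_ hp
  · exact (Real.sqrt_pos.2 (h.rayAverage_weight_pos (le_of_lt hp.1) hp.2)).ne'
  · filter_upwards [eventually_lt_one hp1] with r hr
    exact h.heightRatio_eq (le_of_lt hr.1.1) ⟨hr.1.2.1, hr.2⟩

theorem continuousWithinAt_root_arg (h : FilmProfile L U U' U'') {p : ℝ × ℝ}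
    (hp : p ∈ Ici (0 : ℝ) ×ˢ Icc (0 : ℝ) 1) :
    ContinuousWithinAt (fun q : ℝ × ℝ =>
      q.2 * √(L q.1 * rayAverage (fun r => 1 - r) U' q.1 q.2)) (Ici 0 ×ˢ Icc 0 1) p :=
  continuousWithinAt_snd.mul (h.C1_massRoot.cont p hp)

theorem continuousWithinAt_massLabel_left (h : FilmProfile L U U' U'') {p : ℝ × ℝ}
    (hp : p ∈ Ici (0 : ℝ) ×ˢ Icc (0 : ℝ) 1) (hp1 : p.2 < 1) :
    ContinuousWithinAt (fun q : ℝ × ℝ => massLabel L U q.1 q.2) (Ici 0 ×ˢ Icc 0 1) p := by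
  obtain ⟨q, hq, e⟩ := h.exists_sqrtProfile_eq hp.1 hp.2 hp1
  have hs := (contDiffAt_sqrtProfileInv hq).continuousAt
  rw [← e] at hs
  refine ((hs.comp_continuousWithinAt (f := fun q : ℝ × ℝ =>
    q.2 * √(L q.1 * rayAverage (fun r => 1 - r) U' q.1 q.2))
    (h.continuousWithinAt_root_arg hp)).sub
    (continuousWithinAt_const (b := 1))).congr_of_eventuallyEq_of_mem
    (g := fun q : ℝ × ℝ => massLabel L U q.1 q.2) ?_ hp
  filter_upwards [eventually_lt_one hp1] with r hr
  exact h.massLabel_eq hr.1.1 ⟨hr.1.2.1, hr.2⟩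

theorem eventually_lt_one_slice {x : ℝ} (hx1 : x < 1) :
    ∀ᶠ z in 𝓝[Icc (0 : ℝ) 1] x, z ∈ Ico (0 : ℝ) 1 := by
  filter_upwards [self_mem_nhdsWithin, nhdsWithin_le_nhds (gt_mem_nhds hx1)] with z h1 h2
  exact ⟨h1.1, h2⟩

theorem hasDerivWithinAt_root_arg (h : FilmProfile L U U' U'') {t : ℝ} (ht : 0 ≤ t) {x : ℝ}
    (hx : x ∈ Icc (0 : ℝ) 1) :
    HasDerivWithinAt (fun x => x * √(L t * rayAverage (fun r => 1 - r) U' t x))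
      (√(L t * rayAverage (fun r => 1 - r) U' t x) +
        x * (L t * rayAverage (fun r => (1 - r) * r) U'' t x /
        (2 * √(L t * rayAverage (fun r => 1 - r) U' t x)))) (Icc 0 1) x :=
  ((hasDerivWithinAt_id x _).mul (h.C1_massRoot.hasDeriv t ht x hx)).congr_deriv (by simp)

theorem differentiableWithinAt_massLabel (h : FilmProfile L U U' U'') {t : ℝ} (ht : 0 ≤ t) {x : ℝ}
    (hx : x ∈ Icc (0 : ℝ) 1) (hx1 : x < 1) :
    DifferentiableWithinAt ℝ (massLabel L U t) (Icc 0 1) x := by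
  obtain ⟨q, hq, e⟩ := h.exists_sqrtProfile_eq ht hx hx1
  have hs := (contDiffAt_sqrtProfileInv hq).differentiableAt (by simp)
  rw [← e] at hs
  refine ((hs.comp_differentiableWithinAt (f := fun x =>
    x * √(L t * rayAverage (fun r => 1 - r) U' t x)) x
    (h.hasDerivWithinAt_root_arg ht hx).differentiableWithinAt).sub_const
    1).congr_of_eventuallyEq_of_mem ?_ hx
  filter_upwards [eventually_lt_one_slice hx1] with z hz
  exact h.massLabel_eq ht hz

/-- The space derivative of the height ratio. -/
theorem exists_deriv_heightRatio_left (h : FilmProfile L U U' U'') : ∃ v' : ℝ → ℝ → ℝ,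
    ∀ p ∈ Ici (0 : ℝ) ×ˢ Icc (0 : ℝ) 1, p.2 < 1 →
      ContinuousWithinAt (fun q : ℝ × ℝ => v' q.1 q.2) (Ici 0 ×ˢ Icc 0 1) p ∧
      HasDerivWithinAt (heightRatio L U p.1) (v' p.1 p.2) (Icc 0 1) p.2 := by
  have hk := h.slope.average (w := fun _ => 1) continuous_const
  have ha := h.C1_massRoot
  set k := rayAverage (fun _ => 1) U' with hk_def
  set k' := rayAverage (fun r => 1 * r) U''
  set a := fun t x => √(L t * rayAverage (fun r => 1 - r) U' t x) with ha_def
  set a' := fun t x => L t * rayAverage (fun r => (1 - r) * r) U'' t x / (2 * a t x)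
  refine ⟨fun t x => (k' t x * a t x - k t x * a' t x) / a t x ^ 2 * ratioFactor (x * a t x)
    + k t x / a t x * (deriv ratioFactor (x * a t x) * (a t x + x * a' t x)), fun p hp hp1 => ?_⟩
  obtain ⟨q, hq, e⟩ := h.exists_sqrtProfile_eq hp.1 hp.2 hp1
  have hs := contDiffAt_ratioFactor hq
  rw [← e] at hs
  have hane : a p.1 p.2 ≠ 0 := (Real.sqrt_pos.2 (h.rayAverage_weight_pos hp.1 hp.2)).ne'
  have hs' : ContinuousAt (deriv ratioFactor) (p.2 * a p.1 p.2) :=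
    (hs.derivWithin (m := 0) (by simp)).continuousAt
  have harg := h.continuousWithinAt_root_arg hp
  have c1 := hs.continuousAt.comp_continuousWithinAt (f := fun q : ℝ × ℝ => q.2 * a q.1 q.2) harg
  have c2 := hs'.comp_continuousWithinAt (f := fun q : ℝ × ℝ => q.2 * a q.1 q.2) harg
  refine ⟨?_, ?_⟩
  · refine ((((hk.cont' p hp).mul (ha.cont p hp)).sub ((hk.cont p hp).mul (ha.cont' p hp))).div
      ((ha.cont p hp).pow 2) (pow_ne_zero 2 hane)).mul c1 |>.add
      (((hk.cont p hp).div (ha.cont p hp) hane).mul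
        (c2.mul ((ha.cont p hp).add (continuousWithinAt_snd.mul (ha.cont' p hp)))))
  · have d1 := (hk.hasDeriv p.1 hp.1 p.2 hp.2).div (ha.hasDeriv p.1 hp.1 p.2 hp.2) hane
    have d2 := (hs.differentiableAt (by simp)).hasDerivAt.comp_hasDerivWithinAt p.2
      (h.hasDerivWithinAt_root_arg hp.1 hp.2)
    refine (d1.mul d2).congr_of_eventuallyEq_of_mem ?_ hp.2
    filter_upwards [eventually_lt_one_slice hp1] with z hz
    exact h.heightRatio_eq hp.1 hz

end FilmProfile

/-! ### Regularity up to both contact points, by reflection. -/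

theorem reflect_lt_one {x : ℝ} (hx : ¬x < 1) : 1 - x < 1 := by linarith

namespace FilmProfile

variable {L : ℝ → ℝ} {U U' U'' : ℝ → ℝ → ℝ}

theorem heightRatio_eq_reflect (h : FilmProfile L U U' U'') {t : ℝ} (ht : 0 ≤ t) {x : ℝ}
    (hx : x ∈ Icc (0 : ℝ) 1) :
    heightRatio L U t x = heightRatio L (fun t x => U t (1 - x)) t (1 - x) := by
  rw [h.heightRatio_reflect ht (reflect_mem hx), sub_sub_cancel]

theorem massLabel_eq_reflect (h : FilmProfile L U U' U'') {t : ℝ} (ht : 0 ≤ t) {x : ℝ}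
    (hx : x ∈ Icc (0 : ℝ) 1) :
    massLabel L U t x = -massLabel L (fun t x => U t (1 - x)) t (1 - x) := by
  rw [h.massLabel_reflect ht (reflect_mem hx), sub_sub_cancel, neg_neg]

theorem smooth_heightRatio (h : FilmProfile L U U' U'') : SmoothUpTo 0 1 (heightRatio L U) := by
  intro p hp
  by_cases hp1 : p.2 < 1
  · exact h.contDiffWithinAt_heightRatio_left hp hp1
  · have := (h.reflect.contDiffWithinAt_heightRatio_left (p := (p.1, 1 - p.2))
      (mapsTo_reflect _ hp) (reflect_lt_one hp1)).comp p (contDiffOn_strip_reflect p hp)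
      (mapsTo_reflect _)
    exact this.congr_of_mem (fun q hq => h.heightRatio_eq_reflect (le_of_lt hq.1) hq.2) hp

theorem smooth_massLabel (h : FilmProfile L U U' U'') : SmoothUpTo 0 1 (massLabel L U) := by
  intro p hp
  by_cases hp1 : p.2 < 1
  · exact h.contDiffWithinAt_massLabel_left hp hp1
  · have := ((h.reflect.contDiffWithinAt_massLabel_left (p := (p.1, 1 - p.2))
      (mapsTo_reflect _ hp) (reflect_lt_one hp1)).comp p (contDiffOn_strip_reflect p hp)
      (mapsTo_reflect _)).neg
    exact this.congr_of_mem (fun q hq => h.massLabel_eq_reflect (le_of_lt hq.1) hq.2) hp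

theorem continuousOn_reflect (I : Set ℝ) :
    ContinuousOn (fun q : ℝ × ℝ => (q.1, 1 - q.2)) (I ×ˢ Icc 0 1) := by fun_prop

theorem continuousOn_massLabel (h : FilmProfile L U U' U'') :
    ContinuousOn (fun q : ℝ × ℝ => massLabel L U q.1 q.2) (Ici 0 ×ˢ Icc 0 1) := by
  intro p hp
  by_cases hp1 : p.2 < 1
  · exact h.continuousWithinAt_massLabel_left hp hp1
  · have := (ContinuousWithinAt.comp (f := fun q : ℝ × ℝ => (q.1, 1 - q.2))
      (h.reflect.continuousWithinAt_massLabel_left (p := (p.1, 1 - p.2))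
      (mapsTo_reflect _ hp) (reflect_lt_one hp1)) (continuousOn_reflect _ p hp)
      (mapsTo_reflect _)).neg
    exact this.congr_of_mem (fun q hq => h.massLabel_eq_reflect hq.1 hq.2) hp

/-- The height ratio is continuously differentiable in space, up to time `0`. -/
theorem C1_heightRatio (h : FilmProfile L U U' U'') :
    C1UpTo (heightRatio L U) (fun t x => derivWithin (heightRatio L U t) (Icc 0 1) x) := by
  obtain ⟨v', hv'⟩ := h.exists_deriv_heightRatio_left
  obtain ⟨w', hw'⟩ := h.reflect.exists_deriv_heightRatio_left
  have hu : ∀ x ∈ Icc (0 : ℝ) 1, UniqueDiffWithinAt ℝ (Icc (0 : ℝ) 1) x :=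
    uniqueDiffOn_Icc zero_lt_one
  have right : ∀ p ∈ Ici (0 : ℝ) ×ˢ Icc (0 : ℝ) 1, 0 < p.2 →
      HasDerivWithinAt (heightRatio L U p.1) (-w' p.1 (1 - p.2)) (Icc 0 1) p.2 := by
    intro p hp hp0
    have h1 := (hw' (p.1, 1 - p.2) (mapsTo_reflect _ hp) (by simpa using hp0)).2
    have h2 : HasDerivWithinAt (fun z : ℝ => 1 - z) (-1) (Icc 0 1) p.2 :=
      ((hasDerivAt_id p.2).const_sub 1).hasDerivWithinAt
    refine ((HasDerivWithinAt.comp (s' := Icc 0 1) p.2 h1 h2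
      fun z hz => reflect_mem hz).congr_of_mem
      (fun z hz => h.heightRatio_eq_reflect hp.1 hz) hp.2).congr_deriv (by ring)
  have hd : ∀ t, 0 ≤ t → ∀ x ∈ Icc (0 : ℝ) 1,
      DifferentiableWithinAt ℝ (heightRatio L U t) (Icc 0 1) x := by
    intro t ht x hx
    by_cases hx1 : x < 1
    · exact (hv' (t, x) ⟨ht, hx⟩ hx1).2.differentiableWithinAt
    · exact (right (t, x) ⟨ht, hx⟩ (by simp at hx1; simp; linarith)).differentiableWithinAt
  have hd' : ∀ t, 0 ≤ t → ∀ x ∈ Icc (0 : ℝ) 1, HasDerivWithinAt (heightRatio L U t)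
      (derivWithin (heightRatio L U t) (Icc 0 1) x) (Icc 0 1) x :=
    fun t ht x hx => (hd t ht x hx).hasDerivWithinAt
  refine ⟨fun p hp => ?_, fun p hp => ?_, hd'⟩
  · by_cases hp1 : p.2 < 1
    · obtain ⟨q, hq, e⟩ := h.exists_sqrtProfile_eq hp.1 hp.2 hp1
      have hs := (contDiffAt_ratioFactor hq).continuousAt
      rw [← e] at hs
      refine (((h.slope.average (w := fun _ => 1) continuous_const).cont p hp |>.div
        (h.C1_massRoot.cont p hp)
        (Real.sqrt_pos.2 (h.rayAverage_weight_pos hp.1 hp.2)).ne').mul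
        (hs.comp_continuousWithinAt (f := fun q : ℝ × ℝ =>
          q.2 * √(L q.1 * rayAverage (fun r => 1 - r) U' q.1 q.2))
          (h.continuousWithinAt_root_arg hp))).congr_of_eventuallyEq_of_mem
        (g := fun q : ℝ × ℝ => heightRatio L U q.1 q.2) ?_ hp
      filter_upwards [eventually_lt_one hp1] with r hr
      exact h.heightRatio_eq hr.1.1 ⟨hr.1.2.1, hr.2⟩
    · have hp' := mapsTo_reflect _ hp
      have hr := h.reflect
      obtain ⟨q, hq, e⟩ := hr.exists_sqrtProfile_eq hp'.1 hp'.2 (reflect_lt_one hp1)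
      have hs := (contDiffAt_ratioFactor hq).continuousAt
      rw [← e] at hs
      have key := (((hr.slope.average (w := fun _ => 1) continuous_const).cont _ hp' |>.div
        (hr.C1_massRoot.cont _ hp')
        (Real.sqrt_pos.2 (hr.rayAverage_weight_pos hp'.1 hp'.2)).ne').mul
        (hs.comp_continuousWithinAt (f := fun q : ℝ × ℝ =>
          q.2 * √(L q.1 * rayAverage (fun r => 1 - r) (fun t x => -U' t (1 - x)) q.1 q.2))
          (hr.continuousWithinAt_root_arg hp'))).congr_of_eventuallyEq_of_mem
        (g := fun q : ℝ × ℝ => heightRatio L (fun t x => U t (1 - x)) q.1 q.2)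
        (by
          filter_upwards [eventually_lt_one (p := (p.1, 1 - p.2)) (reflect_lt_one hp1)] with r hr'
          exact hr.heightRatio_eq hr'.1.1 ⟨hr'.1.2.1, hr'.2⟩) hp'
      exact (ContinuousWithinAt.comp (f := fun q : ℝ × ℝ => (q.1, 1 - q.2)) key
        (continuousOn_reflect _ p hp) (mapsTo_reflect _)).congr_of_mem
        (fun q hq => h.heightRatio_eq_reflect hq.1 hq.2) hp
  · by_cases hp1 : p.2 < 1
    · refine (hv' p hp hp1).1.congr_of_eventuallyEq_of_mem ?_ hp
      filter_upwards [eventually_lt_one hp1] with r hr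
      exact (hv' r hr.1 hr.2).2.derivWithin (hu _ hr.1.2)
    · have key := (ContinuousWithinAt.comp (f := fun q : ℝ × ℝ => (q.1, 1 - q.2))
        (hw' (p.1, 1 - p.2) (mapsTo_reflect _ hp) (reflect_lt_one hp1)).1
        (continuousOn_reflect _ p hp) (mapsTo_reflect _)).neg
      refine key.congr_of_eventuallyEq_of_mem ?_ hp
      have hp0 : 0 < p.2 := by linarith
      have ev : ∀ᶠ q in 𝓝[Ici (0 : ℝ) ×ˢ Icc (0 : ℝ) 1] p, 0 < q.2 :=
        nhdsWithin_le_nhds (continuous_snd.continuousAt.eventually (lt_mem_nhds hp0))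
      filter_upwards [self_mem_nhdsWithin, ev] with r hr hr0
      exact (right r hr hr0).derivWithin (hu _ hr.2)

theorem heightRatio_zero (t : ℝ) : heightRatio L U t 0 = 1 := by simp [heightRatio]

theorem heightRatio_one (t : ℝ) : heightRatio L U t 1 = 1 := by simp [heightRatio]

theorem massLabel_mem_Icc (h : FilmProfile L U U' U'') {t : ℝ} (ht : 0 ≤ t) {x : ℝ}
    (hx : x ∈ Icc (0 : ℝ) 1) : massLabel L U t x ∈ Icc (-1 : ℝ) 1 := by
  have := h.massLabel_mem ht hx
  exact ⟨by linarith [this.1], by linarith [this.2]⟩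

theorem massLabel_mem_Ioo (h : FilmProfile L U U' U'') {t : ℝ} (ht : 0 ≤ t) {x : ℝ}
    (hx : x ∈ Ioo (0 : ℝ) 1) : massLabel L U t x ∈ Ioo (-1 : ℝ) 1 := by
  have hx' := Ioo_subset_Icc_self hx
  have h0 := h.strictMonoOn_massLabel ht (by simp) hx' hx.1
  have h1 := h.strictMonoOn_massLabel ht hx' (by simp) hx.2
  rw [massLabel_zero] at h0
  rw [h.massLabel_one ht] at h1
  exact ⟨h0, h1⟩

theorem heightRatio_mul (h : FilmProfile L U U' U'') {t : ℝ} (ht : 0 ≤ t) {x : ℝ}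
    (hx : x ∈ Icc (0 : ℝ) 1) :
    (1 - massLabel L U t x ^ 2) / 2 * heightRatio L U t x = U t x := by
  by_cases hx' : x ∈ Ioo (0 : ℝ) 1
  · have hm := h.massLabel_mem_Ioo ht hx'
    have : (1 - massLabel L U t x ^ 2) / 2 ≠ 0 := by
      have : 0 < (1 - massLabel L U t x) * (1 + massLabel L U t x) :=
        mul_pos (by linarith [hm.2]) (by linarith [hm.1])
      nlinarith
    rw [heightRatio, if_pos hx', mul_div_cancel₀ _ this]
  · rcases hx.1.eq_or_lt with rfl | h0
    · rw [massLabel_zero, h.left_zero t ht]; norm_num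
    · have h1 : x = 1 := le_antisymm hx.2 (not_lt.1 fun h1 => hx' ⟨h0, h1⟩)
      rw [h1, h.massLabel_one ht, h.right_zero t ht]; norm_num

theorem heightRatio_pos (h : FilmProfile L U U' U'') {t : ℝ} (ht : 0 ≤ t) (x : ℝ) :
    0 < heightRatio L U t x := by
  by_cases hx' : x ∈ Ioo (0 : ℝ) 1
  · have hm := h.massLabel_mem_Ioo ht hx'
    rw [heightRatio, if_pos hx']
    refine div_pos (h.pos t ht x hx') ?_
    nlinarith [hm.1, hm.2]
  · rw [heightRatio, if_neg hx']; exact one_pos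

theorem hasDerivAt_partialMass (h : FilmProfile L U U' U'') {t : ℝ} (ht : 0 ≤ t) {x : ℝ}
    (hx : x ∈ Ioo (0 : ℝ) 1) : HasDerivAt (partialMass L U t) (L t * U t x) x := by
  have hc := continuousOn_slice h.height.cont (x := t) ht
  refine (intervalIntegral.integral_hasDerivAt_right
    (h.intervalIntegrable ht (by simp) (Ioo_subset_Icc_self hx)) ?_
    (hc.continuousAt (Icc_mem_nhds hx.1 hx.2))).const_mul (L t)
  exact (hc.stronglyMeasurableAtFilter_nhdsWithin measurableSet_Icc x).filter_mono
    (by rw [nhdsWithin_eq_nhds.2 (Icc_mem_nhds hx.1 hx.2)])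

/-- Differentiating `massProfile (1 + Y) = partialMass` gives `φ(Y) Y_x = L U = L φ(Y) v`, and `φ(Y)
> 0` cancels in the interior. -/
theorem hasDerivAt_massLabel (h : FilmProfile L U U' U'') {t : ℝ} (ht : 0 ≤ t) {x : ℝ}
    (hx : x ∈ Ioo (0 : ℝ) 1) : HasDerivAt (massLabel L U t) (L t * heightRatio L U t x) x := by
  have hx' := Ioo_subset_Icc_self hx
  have hd := ((h.differentiableWithinAt_massLabel ht hx' hx.2).differentiableAt
    (Icc_mem_nhds hx.1 hx.2)).hasDerivAt
  have h1 := (hasDerivAt_massProfile (1 + massLabel L U t x)).comp x (hd.const_add 1)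
  have h2 := (h.hasDerivAt_partialMass ht hx).congr_of_eventuallyEq (f₁ := fun z =>
    massProfile (1 + massLabel L U t z)) (by
      filter_upwards [Icc_mem_nhds hx.1 hx.2] with z hz
      exact h.massProfile_massLabel ht hz)
  have e := h1.unique h2
  have hm := h.massLabel_mem_Ioo ht hx
  have hne : (1 - massLabel L U t x ^ 2) / 2 ≠ 0 := by nlinarith [hm.1, hm.2]
  refine hd.congr_deriv (mul_left_cancel₀ hne ?_)
  linear_combination e - L t * h.heightRatio_mul ht hx'

/-! ### The inverse mass label and the ratio as a function of the label. -/

/-- The inverse of the mass label. -/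
noncomputable def massPoint (L : ℝ → ℝ) (U : ℝ → ℝ → ℝ) (t y : ℝ) : ℝ :=
  Function.invFunOn (massLabel L U t) (Icc 0 1) y

theorem exists_massLabel_eq (h : FilmProfile L U U' U'') {t : ℝ} (ht : 0 ≤ t) {y : ℝ}
    (hy : y ∈ Icc (-1 : ℝ) 1) : ∃ x ∈ Icc (0 : ℝ) 1, massLabel L U t x = y := by
  have := intermediate_value_Icc zero_le_one
    (continuousOn_slice h.continuousOn_massLabel (x := t) ht)
  rw [massLabel_zero, h.massLabel_one ht] at this
  exact this hy

theorem massPoint_mem (h : FilmProfile L U U' U'') {t : ℝ} (ht : 0 ≤ t) {y : ℝ}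
    (hy : y ∈ Icc (-1 : ℝ) 1) : massPoint L U t y ∈ Icc (0 : ℝ) 1 :=
  Function.invFunOn_mem (h.exists_massLabel_eq ht hy)

theorem massLabel_massPoint (h : FilmProfile L U U' U'') {t : ℝ} (ht : 0 ≤ t) {y : ℝ}
    (hy : y ∈ Icc (-1 : ℝ) 1) : massLabel L U t (massPoint L U t y) = y :=
  Function.invFunOn_eq (h.exists_massLabel_eq ht hy)

theorem massPoint_eq (h : FilmProfile L U U' U'') {t : ℝ} (ht : 0 ≤ t) {x y : ℝ}
    (hx : x ∈ Icc (0 : ℝ) 1) (e : massLabel L U t x = y) : massPoint L U t y = x := by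
  have hy : y ∈ Icc (-1 : ℝ) 1 := e ▸ h.massLabel_mem_Icc ht hx
  exact (h.strictMonoOn_massLabel ht).injOn (h.massPoint_mem ht hy) hx
    ((h.massLabel_massPoint ht hy).trans e.symm)

theorem massPoint_mem_Ioo (h : FilmProfile L U U' U'') {t : ℝ} (ht : 0 ≤ t) {y : ℝ}
    (hy : y ∈ Ioo (-1 : ℝ) 1) : massPoint L U t y ∈ Ioo (0 : ℝ) 1 := by
  have hy' := Ioo_subset_Icc_self hy
  have hm := h.massPoint_mem ht hy'
  have hl := h.massLabel_massPoint ht hy'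
  refine ⟨lt_of_le_of_ne hm.1 fun e => ?_, lt_of_le_of_ne hm.2 fun e => ?_⟩
  · rw [← e, massLabel_zero] at hl; exact hy.1.ne hl
  · rw [e, h.massLabel_one ht] at hl; exact hy.2.ne hl.symm

/-- By monotonicity, `x < massPoint t y` is equivalent to `massLabel t x < y`, a condition stable
under small changes of `(t, y)`; likewise for the opposite inequality. -/
theorem continuousOn_massPoint (h : FilmProfile L U U' U'') :
    ContinuousOn (fun q : ℝ × ℝ => massPoint L U q.1 q.2) (Ici 0 ×ˢ Icc (-1) 1) := by
  rintro ⟨t, y⟩ ⟨ht, hy⟩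
  have hc := h.continuousOn_massLabel
  have ev : ∀ x ∈ Icc (0 : ℝ) 1, Tendsto (fun q : ℝ × ℝ => massLabel L U q.1 x - q.2)
      (𝓝[Ici 0 ×ˢ Icc (-1) 1] (t, y)) (𝓝 (massLabel L U t x - y)) := fun x hx => by
    have h1 : ContinuousWithinAt (fun s => massLabel L U s x) (Ici 0) t :=
      continuousOn_slice_left hc hx t ht
    exact (ContinuousWithinAt.comp (f := Prod.fst) (x := (t, y)) (s := Ici (0 : ℝ) ×ˢ Icc (-1) 1)
      h1 continuousWithinAt_fst fun q hq => hq.1).sub continuousWithinAt_snd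
  have hmono := fun s (hs : (0 : ℝ) ≤ s) => h.strictMonoOn_massLabel hs
  refine tendsto_order.2 ⟨fun x hx => ?_, fun x hx => ?_⟩
  · by_cases hx0 : x < 0
    · filter_upwards [self_mem_nhdsWithin] with q hq
      exact hx0.trans_le (h.massPoint_mem hq.1 hq.2).1
    · have hxI : x ∈ Icc (0 : ℝ) 1 :=
        ⟨not_lt.1 hx0, (hx.le.trans (h.massPoint_mem ht hy).2)⟩
      have hlt := hmono t ht hxI (h.massPoint_mem ht hy) hx
      simp only at hlt
      rw [h.massLabel_massPoint ht hy, ← sub_neg] at hlt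
      filter_upwards [(ev x hxI).eventually (gt_mem_nhds hlt), self_mem_nhdsWithin] with q hq hqm
      rw [sub_neg, ← h.massLabel_massPoint hqm.1 hqm.2] at hq
      exact ((hmono q.1 hqm.1).lt_iff_lt hxI (h.massPoint_mem hqm.1 hqm.2)).1 hq
  · by_cases hx1 : 1 < x
    · filter_upwards [self_mem_nhdsWithin] with q hq
      exact (h.massPoint_mem hq.1 hq.2).2.trans_lt hx1
    · have hxI : x ∈ Icc (0 : ℝ) 1 :=
        ⟨((h.massPoint_mem ht hy).1.trans hx.le), not_lt.1 hx1⟩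
      have hlt := hmono t ht (h.massPoint_mem ht hy) hxI hx
      simp only at hlt
      rw [h.massLabel_massPoint ht hy, ← sub_pos] at hlt
      filter_upwards [(ev x hxI).eventually (lt_mem_nhds hlt), self_mem_nhdsWithin] with q hq hqm
      rw [sub_pos, ← h.massLabel_massPoint hqm.1 hqm.2] at hq
      exact ((hmono q.1 hqm.1).lt_iff_lt (h.massPoint_mem hqm.1 hqm.2) hxI).1 hq

/-- The interior formula extends by continuity. The label is thus a nondegenerate change of variable
at the contact points too, as its smooth inversion requires. -/
theorem dX_massLabel (h : FilmProfile L U U' U'') {t : ℝ} (ht : 0 < t) {x : ℝ}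
    (hx : x ∈ Icc (0 : ℝ) 1) : dX 0 1 (massLabel L U) t x = L t * heightRatio L U t x := by
  have e : EqOn (dX 0 1 (massLabel L U) t) (fun x => L t * heightRatio L U t x) (Ioo 0 1) :=
    fun z hz => (h.smooth_massLabel.hasDerivAt_space ht hz).unique (h.hasDerivAt_massLabel ht.le hz)
  refine e.of_subset_closure ((h.smooth_massLabel.smooth_dX zero_lt_one).continuousOn_slice ht)
    (continuousOn_const.mul (h.smooth_heightRatio.continuousOn_slice ht)) Ioo_subset_Icc_self ?_ hx
  rw [closure_Ioo zero_ne_one]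

theorem smooth_massPoint (h : FilmProfile L U U' U'') : SmoothUpTo (-1) 1 (massPoint L U) := by
  refine h.smooth_massLabel.inverse zero_lt_one (by norm_num) (fun t ht x hx => ?_)
    (h.continuousOn_massPoint.mono (prod_mono_left Ioi_subset_Ici_self))
    (fun t ht y hy => h.massPoint_mem (le_of_lt ht) hy)
    (fun t ht y hy => h.massLabel_massPoint (le_of_lt ht) hy)
  rw [h.dX_massLabel ht hx]
  exact (mul_pos (h.length_pos t (le_of_lt ht)) (h.heightRatio_pos (le_of_lt ht) x)).ne'

theorem hasDerivAt_massPoint (h : FilmProfile L U U' U'') {t : ℝ} (ht : 0 ≤ t) {y : ℝ}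
    (hy : y ∈ Ioo (-1 : ℝ) 1) :
    HasDerivAt (massPoint L U t) (L t * heightRatio L U t (massPoint L U t y))⁻¹ y := by
  have hc := (continuousOn_slice h.continuousOn_massPoint (x := t) ht).continuousAt
    (Icc_mem_nhds hy.1 hy.2)
  refine HasDerivAt.of_local_left_inverse hc
    (h.hasDerivAt_massLabel ht (h.massPoint_mem_Ioo ht hy))
    (mul_pos (h.length_pos t ht) (h.heightRatio_pos ht _)).ne' ?_
  filter_upwards [Icc_mem_nhds hy.1 hy.2] with z hz
  exact h.massLabel_massPoint ht hz

/-- The height ratio as a function of the mass label. -/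
noncomputable def labelRatio (L : ℝ → ℝ) (U : ℝ → ℝ → ℝ) (t y : ℝ) : ℝ :=
  heightRatio L U t (massPoint L U t y)

/-- The derivative of the height ratio with respect to the mass label. -/
noncomputable def labelRatioDeriv (L : ℝ → ℝ) (U : ℝ → ℝ → ℝ) (t y : ℝ) : ℝ :=
  derivWithin (heightRatio L U t) (Icc 0 1) (massPoint L U t y) / (L t * labelRatio L U t y)

theorem labelRatio_pos (h : FilmProfile L U U' U'') {t : ℝ} (ht : 0 ≤ t) (y : ℝ) :
    0 < labelRatio L U t y := h.heightRatio_pos ht _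

theorem smooth_labelRatio (h : FilmProfile L U U' U'') : SmoothUpTo (-1) 1 (labelRatio L U) :=
  h.smooth_heightRatio.comp (f := fun q : ℝ × ℝ => (q.1, massPoint L U q.1 q.2))
    (contDiffOn_fst.prodMk h.smooth_massPoint)
    fun _ hq => ⟨hq.1, h.massPoint_mem (le_of_lt hq.1) hq.2⟩

theorem mapsTo_massPoint (h : FilmProfile L U U' U'') :
    MapsTo (fun q : ℝ × ℝ => (q.1, massPoint L U q.1 q.2)) (Ici 0 ×ˢ Icc (-1) 1)
      (Ici 0 ×ˢ Icc 0 1) := fun _ hq => ⟨hq.1, h.massPoint_mem hq.1 hq.2⟩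

theorem continuousOn_labelRatio (h : FilmProfile L U U' U'') :
    ContinuousOn (fun q : ℝ × ℝ => labelRatio L U q.1 q.2) (Ici 0 ×ˢ Icc (-1) 1) :=
  h.C1_heightRatio.cont.comp (f := fun q : ℝ × ℝ => (q.1, massPoint L U q.1 q.2))
    (continuousOn_fst.prodMk h.continuousOn_massPoint) h.mapsTo_massPoint

theorem continuousOn_labelRatioDeriv (h : FilmProfile L U U' U'') :
    ContinuousOn (fun q : ℝ × ℝ => labelRatioDeriv L U q.1 q.2) (Ici 0 ×ˢ Icc (-1) 1) := by
  refine (h.C1_heightRatio.cont'.comp (f := fun q : ℝ × ℝ => (q.1, massPoint L U q.1 q.2))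
    (continuousOn_fst.prodMk h.continuousOn_massPoint) h.mapsTo_massPoint).div
    ((h.length_cont.comp continuousOn_fst fun q hq => hq.1).mul h.continuousOn_labelRatio)
    fun q hq => (mul_pos (h.length_pos _ hq.1) (h.labelRatio_pos hq.1 _)).ne'

theorem hasDerivAt_labelRatio (h : FilmProfile L U U' U'') {t : ℝ} (ht : 0 ≤ t) {y : ℝ}
    (hy : y ∈ Ioo (-1 : ℝ) 1) :
    HasDerivAt (labelRatio L U t) (labelRatioDeriv L U t y) y := by
  have hm := h.massPoint_mem_Ioo ht hy
  have h1 := (h.C1_heightRatio.hasDeriv t ht _ (Ioo_subset_Icc_self hm)).hasDerivAt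
    (Icc_mem_nhds hm.1 hm.2)
  exact (h1.comp y (h.hasDerivAt_massPoint ht hy)).congr_deriv (div_eq_mul_inv _ _).symm

theorem labelRatio_left (h : FilmProfile L U U' U'') {t : ℝ} (ht : 0 ≤ t) :
    labelRatio L U t (-1) = 1 := by
  rw [labelRatio, h.massPoint_eq ht (by simp) (massLabel_zero t), heightRatio_zero]

theorem labelRatio_right (h : FilmProfile L U U' U'') {t : ℝ} (ht : 0 ≤ t) :
    labelRatio L U t 1 = 1 := by
  rw [labelRatio, h.massPoint_eq ht (by simp) (h.massLabel_one ht), heightRatio_one]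

theorem labelRatio_mul (h : FilmProfile L U U' U'') {t : ℝ} (ht : 0 ≤ t) {y : ℝ}
    (hy : y ∈ Icc (-1 : ℝ) 1) :
    (1 - y ^ 2) / 2 * labelRatio L U t y = U t (massPoint L U t y) := by
  have := h.heightRatio_mul ht (h.massPoint_mem ht hy)
  rwa [h.massLabel_massPoint ht hy] at this

end FilmProfile

/-! ### From the moving film to the reference interval; conservation of mass. -/

/-- The film height in the reference domain `[0, 1]`. -/
def refHeight (u : ℝ → ℝ → ℝ) (lL lR : ℝ → ℝ) (t x : ℝ) : ℝ :=
  u t (lL t + (lR t - lL t) * x)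

/-- The space derivatives of the film height, rescaled to the reference domain `[0, 1]`. -/
noncomputable def refDeriv (k : ℕ) (u : ℝ → ℝ → ℝ) (lL lR : ℝ → ℝ) (t x : ℝ) : ℝ :=
  (lR t - lL t) ^ k *
    iteratedDerivWithin k (u t) (Icc (lL t) (lR t)) (lL t + (lR t - lL t) * x)

theorem affine_mem_Icc {l r x : ℝ} (h : l < r) (hx : x ∈ Icc (0 : ℝ) 1) :
    l + (r - l) * x ∈ Icc l r :=
  ⟨by nlinarith [hx.1], by nlinarith [hx.2]⟩

theorem affine_mem_Ioo {l r x : ℝ} (h : l < r) (hx : x ∈ Ioo (0 : ℝ) 1) :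
    l + (r - l) * x ∈ Ioo l r :=
  ⟨by nlinarith [hx.1], by nlinarith [hx.2]⟩

theorem hasDerivAt_affine (l c x : ℝ) : HasDerivAt (fun z => l + c * z) c x := by
  simpa using ((hasDerivAt_id x).const_mul c).const_add l

/-- Chain rule for the inverse of an affine change of variable. -/
theorem hasDerivAt_of_affine {l r : ℝ} (h : l < r) {f F F' : ℝ → ℝ}
    (hfF : ∀ z ∈ Ioo (0 : ℝ) 1, f (l + (r - l) * z) = F z)
    (hd : ∀ z ∈ Ioo (0 : ℝ) 1, HasDerivAt F (F' z) z) {z : ℝ} (hz : z ∈ Ioo (0 : ℝ) 1) :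
    HasDerivAt f (F' z / (r - l)) (l + (r - l) * z) := by
  have hne : r - l ≠ 0 := (sub_pos.2 h).ne'
  have h1 : HasDerivAt (fun x => (x - l) / (r - l)) (1 / (r - l)) (l + (r - l) * z) :=
    ((hasDerivAt_id _).sub_const l).div_const _
  have e : (l + (r - l) * z - l) / (r - l) = z := by field_simp; ring
  have h2 : HasDerivAt (fun x => F ((x - l) / (r - l))) (F' z * (1 / (r - l)))
      (l + (r - l) * z) :=
    HasDerivAt.comp (h₂ := F) (l + (r - l) * z) (by rw [e]; exact hd z hz) h1
  refine (h2.congr_of_eventuallyEq ?_).congr_deriv (by ring)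
  filter_upwards [Ioo_mem_nhds (affine_mem_Ioo h hz).1 (affine_mem_Ioo h hz).2] with x hx
  have hp : 0 < r - l := sub_pos.2 h
  rw [← hfF _ ⟨div_pos (by linarith [hx.1]) hp, (div_lt_one hp).2 (by linarith [hx.2])⟩]
  congr 1
  field_simp
  ring

namespace IsGlobalSmoothSolution

variable {u : ℝ → ℝ → ℝ} {lL lR : ℝ → ℝ}

theorem length_pos (h : IsGlobalSmoothSolution u lL lR) {t : ℝ} (ht : 0 ≤ t) :
    0 < lR t - lL t := sub_pos.2 (h.lt t ht)

theorem contDiffOn_slice (h : IsGlobalSmoothSolution u lL lR) {t : ℝ} (ht : 0 ≤ t) :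
    ContDiffOn ℝ 2 (u t) (Icc (lL t) (lR t)) := by
  rcases ht.eq_or_lt with rfl | ht
  · exact h.initial_smooth
  · refine ContDiffOn.of_le (n := ∞) ?_ (WithTop.coe_le_coe.2 le_top)
    exact h.smooth.comp (f := fun x => (t, x)) (by fun_prop) fun x hx => ⟨ht, hx⟩

theorem hasDerivWithinAt_iterated (h : IsGlobalSmoothSolution u lL lR) {t : ℝ} (ht : 0 ≤ t) {k : ℕ}
    (hk : k < 2) {x : ℝ} (hx : x ∈ Icc (lL t) (lR t)) :
    HasDerivWithinAt (iteratedDerivWithin k (u t) (Icc (lL t) (lR t)))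
      (iteratedDerivWithin (k + 1) (u t) (Icc (lL t) (lR t)) x) (Icc (lL t) (lR t)) x := by
  have hd := (h.contDiffOn_slice ht).differentiableOn_iteratedDerivWithin (m := k)
    (by exact_mod_cast hk) (uniqueDiffOn_Icc (h.lt t ht)) x hx
  rw [iteratedDerivWithin_succ]
  exact hd.hasDerivWithinAt

theorem refDeriv_zero : refDeriv 0 u lL lR = refHeight u lL lR := by
  funext t x; simp [refDeriv, refHeight]

theorem C1_refDeriv (h : IsGlobalSmoothSolution u lL lR) {k : ℕ} (hk : k < 2) :
    C1UpTo (refDeriv k u lL lR) (refDeriv (k + 1) u lL lR) := by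
  have hL : ContinuousOn (fun q : ℝ × ℝ => lL q.1) (Ici 0 ×ˢ Icc 0 1) :=
    h.left_continuous.comp continuousOn_fst fun q hq => hq.1
  have hR : ContinuousOn (fun q : ℝ × ℝ => lR q.1) (Ici 0 ×ˢ Icc 0 1) :=
    h.right_continuous.comp continuousOn_fst fun q hq => hq.1
  have hc : ∀ k ≤ 2, ContinuousOn (fun q : ℝ × ℝ => refDeriv k u lL lR q.1 q.2)
      (Ici 0 ×ˢ Icc 0 1) := fun k hk => by
    refine ((hR.sub hL).pow k).mul ?_
    exact (h.initial_attained k hk).comp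
      (f := fun q : ℝ × ℝ => (q.1, lL q.1 + (lR q.1 - lL q.1) * q.2))
      (continuousOn_fst.prodMk (hL.add ((hR.sub hL).mul continuousOn_snd)))
      fun q hq => ⟨hq.1, affine_mem_Icc (h.lt _ hq.1) hq.2⟩
  refine ⟨hc k hk.le, hc (k + 1) hk, fun t ht x hx => ?_⟩
  have h1 := h.hasDerivWithinAt_iterated ht hk (affine_mem_Icc (h.lt t ht) hx)
  have h2 := (hasDerivAt_affine (lL t) (lR t - lL t) x).hasDerivWithinAt (s := Icc 0 1)
  exact ((HasDerivWithinAt.comp x h1 h2 fun z hz => affine_mem_Icc (h.lt t ht) hz).const_mul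
    ((lR t - lL t) ^ k)).congr_deriv (by rw [refDeriv, pow_succ]; ring)

theorem C1_refHeight (h : IsGlobalSmoothSolution u lL lR) :
    C1UpTo (refHeight u lL lR) (refDeriv 1 u lL lR) := by
  have := h.C1_refDeriv (k := 0) (by norm_num)
  rwa [refDeriv_zero] at this

theorem smooth_refHeight (h : IsGlobalSmoothSolution u lL lR) :
    SmoothUpTo 0 1 (refHeight u lL lR) := by
  have hL : ContDiffOn ℝ ∞ (fun q : ℝ × ℝ => lL q.1) (Ioi 0 ×ˢ Icc 0 1) :=
    h.left_smooth.comp contDiffOn_fst fun q hq => hq.1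
  have hR : ContDiffOn ℝ ∞ (fun q : ℝ × ℝ => lR q.1) (Ioi 0 ×ˢ Icc 0 1) :=
    h.right_smooth.comp contDiffOn_fst fun q hq => hq.1
  exact h.smooth.comp (f := fun q : ℝ × ℝ => (q.1, lL q.1 + (lR q.1 - lL q.1) * q.2))
    (contDiffOn_fst.prodMk (hL.add ((hR.sub hL).mul contDiffOn_snd)))
    fun q hq => ⟨hq.1, affine_mem_Icc (h.lt _ (le_of_lt hq.1)) hq.2⟩

theorem refHeight_pos (h : IsGlobalSmoothSolution u lL lR) {t : ℝ} (ht : 0 ≤ t) {x : ℝ}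
    (hx : x ∈ Ioo (0 : ℝ) 1) : 0 < refHeight u lL lR t x :=
  h.pos t ht _ (affine_mem_Ioo (h.lt t ht) hx)

/-- An equality of continuous functions of time extends to the initial time. -/
theorem eq_of_eq_pos {f g : ℝ → ℝ} (hf : ContinuousOn f (Ici 0)) (hg : ContinuousOn g (Ici 0))
    (he : ∀ t, 0 < t → f t = g t) {t : ℝ} (ht : 0 ≤ t) : f t = g t :=
  EqOn.of_subset_closure (s := Ioi 0) (t := Ici 0) he hf hg Ioi_subset_Ici_self
    (by rw [closure_Ioi]) ht

theorem refHeight_left (h : IsGlobalSmoothSolution u lL lR) {t : ℝ} (ht : 0 ≤ t) :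
    refHeight u lL lR t 0 = 0 :=
  eq_of_eq_pos (continuousOn_slice_left h.C1_refHeight.cont (by simp)) continuousOn_const
    (fun t ht => by simpa [refHeight] using h.left_zero t ht) ht

theorem refHeight_right (h : IsGlobalSmoothSolution u lL lR) {t : ℝ} (ht : 0 ≤ t) :
    refHeight u lL lR t 1 = 0 :=
  eq_of_eq_pos (continuousOn_slice_left h.C1_refHeight.cont (by simp)) continuousOn_const
    (fun t ht => by simpa [refHeight] using h.right_zero t ht) ht

theorem refHeight_nonneg (h : IsGlobalSmoothSolution u lL lR) {t : ℝ} (ht : 0 ≤ t) {x : ℝ}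
    (hx : x ∈ Icc (0 : ℝ) 1) : 0 ≤ refHeight u lL lR t x := by
  rcases hx.1.eq_or_lt with rfl | h0
  · exact (h.refHeight_left ht).ge
  · rcases hx.2.eq_or_lt with rfl | h1
    · exact (h.refHeight_right ht).ge
    · exact (h.refHeight_pos ht ⟨h0, h1⟩).le

theorem refSlope_left (h : IsGlobalSmoothSolution u lL lR) {t : ℝ} (ht : 0 ≤ t) :
    refDeriv 1 u lL lR t 0 = lR t - lL t := by
  refine eq_of_eq_pos (continuousOn_slice_left h.C1_refHeight.cont' (by simp))
    (h.right_continuous.sub h.left_continuous) (fun t ht => ?_) ht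
  -- The boundary condition fixes only the modulus of the slope; positivity of the film fixes its
  -- sign.
  have h0 : 0 ≤ refDeriv 1 u lL lR t 0 := by
    have hd := h.C1_refHeight.hasDeriv t ht.le 0 (by simp)
    rw [hasDerivWithinAt_iff_tendsto_slope, Icc_sdiff_left] at hd
    have : (𝓝[Ioc (0 : ℝ) 1] 0).NeBot := by
      rw [← mem_closure_iff_nhdsWithin_neBot, closure_Ioc zero_ne_one]; simp
    refine ge_of_tendsto hd ?_
    filter_upwards [self_mem_nhdsWithin] with x hx
    rw [slope_def_field, h.refHeight_left ht.le, sub_zero, sub_zero]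
    exact div_nonneg (h.refHeight_nonneg ht.le ⟨hx.1.le, hx.2⟩) hx.1.le
  have hs := h.left_slope t ht
  have hL := h.length_pos ht.le
  simp only [refDeriv, mul_zero, add_zero, pow_one, iteratedDerivWithin_one] at h0 ⊢
  rw [abs_of_nonneg (nonneg_of_mul_nonneg_right h0 hL)] at hs
  rw [hs, mul_one]; rfl

theorem refSlope_right (h : IsGlobalSmoothSolution u lL lR) {t : ℝ} (ht : 0 ≤ t) :
    refDeriv 1 u lL lR t 1 = -(lR t - lL t) := by
  refine eq_of_eq_pos (continuousOn_slice_left h.C1_refHeight.cont' (by simp))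
    (h.right_continuous.sub h.left_continuous).neg (fun t ht => ?_) ht
  have h0 : refDeriv 1 u lL lR t 1 ≤ 0 := by
    have hd := h.C1_refHeight.hasDeriv t ht.le 1 (by simp)
    rw [hasDerivWithinAt_iff_tendsto_slope, Icc_sdiff_right] at hd
    have : (𝓝[Ico (0 : ℝ) 1] 1).NeBot := by
      rw [← mem_closure_iff_nhdsWithin_neBot, closure_Ico zero_ne_one]; simp
    refine le_of_tendsto hd ?_
    filter_upwards [self_mem_nhdsWithin] with x hx
    rw [slope_def_field, h.refHeight_right ht.le, sub_zero]
    exact div_nonpos_of_nonneg_of_nonpos (h.refHeight_nonneg ht.le ⟨hx.1, hx.2.le⟩)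
      (by linarith [hx.2])
  have hs := h.right_slope t ht
  have hL := h.length_pos ht.le
  simp only [refDeriv, mul_one, add_sub_cancel, pow_one, iteratedDerivWithin_one] at h0 ⊢
  rw [abs_of_nonpos (nonpos_of_mul_nonpos_right h0 hL)] at hs
  rw [neg_eq_iff_eq_neg.1 hs, mul_neg, mul_one]; rfl

theorem hasDerivAt_left (h : IsGlobalSmoothSolution u lL lR) {t : ℝ} (ht : 0 < t) :
    HasDerivAt lL (deriv lL t) t :=
  ((h.left_smooth.differentiableOn (by simp)).differentiableAt (Ioi_mem_nhds ht)).hasDerivAt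

theorem hasDerivAt_right (h : IsGlobalSmoothSolution u lL lR) {t : ℝ} (ht : 0 < t) :
    HasDerivAt lR (deriv lR t) t :=
  ((h.right_smooth.differentiableOn (by simp)).differentiableAt (Ioi_mem_nhds ht)).hasDerivAt

/-- The velocity of a point of the reference domain. -/
noncomputable def refVelocity (lL lR : ℝ → ℝ) (t x : ℝ) : ℝ :=
  deriv lL t + (deriv lR t - deriv lL t) * x

/-- The third space derivative of the film height, in the reference domain. -/
noncomputable def filmVelocity (u : ℝ → ℝ → ℝ) (lL lR : ℝ → ℝ) (t x : ℝ) : ℝ :=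
  dX 0 1 (dX 0 1 (dX 0 1 (refHeight u lL lR))) t x / (lR t - lL t) ^ 3

theorem continuousOn_filmVelocity (h : IsGlobalSmoothSolution u lL lR) {t : ℝ} (ht : 0 < t) :
    ContinuousOn (filmVelocity u lL lR t) (Icc 0 1) :=
  ((((h.smooth_refHeight.smooth_dX zero_lt_one).smooth_dX zero_lt_one).smooth_dX
    zero_lt_one).continuousOn_slice ht).div_const _

theorem deriv_eq (h : IsGlobalSmoothSolution u lL lR) {t : ℝ} (ht : 0 < t) {x : ℝ}
    (hx : x ∈ Ioo (0 : ℝ) 1) : HasDerivAt (u t)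
      (dX 0 1 (refHeight u lL lR) t x / (lR t - lL t)) (lL t + (lR t - lL t) * x) :=
  hasDerivAt_of_affine (h.lt t ht.le) (F := refHeight u lL lR t) (fun _ _ => rfl)
    (fun _ hz => h.smooth_refHeight.hasDerivAt_space ht hz) hx

theorem filmVelocity_eq (h : IsGlobalSmoothSolution u lL lR) {t : ℝ} (ht : 0 < t) {x : ℝ}
    (hx : x ∈ Ioo (0 : ℝ) 1) :
    iteratedDeriv 3 (u t) (lL t + (lR t - lL t) * x) = filmVelocity u lL lR t x := by
  have s1 := h.smooth_refHeight.smooth_dX zero_lt_one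
  have s2 := s1.smooth_dX zero_lt_one
  have d2 : ∀ z ∈ Ioo (0 : ℝ) 1, HasDerivAt (deriv (u t)) _ (lL t + (lR t - lL t) * z) :=
    fun z hz => hasDerivAt_of_affine (h.lt t ht.le)
      (F := fun z => dX 0 1 (refHeight u lL lR) t z / (lR t - lL t))
      (fun z hz => (h.deriv_eq ht hz).deriv)
      (fun z hz => (s1.hasDerivAt_space ht hz).div_const _) hz
  have d3 : ∀ z ∈ Ioo (0 : ℝ) 1, HasDerivAt (deriv (deriv (u t))) _ (lL t + (lR t - lL t) * z) :=
    fun z hz => hasDerivAt_of_affine (h.lt t ht.le)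
      (F := fun z => dX 0 1 (dX 0 1 (refHeight u lL lR)) t z / (lR t - lL t) / (lR t - lL t))
      (fun z hz => (d2 z hz).deriv)
      (fun z hz => ((s2.hasDerivAt_space ht hz).div_const _).div_const _) hz
  rw [iteratedDeriv_succ, iteratedDeriv_succ, iteratedDeriv_one, (d3 x hx).deriv, filmVelocity]
  have := (h.length_pos ht.le).ne'
  field_simp

/-- Chain rule along a point fixed in the reference interval, which moves with velocity
`refVelocity` in space. -/
theorem dT_refHeight (h : IsGlobalSmoothSolution u lL lR) {t : ℝ} (ht : 0 < t) {x : ℝ}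
    (hx : x ∈ Ioo (0 : ℝ) 1) :
    dT 0 1 (refHeight u lL lR) t x =
      deriv (fun s => u s (lL t + (lR t - lL t) * x)) t
        + dX 0 1 (refHeight u lL lR) t x / (lR t - lL t) * refVelocity lL lR t x := by
  set z := lL t + (lR t - lL t) * x with hz
  -- A point strictly inside the film is interior to the space-time region, so `u` is differentiable
  -- there in the unrestricted sense.
  have hmem : region (Ioi 0) lL lR ∈ 𝓝 (t, z) := by
    have hz' := affine_mem_Ioo (h.lt t ht.le) hx
    have e0 : ∀ᶠ q : ℝ × ℝ in 𝓝 (t, z), 0 < q.1 :=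
      continuous_fst.continuousAt.eventually (lt_mem_nhds ht)
    have cL : ContinuousAt (fun q : ℝ × ℝ => q.2 - lL q.1) (t, z) :=
      continuousAt_snd.sub ((h.hasDerivAt_left ht).continuousAt.comp (x := (t, z))
        (f := Prod.fst) continuousAt_fst)
    have cR : ContinuousAt (fun q : ℝ × ℝ => lR q.1 - q.2) (t, z) :=
      ((h.hasDerivAt_right ht).continuousAt.comp (x := (t, z))
        (f := Prod.fst) continuousAt_fst).sub continuousAt_snd
    filter_upwards [e0, cL.eventually (lt_mem_nhds (sub_pos.2 hz'.1)),
      cR.eventually (lt_mem_nhds (sub_pos.2 hz'.2))] with q h0 h1 h2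
    exact ⟨h0, (sub_pos.1 h1).le, (sub_pos.1 h2).le⟩
  have hd : HasFDerivAt (fun p : ℝ × ℝ => u p.1 p.2) _ (t, z) :=
    ((h.smooth.differentiableOn (by simp)).differentiableAt hmem).hasFDerivAt
  set A := fderiv ℝ (fun p : ℝ × ℝ => u p.1 p.2) (t, z)
  have h1 : HasDerivAt (fun s => u s z) (A (1, 0)) t :=
    hd.comp_hasDerivAt (f := fun s => (s, z)) t ((hasDerivAt_id t).prodMk (hasDerivAt_const t z))
  have h2 : HasDerivAt (u t) (A (0, 1)) z :=
    hd.comp_hasDerivAt (f := fun s => (t, s)) z ((hasDerivAt_const z t).prodMk (hasDerivAt_id z))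
  have h3 : HasDerivAt (fun s => lL s + (lR s - lL s) * x) (refVelocity lL lR t x) t :=
    (h.hasDerivAt_left ht).add (((h.hasDerivAt_right ht).sub (h.hasDerivAt_left ht)).mul_const x)
  have h4 : HasDerivAt (fun s => refHeight u lL lR s x) (A (1, refVelocity lL lR t x)) t :=
    hd.comp_hasDerivAt (f := fun s => (s, lL s + (lR s - lL s) * x)) t
      ((hasDerivAt_id t).prodMk h3)
  rw [(h.smooth_refHeight.hasDerivAt_time ht (Ioo_subset_Icc_self hx)).unique h4, h1.deriv,
    (h.deriv_eq ht hx).unique h2]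
  have : ((1 : ℝ), refVelocity lL lR t x)
      = (1, 0) + refVelocity lL lR t x • ((0 : ℝ), (1 : ℝ)) := by simp
  rw [this, map_add, map_smul, smul_eq_mul, mul_comm]

/-- Conservation of mass, in the reference domain. -/
theorem hasDerivAt_partialMass_time (h : IsGlobalSmoothSolution u lL lR) {t : ℝ} (ht : 0 < t)
    {x : ℝ} (hx : x ∈ Icc (0 : ℝ) 1) :
    HasDerivAt (fun s => partialMass (fun t => lR t - lL t) (refHeight u lL lR) s x)
      (refHeight u lL lR t x * (refVelocity lL lR t x - filmVelocity u lL lR t x)) t := by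
  set U := refHeight u lL lR with hU
  have sU := h.smooth_refHeight
  have sR : SmoothUpTo 0 1 (fun t x => (lR t - lL t) * U t x) := by
    refine ContDiffOn.mul ?_ sU
    exact (h.right_smooth.sub h.left_smooth).comp contDiffOn_fst fun q hq => hq.1
  have hsub : Icc (0 : ℝ) x ⊆ Icc 0 1 := Icc_subset_Icc_right hx.2
  have h1 := (hasDerivWithinAt_parametric_integral (convex_Ioi (0 : ℝ)) hx.1
    (f := fun t x => (lR t - lL t) * U t x)
    (f' := dT 0 1 (fun t x => (lR t - lL t) * U t x))
    (sR.continuousOn.mono (prod_mono_right hsub))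
    ((sR.smooth_dT zero_lt_one).continuousOn.mono (prod_mono_right hsub))
    (fun s hs r hr => (sR.hasDerivAt_time hs (hsub hr)).hasDerivWithinAt) ht).hasDerivAt
    (Ioi_mem_nhds ht)
  have e1 : (fun s => partialMass (fun t => lR t - lL t) U s x)
      = fun s => ∫ r in (0 : ℝ)..x, (lR s - lL s) * U s r := by
    funext s; rw [partialMass, intervalIntegral.integral_const_mul]
  rw [e1]
  refine h1.congr_deriv ?_
  have cV : ContinuousOn (fun z => U t z * (refVelocity lL lR t z - filmVelocity u lL lR t z))
      (Icc 0 1) := by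
    have c1 : Continuous (refVelocity lL lR t) := by unfold refVelocity; fun_prop
    exact (sU.continuousOn_slice ht).mul (c1.continuousOn.sub (h.continuousOn_filmVelocity ht))
  -- By the equation, the time derivative of the density `L U` is the `x`-derivative of `U` times
  -- the velocity of the reference point relative to the film. The flux vanishes at `0` together
  -- with `U`.
  rw [integral_eq_sub_of_interior hx.1 (cV.mono hsub)
    (((sR.smooth_dT zero_lt_one).continuousOn_slice ht).mono hsub) fun z hz => ?_]
  · rw [hU, h.refHeight_left ht.le, zero_mul, sub_zero]
  · have hz1 : z ∈ Ioo (0 : ℝ) 1 := ⟨hz.1, hz.2.trans_le hx.2⟩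
    have hL := (h.length_pos ht.le).ne'
    have dU := sU.hasDerivAt_space ht hz1
    have dv : HasDerivAt (refVelocity lL lR t) (deriv lR t - deriv lL t) z :=
      hasDerivAt_affine _ _ _
    have sj := ((sU.smooth_dX zero_lt_one).smooth_dX zero_lt_one).smooth_dX zero_lt_one
    have dj : ∀ z ∈ Ioo (0 : ℝ) 1, HasDerivAt (fun z => U t z * filmVelocity u lL lR t z)
      _ z := fun z hz => (sU.hasDerivAt_space ht hz).mul
        ((sj.hasDerivAt_space ht hz).div_const ((lR t - lL t) ^ 3))
    have dw := hasDerivAt_of_affine (h.lt t ht.le)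
      (f := fun z => u t z * iteratedDeriv 3 (u t) z)
      (fun z hz => by rw [h.filmVelocity_eq ht hz]; rfl) dj hz1
    have pde := h.equation t ht _ (affine_mem_Ioo (h.lt t ht.le) hz1)
    rw [dw.deriv] at pde
    have dT1 : dT 0 1 (fun t x => (lR t - lL t) * U t x) t z
        = (deriv lR t - deriv lL t) * U t z + (lR t - lL t) * dT 0 1 U t z :=
      (sR.hasDerivAt_time ht (Ioo_subset_Icc_self hz1)).unique
        (((h.hasDerivAt_right ht).sub (h.hasDerivAt_left ht)).mul
          (sU.hasDerivAt_time ht (Ioo_subset_Icc_self hz1)))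
    rw [dT1, h.dT_refHeight ht hz1]
    have e2 : (fun z => U t z * (refVelocity lL lR t z - filmVelocity u lL lR t z))
        = fun z => U t z * refVelocity lL lR t z - U t z * filmVelocity u lL lR t z := by
      funext z; ring
    rw [e2]
    refine ((dU.mul dv).sub (dj z hz1)).congr_deriv ?_
    have pde' := congrArg (fun a => (lR t - lL t) * a) pde
    simp only [mul_add, mul_zero, mul_div_cancel₀ _ hL] at pde'
    rw [mul_add, ← mul_assoc, mul_div_cancel₀ _ hL]
    linear_combination -pde'

theorem mass_eq (h : IsGlobalSmoothSolution u lL lR) (t : ℝ) (ht : 0 ≤ t) :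
    mass u lL lR t = (lR t - lL t) * ∫ x in (0 : ℝ)..1, refHeight u lL lR t x := by
  have hL := (h.length_pos ht).ne'
  simp only [refHeight, mass]
  rw [intervalIntegral.integral_comp_add_mul _ hL, smul_eq_mul, mul_inv_cancel_left₀ hL]
  simp

/-- A solution of mass `2 / 3` gives a film in the reference domain. -/
theorem filmProfile (h : IsGlobalSmoothSolution u lL lR) (hm : mass u lL lR 0 = 2 / 3) :
    FilmProfile (fun t => lR t - lL t) (refHeight u lL lR) (refDeriv 1 u lL lR)
      (refDeriv 2 u lL lR) where
  length_cont := h.right_continuous.sub h.left_continuous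
  length_pos t ht := h.length_pos ht
  length_smooth := h.right_smooth.sub h.left_smooth
  height := h.C1_refHeight
  slope := h.C1_refDeriv (k := 1) (by norm_num)
  smooth := h.smooth_refHeight
  pos t ht x hx := h.refHeight_pos ht hx
  left_zero t ht := h.refHeight_left ht
  right_zero t ht := h.refHeight_right ht
  left_slope t ht := h.refSlope_left ht
  right_slope t ht := h.refSlope_right ht
  mass t ht := by
    have hc : ContinuousOn (fun t => (lR t - lL t) * ∫ x in (0 : ℝ)..1, refHeight u lL lR t x)
        (Ici 0) := (h.right_continuous.sub h.left_continuous).mul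
      (continuousOn_parametric_integral zero_le_one h.C1_refHeight.cont)
    -- The total mass has zero derivative, since the flux also vanishes at `x = 1`.
    have := integral_eq_sub_of_interior ht (hc.mono Icc_subset_Ici_self)
      (f' := fun _ => 0) continuousOn_const fun s hs => by
        have := h.hasDerivAt_partialMass_time hs.1 (x := 1) (by simp)
        rw [h.refHeight_right hs.1.le, zero_mul] at this
        exact this
    rw [intervalIntegral.integral_zero] at this
    have h0 := h.mass_eq 0 le_rfl
    rw [hm] at h0
    linarith

end IsGlobalSmoothSolution

/-! ### The evolution equation in the mass label. -/

namespace FilmProfile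

variable {L : ℝ → ℝ} {U U' U'' : ℝ → ℝ → ℝ}

theorem dX_labelRatio (h : FilmProfile L U U' U'') {t : ℝ} (ht : 0 < t) {y : ℝ}
    (hy : y ∈ Ioo (-1 : ℝ) 1) : dX (-1) 1 (labelRatio L U) t y = labelRatioDeriv L U t y :=
  (h.smooth_labelRatio.hasDerivAt_space ht hy).unique (h.hasDerivAt_labelRatio ht.le hy)

/-- The chain rule for the change of variable from the mass label to the reference domain. -/
theorem dX_div_length (h : FilmProfile L U U' U'') {t : ℝ} (ht : 0 < t) {F : ℝ → ℝ → ℝ}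
    (hF : SmoothUpTo 0 1 F) {f f' : ℝ → ℝ}
    (hf : ∀ y ∈ Ioo (-1 : ℝ) 1, F t (massPoint L U t y) = f y)
    (hd : ∀ y ∈ Ioo (-1 : ℝ) 1, HasDerivAt f (f' y) y) {y : ℝ} (hy : y ∈ Ioo (-1 : ℝ) 1) :
    dX 0 1 F t (massPoint L U t y) / L t = labelRatio L U t y * f' y := by
  have h1 := (hF.hasDerivAt_space ht (h.massPoint_mem_Ioo ht.le hy)).comp y
    (h.hasDerivAt_massPoint ht.le hy)
  have h2 := (hd y hy).congr_of_eventuallyEq (f₁ := F t ∘ massPoint L U t) (by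
    filter_upwards [Ioo_mem_nhds hy.1 hy.2] with z hz using hf z hz)
  rw [← h1.unique h2, ← labelRatio]
  have hV := (h.labelRatio_pos ht.le y).ne'
  have hL := (h.length_pos t ht.le).ne'
  field_simp

end FilmProfile

/-- The velocity of the film in terms of the height ratio and of its derivatives. -/
noncomputable def labelVelocity (y v p g h : ℝ) : ℝ :=
  -(6 * v ^ 3 * p) - y * (7 * v ^ 2 * p ^ 2 + 4 * v ^ 3 * g)
    + (1 - y ^ 2) / 2 * (v * p ^ 3 + 4 * v ^ 2 * p * g + v ^ 3 * h)

theorem hasDerivAt_weight (y : ℝ) : HasDerivAt (fun y : ℝ => (1 - y ^ 2) / 2) (-y) y :=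
  (((hasDerivAt_pow 2 y).const_sub 1).div_const 2).congr_deriv (by push_cast; ring)

/-- Origin of the coefficients in `velocityDeriv`: `labelVelocity` is the expansion of `(v ∂_y)³(φ
v)`. -/
theorem hasDerivAt_labelVelocity {v p g h : ℝ → ℝ} {k y : ℝ} (hv : HasDerivAt v (p y) y)
    (hp : HasDerivAt p (g y) y) (hg : HasDerivAt g (h y) y) (hh : HasDerivAt h k y) :
    HasDerivAt (fun y => labelVelocity y (v y) (p y) (g y) (h y))
      (velocityDeriv y (v y) (p y) (g y) (h y) k) y := by
  have e1 := (((hv.fun_pow 3).const_mul 6).mul hp).neg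
  have e2 := (hasDerivAt_id y).mul ((((hv.fun_pow 2).const_mul 7).mul (hp.fun_pow 2)).add
    (((hv.fun_pow 3).const_mul 4).mul hg))
  have e3 := (hasDerivAt_weight y).mul (((hv.mul (hp.fun_pow 3)).add
    ((((hv.fun_pow 2).const_mul 4).mul hp).mul hg)).add ((hv.fun_pow 3).mul hh))
  refine ((e1.sub e2).add e3).congr_deriv ?_
  simp only [velocityDeriv, Pi.mul_apply, Pi.add_apply, id]
  push_cast
  ring

namespace IsGlobalSmoothSolution

variable {u : ℝ → ℝ → ℝ} {lL lR : ℝ → ℝ}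

/-- The film height at given mass label, divided by that of the stationary film. -/
noncomputable def ratio (u : ℝ → ℝ → ℝ) (lL lR : ℝ → ℝ) : ℝ → ℝ → ℝ :=
  FilmProfile.labelRatio (fun t => lR t - lL t) (refHeight u lL lR)

/-- The mass Lagrangian variable, in the reference domain. -/
noncomputable def refPoint (u : ℝ → ℝ → ℝ) (lL lR : ℝ → ℝ) : ℝ → ℝ → ℝ :=
  FilmProfile.massPoint (fun t => lR t - lL t) (refHeight u lL lR)

/-- The film velocity, expressed by the height ratio. -/
theorem filmVelocity_refPoint (h : IsGlobalSmoothSolution u lL lR) (hm : mass u lL lR 0 = 2 / 3)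
    {t : ℝ} (ht : 0 < t) {y : ℝ} (hy : y ∈ Ioo (-1 : ℝ) 1) :
    filmVelocity u lL lR t (refPoint u lL lR t y) =
      labelVelocity y (ratio u lL lR t y) (dX (-1) 1 (ratio u lL lR) t y)
        (dX (-1) 1 (dX (-1) 1 (ratio u lL lR)) t y)
        (dX (-1) 1 (dX (-1) 1 (dX (-1) 1 (ratio u lL lR))) t y) := by
  have P := h.filmProfile hm
  have I : (-1 : ℝ) < 1 := by norm_num
  have sV : SmoothUpTo (-1) 1 (ratio u lL lR) := P.smooth_labelRatio
  have s1 := sV.smooth_dX I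
  have s2 := s1.smooth_dX I
  have sU := h.smooth_refHeight
  have sU1 := sU.smooth_dX zero_lt_one
  have sU2 := sU1.smooth_dX zero_lt_one
  have hL := (h.length_pos ht.le).ne'
  set v := ratio u lL lR t with hv
  set p := dX (-1) 1 (ratio u lL lR) t with hp
  set g := dX (-1) 1 (dX (-1) 1 (ratio u lL lR)) t with hg
  set k := dX (-1) 1 (dX (-1) 1 (dX (-1) 1 (ratio u lL lR))) t with hk
  have dv : ∀ y ∈ Ioo (-1 : ℝ) 1, HasDerivAt v (p y) y := fun y hy => sV.hasDerivAt_space ht hy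
  have dp : ∀ y ∈ Ioo (-1 : ℝ) 1, HasDerivAt p (g y) y := fun y hy => s1.hasDerivAt_space ht hy
  have dg : ∀ y ∈ Ioo (-1 : ℝ) 1, HasDerivAt g (k y) y := fun y hy => s2.hasDerivAt_space ht hy
  -- Starting from `U = φ v`, the operator `L⁻¹ ∂_x = v ∂_y` is applied three times; `f1`, `f2`,
  -- `f3` are the successive results.
  have f1 : ∀ y ∈ Ioo (-1 : ℝ) 1, dX 0 1 (refHeight u lL lR) t (refPoint u lL lR t y)
      = (lR t - lL t) * (-y * v y ^ 2 + (1 - y ^ 2) / 2 * (v y * p y)) := fun y hy => by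
    have := P.dX_div_length ht sU (f := fun y => (1 - y ^ 2) / 2 * v y)
      (fun y hy => (P.labelRatio_mul ht.le (Ioo_subset_Icc_self hy)).symm)
      (fun y hy => (hasDerivAt_weight y).mul (dv y hy)) hy
    rw [div_eq_iff hL] at this
    refine this.trans ?_
    change v y * _ * _ = _
    ring
  have f2 : ∀ y ∈ Ioo (-1 : ℝ) 1,
      dX 0 1 (dX 0 1 (refHeight u lL lR)) t (refPoint u lL lR t y)
      = (lR t - lL t) ^ 2 * (-v y ^ 3 - 3 * y * (v y ^ 2 * p y)
        + (1 - y ^ 2) / 2 * (v y * p y ^ 2 + v y ^ 2 * g y)) := fun y hy => by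
    have := P.dX_div_length ht sU1 f1
      (fun y hy => (((hasDerivAt_id y).neg.mul ((dv y hy).fun_pow 2)).add
        ((hasDerivAt_weight y).mul ((dv y hy).mul (dp y hy)))).const_mul (lR t - lL t)) hy
    rw [div_eq_iff hL] at this
    refine this.trans ?_
    simp only [id, Pi.mul_apply, Pi.neg_apply]
    change v y * _ * _ = _
    push_cast
    ring
  have f3 := P.dX_div_length ht sU2 f2
      (fun y hy => ((((dv y hy).fun_pow 3).neg.sub (((hasDerivAt_id y).const_mul 3).mul
        (((dv y hy).fun_pow 2).mul (dp y hy)))).add ((hasDerivAt_weight y).mul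
        (((dv y hy).mul ((dp y hy).fun_pow 2)).add (((dv y hy).fun_pow 2).mul
          (dg y hy))))).const_mul ((lR t - lL t) ^ 2)) hy
  rw [div_eq_iff hL] at f3
  rw [filmVelocity, div_eq_iff (pow_ne_zero 3 hL)]
  refine f3.trans ?_
  simp only [id, Pi.mul_apply, Pi.add_apply, labelVelocity]
  change v y * _ * _ = _
  push_cast
  ring

/-- A point of constant label moves with the film velocity. This comes from differentiating `Y(t,
Θ(t, y)) = y`, with `Y_x = L v` and with `φ Y_t` equal to the mass flux; the factor `φ v` then
cancels. -/
theorem dT_refPoint (h : IsGlobalSmoothSolution u lL lR) (hm : mass u lL lR 0 = 2 / 3)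
    {t : ℝ} (ht : 0 < t) {y : ℝ} (hy : y ∈ Ioo (-1 : ℝ) 1) :
    (lR t - lL t) * dT (-1) 1 (refPoint u lL lR) t y =
      filmVelocity u lL lR t (refPoint u lL lR t y)
        - refVelocity lL lR t (refPoint u lL lR t y) := by
  have P := h.filmProfile hm
  have hy' := Ioo_subset_Icc_self hy
  have sY := P.smooth_massLabel
  have sΘ : SmoothUpTo (-1) 1 (refPoint u lL lR) := P.smooth_massPoint
  set Y := massLabel (fun t => lR t - lL t) (refHeight u lL lR) with hY
  set x := refPoint u lL lR t y with hx
  have hxI : x ∈ Ioo (0 : ℝ) 1 := P.massPoint_mem_Ioo ht.le hy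
  have hxI' := Ioo_subset_Icc_self hxI
  have hYx : Y t x = y := P.massLabel_massPoint ht.le hy'
  have h1 := (sY.hasFDerivWithinAt ht hxI').comp_hasDerivWithinAt t
    (f := fun s => (s, refPoint u lL lR s y)) (s := Ioi 0)
    ((hasDerivAt_id t).prodMk (sΘ.hasDerivAt_time ht hy')).hasDerivWithinAt
    (fun s hs => ⟨hs, P.massPoint_mem (le_of_lt hs) hy'⟩)
  have h2 := (h1.hasDerivAt (Ioi_mem_nhds ht)).unique
    ((hasDerivAt_const t y).congr_of_eventuallyEq (by
      filter_upwards [Ioi_mem_nhds ht] with s hs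
      exact P.massLabel_massPoint (le_of_lt hs) hy'))
  have h2' : dT 0 1 Y t x + dX 0 1 Y t x * dT (-1) 1 (refPoint u lL lR) t y = 0 := by
    simpa using h2
  have h3 := (hasDerivAt_massProfile (1 + Y t x)).comp t
    ((sY.hasDerivAt_time ht hxI').const_add 1)
  have h4 := h3.unique ((h.hasDerivAt_partialMass_time ht hxI').congr_of_eventuallyEq (by
    filter_upwards [Ioi_mem_nhds ht] with s hs
    exact P.massProfile_massLabel (le_of_lt hs) hxI'))
  have h5 := P.heightRatio_mul ht.le hxI'
  rw [← hY] at h5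
  have hne : (1 - y ^ 2) / 2 ≠ 0 := by nlinarith [hy.1, hy.2]
  have hV := P.heightRatio_pos ht.le x
  rw [P.dX_massLabel ht hxI'] at h2'
  rw [hYx] at h4 h5
  refine mul_left_cancel₀ (mul_ne_zero hne hV.ne') ?_
  linear_combination (1 - y ^ 2) / 2 * h2' - h4
    + (refVelocity lL lR t x - filmVelocity u lL lR t x) * h5

/-- The evolution equation of the height ratio. -/
theorem dT_ratio (h : IsGlobalSmoothSolution u lL lR) (hm : mass u lL lR 0 = 2 / 3)
    {t : ℝ} (ht : 0 < t) {y : ℝ} (hy : y ∈ Ioo (-1 : ℝ) 1) :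
    dT (-1) 1 (ratio u lL lR) t y = -(ratio u lL lR t y ^ 2 *
      velocityDeriv y (ratio u lL lR t y) (dX (-1) 1 (ratio u lL lR) t y)
        (dX (-1) 1 (dX (-1) 1 (ratio u lL lR)) t y)
        (dX (-1) 1 (dX (-1) 1 (dX (-1) 1 (ratio u lL lR))) t y)
        (dX (-1) 1 (dX (-1) 1 (dX (-1) 1 (dX (-1) 1 (ratio u lL lR)))) t y)) := by
  have P := h.filmProfile hm
  have I : (-1 : ℝ) < 1 := by norm_num
  have sV : SmoothUpTo (-1) 1 (ratio u lL lR) := P.smooth_labelRatio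
  have s1 := sV.smooth_dX I
  have s2 := s1.smooth_dX I
  have s3 := s2.smooth_dX I
  have sΘ : SmoothUpTo (-1) 1 (refPoint u lL lR) := P.smooth_massPoint
  have hlen : ContDiffOn ℝ ∞ (fun q : ℝ × ℝ => lR q.1 - lL q.1) (Ioi 0 ×ˢ Icc (-1) 1) :=
    (h.right_smooth.sub h.left_smooth).comp contDiffOn_fst fun q hq => hq.1
  have hleft : ContDiffOn ℝ ∞ (fun q : ℝ × ℝ => lL q.1) (Ioi 0 ×ˢ Icc (-1) 1) :=
    h.left_smooth.comp contDiffOn_fst fun q hq => hq.1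
  set Z : ℝ → ℝ → ℝ := fun t y => lL t + (lR t - lL t) * refPoint u lL lR t y with hZ
  have sZ : SmoothUpTo (-1) 1 Z := hleft.add (hlen.mul sΘ)
  -- In the physical variable, `Z_t` is the film velocity and `Z_y = 1/v`. Commuting the two
  -- derivatives of `Z` gives the equation for `v`.
  have Zt : ∀ y ∈ Ioo (-1 : ℝ) 1, dT (-1) 1 Z t y
      = filmVelocity u lL lR t (refPoint u lL lR t y) := fun y hy => by
    rw [(sZ.hasDerivAt_time ht (Ioo_subset_Icc_self hy)).unique ((h.hasDerivAt_left ht).add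
      (((h.hasDerivAt_right ht).sub (h.hasDerivAt_left ht)).mul
      (sΘ.hasDerivAt_time ht (Ioo_subset_Icc_self hy))))]
    have := h.dT_refPoint hm ht hy
    rw [refVelocity] at this
    simp only [Pi.sub_apply]
    linarith
  have Zy : ∀ s, 0 < s → dX (-1) 1 Z s y = (ratio u lL lR s y)⁻¹ := fun s hs => by
    rw [(sZ.hasDerivAt_space hs hy).unique
      (((P.hasDerivAt_massPoint hs.le hy).const_mul (lR s - lL s)).const_add (lL s))]
    have hL := (h.length_pos hs.le).ne'
    rw [mul_inv, mul_inv_cancel_left₀ hL]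
    rfl
  have e1 := sZ.dT_dX_comm I ht (Ioo_subset_Icc_self hy)
  have hV : ratio u lL lR t y ≠ 0 := (P.labelRatio_pos ht.le y).ne'
  have e2 := ((sZ.smooth_dX I).hasDerivAt_time ht (Ioo_subset_Icc_self hy)).unique
    (((sV.hasDerivAt_time ht (Ioo_subset_Icc_self hy)).inv hV).congr_of_eventuallyEq (by
      filter_upwards [Ioi_mem_nhds ht] with s hs
      exact Zy s hs))
  have e3 := ((sZ.smooth_dT I).hasDerivAt_space ht hy).unique
    ((hasDerivAt_labelVelocity (sV.hasDerivAt_space ht hy) (s1.hasDerivAt_space ht hy)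
      (s2.hasDerivAt_space ht hy) (s3.hasDerivAt_space ht hy)).congr_of_eventuallyEq (by
      filter_upwards [Ioo_mem_nhds hy.1 hy.2] with z hz
      rw [Zt z hz, h.filmVelocity_refPoint hm ht hz]))
  rw [e2, e3, div_eq_iff (pow_ne_zero 2 hV)] at e1
  linarith

end IsGlobalSmoothSolution

/-! ### Energy decay and distance to the stationary film. -/

namespace IsGlobalSmoothSolution

variable {u : ℝ → ℝ → ℝ} {lL lR : ℝ → ℝ}

/-- The derivative of the height ratio with respect to the mass label, up to the initial time. -/
noncomputable def ratioDeriv (u : ℝ → ℝ → ℝ) (lL lR : ℝ → ℝ) : ℝ → ℝ → ℝ :=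
  FilmProfile.labelRatioDeriv (fun t => lR t - lL t) (refHeight u lL lR)

theorem partialMass_eq_integral (h : IsGlobalSmoothSolution u lL lR) {t : ℝ} (ht : 0 ≤ t)
    (x : ℝ) : ∫ ξ in (lL t)..(lL t + (lR t - lL t) * x), u t ξ
      = partialMass (fun t => lR t - lL t) (refHeight u lL lR) t x := by
  have hL := (h.length_pos ht).ne'
  simp only [refHeight, partialMass]
  rw [intervalIntegral.integral_comp_add_mul _ hL, smul_eq_mul, mul_inv_cancel_left₀ hL]
  simp

/-- The set defining the infimum is a singleton: `massProfile` is injective on `[0, 2]` and a label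
determines its point. -/
theorem lagrangianZ_eq (h : IsGlobalSmoothSolution u lL lR) (hm : mass u lL lR 0 = 2 / 3)
    {t : ℝ} (ht : 0 ≤ t) {y : ℝ} (hy : y ∈ Icc (-1 : ℝ) 1) :
    lagrangianZ u lL lR t y = lL t + (lR t - lL t) * refPoint u lL lR t y := by
  have P := h.filmProfile hm
  have hmem := P.massPoint_mem ht hy
  have hpos := h.length_pos ht
  have hset : {x | x ∈ Icc (lL t) (lR t) ∧
      ∫ ξ in (lL t)..x, u t ξ = (1 / 2) * ∫ s in (-1 : ℝ)..y, (1 - s ^ 2)}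
      = {lL t + (lR t - lL t) * refPoint u lL lR t y} := by
    ext x
    simp only [mem_ofPred_eq, mem_singleton_iff, massProfile_eq_integral]
    constructor
    · rintro ⟨hx, e⟩
      have hz : (x - lL t) / (lR t - lL t) ∈ Icc (0 : ℝ) 1 :=
        ⟨div_nonneg (by linarith [hx.1]) hpos.le, (div_le_one hpos).2 (by linarith [hx.2])⟩
      have hxz : x = lL t + (lR t - lL t) * ((x - lL t) / (lR t - lL t)) := by
        rw [mul_div_cancel₀ _ hpos.ne']; ring
      rw [hxz, h.partialMass_eq_integral ht, ← P.massProfile_massLabel ht hz] at e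
      have e' := strictMonoOn_massProfile.injOn (P.massLabel_mem ht hz)
        ⟨by linarith [hy.1], by linarith [hy.2]⟩ e
      have := P.massPoint_eq ht hz (add_left_cancel e')
      rw [hxz, ← this]
      rfl
    · rintro rfl
      refine ⟨affine_mem_Icc (h.lt t ht) hmem, ?_⟩
      have hl := P.massLabel_massPoint ht hy
      rw [h.partialMass_eq_integral ht, refPoint, ← P.massProfile_massLabel ht hmem, hl]
  rw [lagrangianZ, hset, csInf_singleton]

theorem uTilde_eq (h : IsGlobalSmoothSolution u lL lR) (hm : mass u lL lR 0 = 2 / 3)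
    {t : ℝ} (ht : 0 ≤ t) {y : ℝ} (hy : y ∈ Icc (-1 : ℝ) 1) :
    uTilde u lL lR t y = (1 - y ^ 2) / 2 * ratio u lL lR t y := by
  rw [uTilde, h.lagrangianZ_eq hm ht hy, ratio, (h.filmProfile hm).labelRatio_mul ht hy]
  rfl

theorem uInf_eq {y : ℝ} (hy : y ∈ Icc (-1 : ℝ) 1) : uInf y = (1 - y ^ 2) / 2 := by
  rw [uInf, max_eq_left (by nlinarith [hy.1, hy.2])]; ring

theorem energy_eq (h : IsGlobalSmoothSolution u lL lR) (hm : mass u lL lR 0 = 2 / 3)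
    {t : ℝ} (ht : 0 ≤ t) :
    energy u lL lR t = (1 / 2) * ∫ y in (-1 : ℝ)..1, ratioDeriv u lL lR t y ^ 2 := by
  rw [energy]
  congr 1
  refine intervalIntegral.integral_congr_ae ?_
  -- The interval integral runs over `(-1, 1]`, whereas the derivative is identified only on the
  -- open interval.
  have h1 : ∀ᵐ y : ℝ, y ≠ 1 := by simp [ae_iff]
  filter_upwards [h1] with y hy1 hy
  rw [uIoc_of_le (by norm_num)] at hy
  have hyo : y ∈ Ioo (-1 : ℝ) 1 := ⟨hy.1, lt_of_le_of_ne hy.2 hy1⟩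
  rw [sq_abs, (((h.filmProfile hm).hasDerivAt_labelRatio ht hyo).congr_of_eventuallyEq ?_).deriv]
  · rfl
  · filter_upwards [Ioo_mem_nhds hyo.1 hyo.2] with z hz
    have hz' := Ioo_subset_Icc_self hz
    have hne : (1 - z ^ 2) / 2 ≠ 0 := by nlinarith [hz.1, hz.2]
    rw [h.uTilde_eq hm ht hz', uInf_eq hz', mul_div_cancel_left₀ _ hne]
    rfl

/-- Time `0` is included, so the differential inequality, valid for `t > 0`, can be integrated from
the initial energy. -/
theorem continuousOn_energy (h : IsGlobalSmoothSolution u lL lR) (hm : mass u lL lR 0 = 2 / 3) :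
    ContinuousOn (energy u lL lR) (Ici 0) := by
  have hc := continuousOn_parametric_integral (X := ℝ) (S := Ici 0) (a := -1) (b := 1)
    (f := fun t y => ratioDeriv u lL lR t y ^ 2) (by norm_num)
    ((h.filmProfile hm).continuousOn_labelRatioDeriv.pow 2)
  exact (continuousOn_const.mul hc).congr fun t ht => h.energy_eq hm ht

theorem energy_eq_dX (h : IsGlobalSmoothSolution u lL lR) (hm : mass u lL lR 0 = 2 / 3)
    {t : ℝ} (ht : 0 < t) :
    energy u lL lR t = (1 / 2) * ∫ y in (-1 : ℝ)..1, dX (-1) 1 (ratio u lL lR) t y ^ 2 := by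
  rw [h.energy_eq hm ht.le]
  congr 1
  refine intervalIntegral.integral_congr_ae ?_
  have h1 : ∀ᵐ y : ℝ, y ≠ 1 := by simp [ae_iff]
  filter_upwards [h1] with y hy1 hy
  rw [uIoc_of_le (by norm_num)] at hy
  rw [ratio, (h.filmProfile hm).dX_labelRatio ht ⟨hy.1, lt_of_le_of_ne hy.2 hy1⟩]
  rfl

/-- Dissipation of the energy. -/
theorem exists_hasDerivAt_energy (h : IsGlobalSmoothSolution u lL lR)
    (hm : mass u lL lR 0 = 2 / 3) {t : ℝ} (ht : 0 < t)
    (he : energy u lL lR t ≤ (1 / 2) * (1 / 1000) ^ 2) :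
    ∃ E' : ℝ, HasDerivAt (energy u lL lR) E' t ∧ E' ≤ -2 * energy u lL lR t := by
  have P := h.filmProfile hm
  have I : (-1 : ℝ) < 1 := by norm_num
  have sV : SmoothUpTo (-1) 1 (ratio u lL lR) := P.smooth_labelRatio
  have s1 := sV.smooth_dX I
  have s2 := s1.smooth_dX I
  have s3 := s2.smooth_dX I
  have s4 := s3.smooth_dX I
  have sT := sV.smooth_dT I
  have ss : SmoothUpTo (-1) 1 (fun t y => dX (-1) 1 (ratio u lL lR) t y ^ 2) := ContDiffOn.pow s1 2
  have sp : SmoothUpTo (-1) 1 (fun t y => 2 * (dX (-1) 1 (ratio u lL lR) t y *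
      dT (-1) 1 (dX (-1) 1 (ratio u lL lR)) t y)) :=
    contDiffOn_const.mul (ContDiffOn.mul s1 (s1.smooth_dT I))
  have hd := (hasDerivWithinAt_parametric_integral (convex_Ioi (0 : ℝ)) I.le
    (f := fun t y => dX (-1) 1 (ratio u lL lR) t y ^ 2)
    (f' := fun t y => 2 * (dX (-1) 1 (ratio u lL lR) t y *
      dT (-1) 1 (dX (-1) 1 (ratio u lL lR)) t y)) ss.continuousOn sp.continuousOn
    (fun s hs y hy => (((s1.hasDerivAt_time hs hy).fun_pow 2).congr_deriv
      (by push_cast; ring)).hasDerivWithinAt) ht).hasDerivAt (Ioi_mem_nhds ht)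
  refine ⟨_, (hd.const_mul (1 / 2)).congr_of_eventuallyEq ?_, ?_⟩
  · filter_upwards [Ioi_mem_nhds ht] with s hs
    exact h.energy_eq_dX hm hs
  · rw [h.energy_eq_dX hm ht] at he ⊢
    have hD := dissipation_le (sV.continuousOn_slice ht) (s1.continuousOn_slice ht)
      (s2.continuousOn_slice ht) (s3.continuousOn_slice ht) (s4.continuousOn_slice ht)
      (fun y hy => sV.hasDerivAt_space ht hy) (fun y hy => s1.hasDerivAt_space ht hy)
      (fun y hy => s2.hasDerivAt_space ht hy) (fun y hy => s3.hasDerivAt_space ht hy)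
      (P.labelRatio_left ht.le) (P.labelRatio_right ht.le) (by linarith)
    -- `v = 1` at both ends for all times, so `v_t = 0` there and the integration by parts below has
    -- no boundary term.
    have bL : dT (-1) 1 (ratio u lL lR) t (-1) = 0 :=
      (sV.hasDerivAt_time ht (by simp)).unique ((hasDerivAt_const t 1).congr_of_eventuallyEq (by
        filter_upwards [Ioi_mem_nhds ht] with s hs
        exact P.labelRatio_left (le_of_lt hs)))
    have bR : dT (-1) 1 (ratio u lL lR) t 1 = 0 :=
      (sV.hasDerivAt_time ht (by simp)).unique ((hasDerivAt_const t 1).congr_of_eventuallyEq (by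
        filter_upwards [Ioi_mem_nhds ht] with s hs
        exact P.labelRatio_right (le_of_lt hs)))
    have c1 := s1.continuousOn_slice ht
    have c2 := s2.continuousOn_slice ht
    have cT := sT.continuousOn_slice ht
    have cm := (s1.smooth_dT I).continuousOn_slice ht
    have ibp := integral_eq_sub_of_interior I.le (c1.mul cT)
      (f' := fun y => dX (-1) 1 (dX (-1) 1 (ratio u lL lR)) t y * dT (-1) 1 (ratio u lL lR) t y
        + dX (-1) 1 (ratio u lL lR) t y * dT (-1) 1 (dX (-1) 1 (ratio u lL lR)) t y)
      ((c2.mul cT).add (c1.mul cm)) fun y hy => by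
        rw [sV.dT_dX_comm I ht (Ioo_subset_Icc_self hy)]
        exact (s1.hasDerivAt_space ht hy).mul (sT.hasDerivAt_space ht hy)
    have i1 : IntervalIntegrable (fun y => dX (-1) 1 (dX (-1) 1 (ratio u lL lR)) t y *
        dT (-1) 1 (ratio u lL lR) t y) volume (-1) 1 :=
      (c2.mul cT).intervalIntegrable_of_Icc I.le
    have i2 : IntervalIntegrable (fun y => dX (-1) 1 (ratio u lL lR) t y *
        dT (-1) 1 (dX (-1) 1 (ratio u lL lR)) t y) volume (-1) 1 :=
      (c1.mul cm).intervalIntegrable_of_Icc I.le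
    rw [intervalIntegral.integral_add i1 i2] at ibp
    simp only [Pi.mul_apply, bL, bR, mul_zero, sub_zero] at ibp
    have hT : ∫ y in (-1 : ℝ)..1, dX (-1) 1 (dX (-1) 1 (ratio u lL lR)) t y *
        dT (-1) 1 (ratio u lL lR) t y = -∫ y in (-1 : ℝ)..1, ratio u lL lR t y ^ 2 *
        dX (-1) 1 (dX (-1) 1 (ratio u lL lR)) t y *
        velocityDeriv y (ratio u lL lR t y) (dX (-1) 1 (ratio u lL lR) t y)
        (dX (-1) 1 (dX (-1) 1 (ratio u lL lR)) t y)
        (dX (-1) 1 (dX (-1) 1 (dX (-1) 1 (ratio u lL lR))) t y)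
        (dX (-1) 1 (dX (-1) 1 (dX (-1) 1 (dX (-1) 1 (ratio u lL lR)))) t y) := by
      rw [← intervalIntegral.integral_neg]
      refine intervalIntegral.integral_congr_ae ?_
      have h1 : ∀ᵐ y : ℝ, y ≠ 1 := by simp [ae_iff]
      filter_upwards [h1] with y hy1 hy
      rw [uIoc_of_le I.le] at hy
      rw [h.dT_ratio hm ht ⟨hy.1, lt_of_le_of_ne hy.2 hy1⟩]
      ring
    rw [intervalIntegral.integral_const_mul]
    linarith

theorem energy_nonneg (t : ℝ) : 0 ≤ energy u lL lR t :=
  mul_nonneg (by norm_num) (intervalIntegral.integral_nonneg (by norm_num) fun _ _ => sq_nonneg _)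

theorem energy_decay (h : IsGlobalSmoothSolution u lL lR) (hm : mass u lL lR 0 = 2 / 3)
    (h0 : energy u lL lR 0 < (1 / 2) * (1 / 1000) ^ 2) {t : ℝ} (ht : 0 ≤ t) :
    energy u lL lR t ≤ energy u lL lR 0 * Real.exp (-2 * t) := by
  set c : ℝ := (1 / 2) * (1 / 1000) ^ 2 with hc
  have hE := h.continuousOn_energy hm
  -- as long as the energy is small, it decays
  have decay : ∀ T, 0 ≤ T → (∀ s ∈ Ioo 0 T, energy u lL lR s ≤ c) →
      energy u lL lR T * Real.exp (2 * T) ≤ energy u lL lR 0 := fun T hT hs => by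
    have hanti : AntitoneOn (fun s => energy u lL lR s * Real.exp (2 * s)) (Icc 0 T) := by
      have hder : ∀ s ∈ Ioo 0 T, ∃ F' ≤ 0,
          HasDerivAt (fun s => energy u lL lR s * Real.exp (2 * s)) F' s := fun s hs' => by
        obtain ⟨E', hE', hle⟩ := h.exists_hasDerivAt_energy hm hs'.1 (hs s hs')
        refine ⟨_, ?_, hE'.mul (((hasDerivAt_id s).const_mul 2).exp)⟩
        simp only [id, mul_one]
        have := Real.exp_pos (2 * s)
        nlinarith
      refine antitoneOn_of_deriv_nonpos (convex_Icc 0 T)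
        ((hE.mono Icc_subset_Ici_self).mul (by fun_prop)) (fun s hs' => ?_) fun s hs' => ?_
      · rw [interior_Icc] at hs'
        obtain ⟨F', -, hF'⟩ := hder s hs'
        exact hF'.differentiableAt.differentiableWithinAt
      · rw [interior_Icc] at hs'
        obtain ⟨F', hle, hF'⟩ := hder s hs'
        rw [hF'.deriv]; exact hle
    simpa using hanti (left_mem_Icc.2 hT) (right_mem_Icc.2 hT) hT
  -- Continuity argument: at the first time `T` with `E ≥ c`, the decay valid before `T` would give
  -- `c ≤ E(T) ≤ E(0) < c`.
  have small : ∀ T, 0 ≤ T → energy u lL lR T < c := by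
    by_contra! hcon
    obtain ⟨T₁, hT₁, hbig⟩ := hcon
    set S := Icc 0 T₁ ∩ energy u lL lR ⁻¹' Ici c with hS
    have hSc : IsClosed S :=
      (hE.mono Icc_subset_Ici_self).preimage_isClosed_of_isClosed isClosed_Icc isClosed_Ici
    have hSn : S.Nonempty := ⟨T₁, ⟨hT₁, le_rfl⟩, hbig⟩
    have hSb : BddBelow S := ⟨0, fun s hs => hs.1.1⟩
    have hmem := hSc.csInf_mem hSn hSb
    set T := sInf S
    have hT0 : 0 ≤ T := hmem.1.1
    have hlt : ∀ s ∈ Ioo 0 T, energy u lL lR s ≤ c := fun s hs => by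
      by_contra! hc'
      exact absurd (csInf_le hSb ⟨⟨hs.1.le, hs.2.le.trans hmem.1.2⟩, hc'.le⟩) (not_le.2 hs.2)
    have h1 := decay T hT0 hlt
    have h2 : energy u lL lR T ≤ energy u lL lR T * Real.exp (2 * T) :=
      le_mul_of_one_le_right (energy_nonneg T) (Real.one_le_exp (by linarith))
    have h3 : c ≤ energy u lL lR T := hmem.2
    linarith
  have := decay t ht fun s hs => (small s hs.1.le).le
  rw [neg_mul, Real.exp_neg, ← div_eq_mul_inv, le_div_iff₀ (Real.exp_pos _)]
  exact this

/-- The energy controls the distance to the stationary film. -/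
theorem supDist_le (h : IsGlobalSmoothSolution u lL lR) (hm : mass u lL lR 0 = 2 / 3)
    {t : ℝ} (ht : 0 ≤ t) : supDist u lL lR t ≤ ENNReal.ofReal √(energy u lL lR t) := by
  have P := h.filmProfile hm
  rw [supDist, eLpNorm_exponent_top]
  refine eLpNormEssSup_le_of_ae_bound ?_
  refine (ae_restrict_iff' measurableSet_Ioo).2 (Eventually.of_forall fun y hy => ?_)
  have hy' := Ioo_subset_Icc_self hy
  rw [h.uTilde_eq hm ht hy', uInf_eq hy', Real.norm_eq_abs]
  apply Real.abs_le_sqrt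
  -- This gives `(v - 1)² ≤ 2 E`; since `ũ - u^∞ = φ (v - 1)` and `φ ≤ 1/2`, the square of the
  -- distance is at most `E / 2`.
  have key := sq_le_of_dirichlet (w := fun y => ratio u lL lR t y - 1) (p := ratioDeriv u lL lR t)
    ((continuousOn_slice P.continuousOn_labelRatio (x := t) ht).sub continuousOn_const)
    (continuousOn_slice P.continuousOn_labelRatioDeriv (x := t) ht)
    (fun y hy => (P.hasDerivAt_labelRatio ht hy).sub_const 1)
    (sub_eq_zero.2 (P.labelRatio_left ht)) (sub_eq_zero.2 (P.labelRatio_right ht)) hy'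
  have hE := h.energy_eq hm ht
  have hE0 := energy_nonneg (u := u) (lL := lL) (lR := lR) t
  have hφ0 : 0 ≤ (1 - y ^ 2) := by nlinarith [hy.1, hy.2]
  have hφ1 : (1 - y ^ 2) ≤ 1 := by linarith [sq_nonneg y]
  have hi : ∫ s in (-1 : ℝ)..1, ratioDeriv u lL lR t s ^ 2 = 2 * energy u lL lR t := by
    rw [hE]; ring
  rw [hi] at key
  calc ((1 - y ^ 2) / 2 * ratio u lL lR t y - (1 - y ^ 2) / 2) ^ 2
      = (1 - y ^ 2) ^ 2 / 4 * (ratio u lL lR t y - 1) ^ 2 := by ring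
    _ ≤ 1 / 4 * (1 * (2 * energy u lL lR t)) := by
        have h1 : (1 - y ^ 2) ^ 2 ≤ 1 := by nlinarith
        have h2 : (ratio u lL lR t y - 1) ^ 2 ≤ 1 * (2 * energy u lL lR t) :=
          key.trans (by gcongr)
        gcongr
    _ ≤ energy u lL lR t := by linarith

end IsGlobalSmoothSolution

end ThinFilm

theorem corollary1p3 :
    ∃ c₀ : ℝ, 0 < c₀ ∧ ∃ γ : ℝ, 0 < γ ∧ ∃ C : ℝ, 0 < C ∧
      ∀ (u : ℝ → ℝ → ℝ) (lL lR : ℝ → ℝ),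
        ThinFilm.IsGlobalSmoothSolution u lL lR →
        ThinFilm.mass u lL lR 0 = 2 / 3 →
        ThinFilm.centerOfMass u lL lR 0 = 0 →
        ThinFilm.energy u lL lR 0 < c₀ →
        ThinFilm.supDist u lL lR 0 ≤ ENNReal.ofReal (C * c₀) ∧
        ∀ t : ℝ, 0 ≤ t →
          ThinFilm.energy u lL lR t ≤ ThinFilm.energy u lL lR 0 * Real.exp (-γ * t) ∧
          ThinFilm.supDist u lL lR t ≤ ENNReal.ofReal (C * Real.exp (-(γ / 2) * t)) := by
  -- `c₀` corresponds to `∫ v_y² < 10⁻⁶`, the smallness needed in `dissipation_le`, and `γ = 2` is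
  -- its rate. `C = 2000` suffices for `√c₀ ≤ C c₀`, that is `C ≥ 1 / √c₀ ≈ 1414`; for the decay
  -- bound any `C ≥ √c₀` would do.
  refine ⟨1 / 2 * (1 / 1000) ^ 2, by norm_num, 2, by norm_num, 2000, by norm_num,
    fun u lL lR h hm _ h0 => ⟨?_, fun t ht => ⟨h.energy_decay hm h0 ht, ?_⟩⟩⟩
  · refine (h.supDist_le hm le_rfl).trans (ENNReal.ofReal_le_ofReal (Real.sqrt_le_iff.2 ⟨?_, ?_⟩))
    · norm_num
    · linarith
  · refine (h.supDist_le hm ht).trans (ENNReal.ofReal_le_ofReal (Real.sqrt_le_iff.2 ⟨?_, ?_⟩))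
    · positivity
    · have hE := h.energy_decay hm h0 ht
      have hexp : Real.exp (-(2 / 2) * t) ^ 2 = Real.exp (-2 * t) := by
        rw [← Real.exp_nat_mul]; congr 1; push_cast; ring
      rw [mul_pow, hexp]
      have := Real.exp_pos (-2 * t)
      nlinarith
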